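/- \textbf{Setting.} Fix $D\ge 1$ and constants $\kappa,h_0$. A lattice $\Lambda$ is a finite metric space of sites with distances $d_{ij}\ge 1$ for $i\ne j$ in which every ball of radius $r\ge 0$ has at most $\kappa(1+r)^D$ sites. Each site carries a finite-dimensional spin and finitely many fermionic modes (either may be absent). An operator is supported on $X\subseteq\Lambda$ if it belongs to the algebra generated by the operators on the spins in $X$ and the even products of fermion creation and annihilation operators in $X$. Let $H=\sum_{X\subseteq\Lambda}h_X$ with $h_X$ Hermitian and supported on $X$; $\|\cdot\|$ is the operator norm and $A(t)=e^{iHt}Ae^{-iHt}$. For nonempty disjoint $X,Y$ put $d_{XY}=\min_{i\in X,j\in Y}d_{ij}$. We say that $H$ satisfies the Lieb--Robinson bound (LRB) with function $c(r,t)$ if $\|[A(t),B]\|\le |X||Y|\,\|A\|\|B\|\,c(d_{XY},|t|)$ for all nonempty disjoint $X,Y$, all $A,B$ supported on $X,Y$, and all $t\in\mathbb R$. Let $S_X,V_Y$ be Hermitian and supported on nonempty disjoint $X,Y$, and let $d\ge1$, $\Delta>0$. Assume that for every $\lambda\in[0,1]$ there are orthonormal eigenvectors $|G^1(\lambda)\rangle,\dots,|G^d(\lambda)\rangle$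 of $H(\lambda)=H+\lambda V_Y$ with eigenvalues $E_0^a(\lambda)$ (not necessarily equal), such that every eigenvalue $e$ of $H(\lambda)$ on their orthogonal complement satisfies $e\ge E_0^a(\lambda)+\Delta$ for all $a$. Put $\langle O\rangle_\lambda=\frac1d\sum_{a=1}^d\langle G^a(\lambda)|O|G^a(\lambda)\rangle$, $\bar P_G(\lambda)=1-\sum_a|G^a(\lambda)\rangle\langle G^a(\lambda)|$ and $\delta\langle S_X\rangle=\langle S_X\rangle_{1}-\langle S_X\rangle_{0}$. \textbf{Theorem.} (0) For arbitrary Hermitian operators $H,V,S$ on the Hilbert space of such a system, with $H+\lambda V$ satisfying the gap assumption above, and for every $\lambda\in[0,1]$ (one-sided derivatives at the end points), $$\partial_\lambda\langle S\rangle_\lambda=-\frac1d\sum_{a=1}^d\langle G^a(\lambda)|\,S\,\frac{\bar P_G(\lambda)}{H(\lambda)-E_0^a(\lambda)}\,V\,|G^a(\lambda)\rangle+\mathrm{c.c.}$$ In (1)--(3) the polynomial $P$ (of degree at most two, with nonnegative coefficients) and the constant $C'$ depend only on $D,\kappa,h_0$, on the constants named in the item, on $\Delta$, and on upper bounds for $|X|,|Y|,\|S_X\|,\|V_Y\|$;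 not on $\Lambda$, the local degrees of freedom, $d$, $H$, or the positions of $X,Y$. (1) Power-law interactions. Let $\alpha>D$ and consider the $H$ with $\sum_{X\ni i,j}\|h_X\|\le h_0 d_{ij}^{-\alpha}$ for all $i\neq j$. There are $v,C>0$ depending only on $D,\kappa,h_0,\alpha$ such that every such $H$ satisfies the LRB with $c(r,t)=Ce^{vt}/r^\alpha$. For all $v,C,\Delta>0$ there is $P$ such that, for every such $H$ satisfying the LRB with this $c$, $$|\delta\langle S_X\rangle|\le P(\ln d_{XY})\,d_{XY}^{-\alpha_1},\qquad \alpha_1=\frac{2\alpha}{\pi}\arcsin\Bigl(\tanh\frac{\Delta\pi}{2v}\Bigr).$$ (2) Two-body power-law interactions. Let $\alpha>2D$ and $R\in\mathbb R$. There is $C'$ such that $|\delta\langle S_X\rangle|\le C' d_{XY}^{-\alpha}$ for every $H$ as in (1) in which, in addition, each $X$ with $h_X\ne0$ is contained in the union of two balls of radius $R$ (so $|X|\le 2$ if $R=0$). (3) Short-range interactions. Let $\mu>0$ and consider the $H$ with $\sum_{X\ni i,j}\|h_X\|\le h_0e^{-\mu d_{ij}}$ for all $i\ne j$. For every $0<\nu<\mu$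 there are $v,C>0$ depending only on $D,\kappa,h_0,\mu,\nu$ such that every such $H$ satisfies the LRB with $c(r,t)=Ce^{-\nu(r-vt)}$. For all $\nu,v,C,\Delta>0$ (in particular $\nu=\mu$) there is $P$ such that, for every such $H$ satisfying the LRB with this $c$, $$|\delta\langle S_X\rangle|\le P(d_{XY})\,e^{-\mu_1d_{XY}},\qquad \mu_1=\frac{2\nu}{\pi}\arcsin\Bigl(\tanh\frac{\Delta\pi}{2\nu v}\Bigr).$$ -/

import Mathlib

open scoped Matrix Matrix.Norms.L2Operator

noncomputable section

namespace LPPL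

/-- A finite `D`-dimensional lattice: a finite metric space of sites whose spacing is at least one
(the unit of length) and in which a ball of radius `r` has at most `κ (1 + r) ^ D` sites.  Boxes and
tori of any size in `ℤ ^ D` satisfy this with one common `κ`; a bound that is uniform over all
`Lattice D κ` is uniform in the system size. -/
structure Lattice (D : ℕ) (κ : ℝ) where
  site : Type
  [instFintype : Fintype site]
  [instDecidableEq : DecidableEq site]
  [instMetricSpace : MetricSpace site]
  one_le_dist : ∀ i j : site, i ≠ j → 1 ≤ dist i j
  card_ball_le : ∀ (i : site) (r : ℝ), 0 ≤ r →
    ((Set.ncard {j : site | dist i j ≤ r} : ℕ) : ℝ) ≤ κ * (1 + r) ^ D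

attribute [instance] Lattice.instFintype Lattice.instDecidableEq Lattice.instMetricSpace

/-- The degrees of freedom: site `i` carries a spin with a `spinDim i`-dimensional Hilbert space and
`modes i` fermionic modes.  Pure spin systems are the case `modes = 0`, pure fermion systems the
case `spinDim = 1`. -/
structure Model {D : ℕ} {κ : ℝ} (L : Lattice D κ) where
  spinDim : L.site → ℕ
  modes : L.site → ℕ

variable {D : ℕ} {κ : ℝ} {L : Lattice D κ}

namespace Model

/-- The fermionic modes, as pairs of a site and a label. -/
abbrev Mode (M : Model L) : Type := Σ i : L.site, Fin (M.modes i)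

/-- The labels of the standard product basis: a spin configuration and occupation numbers. -/
abbrev Config (M : Model L) : Type := (∀ i : L.site, Fin (M.spinDim i)) × (M.Mode → Bool)

/-- Operators on the global Hilbert space `ℂ ^ Config`, with the operator norm. -/
abbrev Op (M : Model L) : Type := Matrix M.Config M.Config ℂ

/-- Operators `a ⊗ 1`, where `a` acts on the spins in `X`. -/
def spinOps (M : Model L) (X : Finset L.site) : Set M.Op :=
  {A | ∃ a : (∀ i : X, Fin (M.spinDim i)) → (∀ i : X, Fin (M.spinDim i)) → ℂ,
    ∀ σ τ : M.Config,
      A σ τ = if σ.2 = τ.2 ∧ ∀ i, i ∉ X → σ.1 i = τ.1 i then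
        a (fun i => σ.1 i) (fun i => τ.1 i) else 0}

/-- The annihilation operator of the mode `k` on Fock space, with the Jordan-Wigner sign taken with
respect to a fixed enumeration of the modes. -/
def annihilation (M : Model L) (k : M.Mode) : M.Op := fun σ τ =>
  if σ.1 = τ.1 ∧ τ.2 k = true ∧ σ.2 = Function.update τ.2 k false then
    (-1) ^ (Finset.univ.filter fun l : M.Mode =>
      Fintype.equivFin M.Mode l < Fintype.equivFin M.Mode k ∧ τ.2 l = true).card
  else 0

/-- The annihilation and creation operators of the modes in `X`. -/
def fermionOps (M : Model L) (X : Finset L.site) : Set M.Op :=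
  {A | ∃ k : M.Mode, k.1 ∈ X ∧ (A = M.annihilation k ∨ A = (M.annihilation k)ᴴ)}

/-- The operators supported on `X`: the algebra generated by the operators on the spins in `X` and by
the products of two creation or annihilation operators in `X` (for fermions, these are the operators
on `X` that are even in the creation and annihilation operators). -/
def localAlg (M : Model L) (X : Finset L.site) : Subalgebra ℂ M.Op :=
  Algebra.adjoin ℂ
    (M.spinOps X ∪ {A | ∃ f ∈ M.fermionOps X, ∃ g ∈ M.fermionOps X, A = f * g})

end Model

/-- The local terms of a Hamiltonian: for each set `X` of sites, a Hermitian operator on `X`. -/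
structure Interaction (M : Model L) where
  term : Finset L.site → M.Op
  term_mem : ∀ X, term X ∈ M.localAlg X
  term_isHermitian : ∀ X, (term X).IsHermitian

namespace Interaction

variable {M : Model L}

/-- The Hamiltonian `H = ∑ X, h_X`. -/
def hamiltonian (Φ : Interaction M) : M.Op := ∑ X : Finset L.site, Φ.term X

/-- `∑ ‖h_X‖` over all `X` containing `i` and `j` is at most `φ (dist i j)`, for all `i ≠ j`. -/
def DecaysLike (Φ : Interaction M) (φ : ℝ → ℝ) : Prop :=
  ∀ i j : L.site, i ≠ j →
    ∑ X ∈ Finset.univ.filter (fun X : Finset L.site => i ∈ X ∧ j ∈ X), ‖Φ.term X‖ ≤ φ (dist i j)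

/-- Each term couples at most two clusters of sites of radius at most `R` (for `R = 0`: at most two
sites). -/
def IsTwoBody (Φ : Interaction M) (R : ℝ) : Prop :=
  ∀ X : Finset L.site, Φ.term X ≠ 0 →
    ∃ i j : L.site, ∀ k ∈ X, dist k i ≤ R ∨ dist k j ≤ R

end Interaction

/-- The distance `d_XY` of two nonempty regions. -/
def regionDist (X Y : Finset L.site) : ℝ :=
  sInf {r : ℝ | ∃ i ∈ X, ∃ j ∈ Y, r = dist i j}

/-- The Heisenberg evolution `A(t) = exp(i H t) A exp(-i H t)`. -/
def heisenberg {ι : Type} [Fintype ι] [DecidableEq ι] (H A : Matrix ι ι ℂ) (t : ℝ) :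
    Matrix ι ι ℂ :=
  NormedSpace.exp ((Complex.I * (t : ℂ)) • H) * A * NormedSpace.exp (-((Complex.I * (t : ℂ)) • H))

/-- A Lieb-Robinson bound: for operators `A`, `B` supported on disjoint regions `X`, `Y`,
`‖[A(t), B]‖ ≤ |X| |Y| ‖A‖ ‖B‖ c(d_XY, |t|)`. -/
def HasLiebRobinson {M : Model L} (Φ : Interaction M) (c : ℝ → ℝ → ℝ) : Prop :=
  ∀ X Y : Finset L.site, X.Nonempty → Y.Nonempty → Disjoint X Y →
    ∀ A ∈ M.localAlg X, ∀ B ∈ M.localAlg Y, ∀ t : ℝ,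
      ‖heisenberg Φ.hamiltonian A t * B - B * heisenberg Φ.hamiltonian A t‖ ≤
        (X.card : ℝ) * (Y.card : ℝ) * ‖A‖ * ‖B‖ * c (regionDist X Y) |t|

/-- `c(r, t) = C exp(v t) / r ^ α`, the Lieb-Robinson function of power-law systems. -/
def powerLR (α C v : ℝ) (r t : ℝ) : ℝ := C * Real.exp (v * t) / r ^ α

/-- `c(r, t) = C exp(-μ (r - v t))`, the Lieb-Robinson function of short-range systems. -/
def expLR (μ C v : ℝ) (r t : ℝ) : ℝ := C * Real.exp (-μ * (r - v * t))

section GroundStates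

variable {ι : Type} [Fintype ι] [DecidableEq ι] {d : ℕ}

/-- `G a`, `a = 1, …, d`, are orthonormal eigenvectors of `H` with eigenvalues `E a`, and all these
eigenvalues lie below the rest of the spectrum by at least `Δ`.  The `E a` need not be equal. -/
structure IsGroundManifold (H : Matrix ι ι ℂ) (Δ : ℝ) (G : Fin d → ι → ℂ) (E : Fin d → ℝ) :
    Prop where
  orthonormal : ∀ a b, star (G a) ⬝ᵥ G b = if a = b then 1 else 0
  eigen : ∀ a, H *ᵥ G a = (E a : ℂ) • G a
  gap : ∀ (ψ : ι → ℂ) (e : ℝ), ψ ≠ 0 → (∀ a, star (G a) ⬝ᵥ ψ = 0) → H *ᵥ ψ = (e : ℂ) • ψ →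
    ∀ a, E a + Δ ≤ e

/-- For every `u ∈ [0, 1]`, the `d` states `G u a` form a ground-state manifold of `H + u V` that is
separated from the rest of the spectrum by a gap of at least `Δ`. -/
def IsGappedPath (H V : Matrix ι ι ℂ) (Δ : ℝ) (G : ℝ → Fin d → ι → ℂ) (E : ℝ → Fin d → ℝ) :
    Prop :=
  ∀ u ∈ Set.Icc (0 : ℝ) 1, IsGroundManifold (H + (u : ℂ) • V) Δ (G u) (E u)

/-- The uniform average `(1 / d) ∑ a, ⟨G a| S |G a⟩`. -/
def groundAverage (G : Fin d → ι → ℂ) (S : Matrix ι ι ℂ) : ℂ :=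
  (1 / (d : ℂ)) * ∑ a, star (G a) ⬝ᵥ (S *ᵥ G a)

/-- The orthogonal projection `∑ a, |G a⟩⟨G a|`. -/
def groundProj (G : Fin d → ι → ℂ) : Matrix ι ι ℂ :=
  ∑ a, Matrix.vecMulVec (G a) (star (G a))

/-- `P̄ / (H - e)`, where `P̄ = 1 - groundProj G`: zero on the ground-state manifold, and the inverse
of `H - e` on its orthogonal complement. -/
def reducedResolvent (H : Matrix ι ι ℂ) (G : Fin d → ι → ℂ) (e : ℝ) : Matrix ι ι ℂ :=
  (1 - groundProj G) *
    ((1 - groundProj G) * (H - (e : ℂ) • (1 : Matrix ι ι ℂ)) + groundProj G)⁻¹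

/-- `(1 / d) ∑ a, ⟨G a| S (P̄ / (H - E a)) V |G a⟩`. -/
def linearResponse (H V S : Matrix ι ι ℂ) (G : Fin d → ι → ℂ) (E : Fin d → ℝ) : ℂ :=
  (1 / (d : ℂ)) * ∑ a, star (G a) ⬝ᵥ ((S * reducedResolvent H G (E a) * V) *ᵥ G a)

end GroundStates

/-- The response of the averaged expectation value of `S` to the perturbation `V` is at most
`f (d_XY)`, for all observables `S` on `X` and perturbations `V` on `Y`, where `X`, `Y` are disjoint
with at most `p`, `q` sites, `‖S‖ ≤ s`, `‖V‖ ≤ w`, and `H + u V`, `u ∈ [0, 1]`, has a ground-state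
manifold of any fixed dimension `d ≥ 1` with a gap of at least `Δ`. -/
def LPPLBound {M : Model L} (Φ : Interaction M) (Δ : ℝ) (p q : ℕ) (s w : ℝ) (f : ℝ → ℝ) : Prop :=
  ∀ X Y : Finset L.site, X.Nonempty → Y.Nonempty → Disjoint X Y → X.card ≤ p → Y.card ≤ q →
    ∀ S ∈ M.localAlg X, S.IsHermitian → ‖S‖ ≤ s →
    ∀ V ∈ M.localAlg Y, V.IsHermitian → ‖V‖ ≤ w →
    ∀ (d : ℕ) (G : ℝ → Fin d → M.Config → ℂ) (E : ℝ → Fin d → ℝ), 0 < d →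
      IsGappedPath Φ.hamiltonian V Δ G E →
        ‖groundAverage (G 1) S - groundAverage (G 0) S‖ ≤ f (regionDist X Y)

/-- A real polynomial of degree at most two with nonnegative coefficients. -/
def IsNonnegQuadratic (P : Polynomial ℝ) : Prop :=
  P.natDegree ≤ 2 ∧ ∀ n, 0 ≤ P.coeff n

/-- `(2 α / π) arcsin (tanh (Δ π / (2 v)))`. -/
def powerExponent (α v Δ : ℝ) : ℝ :=
  2 * α / Real.pi * Real.arcsin (Real.tanh (Δ * Real.pi / (2 * v)))

/-- `(2 μ / π) arcsin (tanh (Δ π / (2 μ v)))`. -/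
def expRate (μ v Δ : ℝ) : ℝ :=
  2 * μ / Real.pi * Real.arcsin (Real.tanh (Δ * Real.pi / (2 * μ * v)))

end LPPL

end

/-! The response at parameter λ is a sum over excitation energies, hence the value at 0 of a
function that is holomorphic across the spectral gap. Locality of the dynamics makes this function
small away from the real axis, and a maximum principle carries the smallness to 0.

Perturbation theory. A variational inequality shows that the ground-state projection is Lipschitz in
the Hamiltonian (`norm_proj_sub_le`); this makes first-order perturbation theory rigorous for the
averaged expectation value (`hasDerivWithinAt_groundAverage`), without choosing the states
continuously. It remains to bound the linear response uniformly in λ.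

Spectral representation. In an eigenbasis of H(λ), the response plus its conjugate is f(0) with f(z)
= ∑ c_j / (w_j - z) and |w_j| ≥ Δ. The almost periodic function g(t) = ∑ c_j exp(-i w_j t) is the
ground-state average of [S(t), V]: the average is uniform, so intermediate states inside the
manifold cancel by cyclicity of the trace (`exists_resolventSum_eq`). Off the real axis f is a
one-sided Laplace transform of g. A Lieb-Robinson bound for H controls g also for H + λV, because
the perturbation is V itself and Duhamel's formula then involves the same commutator.

Items (1) and (3). Here |g(t)| ≤ B min(1, exp(v(|t| - T))), where T is (α/v) log r, respectively r/v
(with νv as the growth rate). This gives |f(x + iy)| ≤ B exp(-|y|T)(T + 1/|y|) for 0 < |y| ≤ v. So f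
is defined on the strip |Im z| < v cut along the real half lines beyond ±Δ; it is of order exp(-vT)
on the edges and only mildly singular at the cuts. By the two-constants principle, log |f(0)| is
about -vT times the harmonic measure of the edges seen from 0, and that measure is (2/π) arcsin
tanh(πΔ/2v). The conformal map and the harmonic measure are explicit (`stripMap`, `edgeMeasure`).
The maximum principle is applied on a disc of radius 1 - O(1/T), which costs the polynomial
prefactor (`exists_norm_resolventSum_zero_le_of_front`).

Item (2). For two-body interactions with α > 2D commutators grow only polynomially in time, with the
full spatial decay r^(-α) (`exists_lieb_robinson_two_body`). Then f has a pole-like bound at the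
real axis, which a polynomial factor removes on a circle inside the gap, and no part of the exponent
is lost (`norm_resolventSum_zero_le_of_pow`).

Lieb-Robinson bounds. All of them follow from the comparison principle `norm_commutator_intPic_le`:
a weight on regions that dominates the commutator at time zero and is reproduced by the interaction
up to a rate bounds the commutator at later times. For (1) and (3) the weights are sums of power
laws or exponentials, and the interaction picture removes the on-site terms, whose size is not
restricted. For (2) it removes all terms of range at most χ; both χ and the radius ρ to which the
short-range dynamics spreads grow polynomially in t, so that the remaining long terms act with total
strength O(1) up to time t. -/

noncomputable section

namespace LPPL

variable {D : ℕ} {κ : ℝ} {L : Lattice D κ}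

/-! ### Locality: operators with disjoint supports commute -/

section

namespace Model

/-- The operator `1 ⊗ m`, where `m` acts on Fock space. -/
def fockLift (M : Model L) (m : Matrix (M.Mode → Bool) (M.Mode → Bool) ℂ) : M.Op :=
  fun σ τ => if σ.1 = τ.1 then m σ.2 τ.2 else 0

/-- The Jordan-Wigner sign of the mode `k`. -/
def jwSign (M : Model L) (k : M.Mode) (τ : M.Mode → Bool) : ℂ :=
  (-1) ^ (Finset.univ.filter fun l : M.Mode =>
      Fintype.equivFin M.Mode l < Fintype.equivFin M.Mode k ∧ τ l = true).card

/-- The operator on Fock space that changes the occupation of the mode `k` from `b` to `!b`. -/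
def flipOp (M : Model L) (k : M.Mode) (b : Bool) : Matrix (M.Mode → Bool) (M.Mode → Bool) ℂ :=
  fun σ τ => if τ k = b ∧ σ = Function.update τ k (!b) then M.jwSign k τ else 0

variable (M : Model L)

lemma fockLift_mul (m m' : Matrix (M.Mode → Bool) (M.Mode → Bool) ℂ) :
    M.fockLift (m * m') = M.fockLift m * M.fockLift m' := by
  ext ⟨s, f⟩ ⟨s', f'⟩
  simp only [fockLift, Matrix.mul_apply, Fintype.sum_prod_type]
  by_cases h : s = s'
  · subst h
    rw [if_pos rfl, Finset.sum_eq_single s]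
    · simp
    · intro b _ hb
      simp [Ne.symm hb]
    · simp
  · rw [if_neg h, eq_comm]
    refine Finset.sum_eq_zero fun x _ => Finset.sum_eq_zero fun y _ => ?_
    by_cases h1 : s = x
    · subst h1; simp [h]
    · simp [h1]

lemma fockLift_neg (m : Matrix (M.Mode → Bool) (M.Mode → Bool) ℂ) :
    M.fockLift (-m) = -M.fockLift m := by
  ext σ τ
  simp only [fockLift, Matrix.neg_apply]
  split_ifs <;> simp

lemma annihilation_eq (k : M.Mode) : M.annihilation k = M.fockLift (M.flipOp k true) := by
  ext σ τ
  simp only [annihilation, fockLift, flipOp, jwSign, ite_and, Bool.not_true]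

/-- The sign is a product with one factor per mode, and only the factor of `l` changes. -/
lemma jwSign_update (k l : M.Mode) (b : Bool) (τ : M.Mode → Bool) (h : τ l = !b) :
    M.jwSign k (Function.update τ l b) =
      if Fintype.equivFin M.Mode l < Fintype.equivFin M.Mode k then -M.jwSign k τ
      else M.jwSign k τ := by
  have key : ∀ τ : M.Mode → Bool, M.jwSign k τ = ∏ m : M.Mode,
      if Fintype.equivFin M.Mode m < Fintype.equivFin M.Mode k ∧ τ m = true then (-1 : ℂ) else 1 := by
    intro τ
    rw [jwSign, Finset.prod_ite]
    simp
  rw [key, key, ← Finset.mul_prod_erase _ _ (Finset.mem_univ l),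
    ← Finset.mul_prod_erase (a := l) _ _ (Finset.mem_univ l)]
  have : ∀ m ∈ Finset.univ.erase l, (if Fintype.equivFin M.Mode m < Fintype.equivFin M.Mode k ∧
      Function.update τ l b m = true then (-1 : ℂ) else 1) =
      if Fintype.equivFin M.Mode m < Fintype.equivFin M.Mode k ∧ τ m = true then (-1 : ℂ) else 1 := by
    intro m hm
    rw [Function.update_of_ne (Finset.ne_of_mem_erase hm)]
  rw [Finset.prod_congr rfl this, Function.update_self, h]
  by_cases hl : Fintype.equivFin M.Mode l < Fintype.equivFin M.Mode k <;> cases b <;> simp [hl]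

lemma flipOp_conjTranspose (k : M.Mode) : (M.flipOp k true)ᴴ = M.flipOp k false := by
  ext σ τ
  simp only [Matrix.conjTranspose_apply, flipOp, Bool.not_true, Bool.not_false]
  have hs : ∀ τ : M.Mode → Bool, star (M.jwSign k τ) = M.jwSign k τ := fun τ => by simp [jwSign]
  by_cases h : τ k = false ∧ σ = Function.update τ k true
  · obtain ⟨h1, rfl⟩ := h
    rw [if_pos ⟨by simp, by ext i; by_cases hi : i = k <;> simp [hi, h1, Function.update]⟩,
      if_pos ⟨h1, rfl⟩, hs, jwSign_update _ _ _ _ _ (by simpa using h1)]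
    simp
  · rw [if_neg h, if_neg, star_zero]
    rintro ⟨h1, rfl⟩
    exact h ⟨by simp, by ext i; by_cases hi : i = k <;> simp [hi, h1, Function.update]⟩

lemma fockLift_conjTranspose (m : Matrix (M.Mode → Bool) (M.Mode → Bool) ℂ) :
    (M.fockLift m)ᴴ = M.fockLift mᴴ := by
  ext σ τ
  simp only [Matrix.conjTranspose_apply, fockLift, eq_comm (a := σ.1)]
  split_ifs <;> simp

lemma flipOp_mul_apply (k l : M.Mode) (b c : Bool) (σ τ : M.Mode → Bool) :
    (M.flipOp k b * M.flipOp l c) σ τ =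
      if τ l = c ∧ Function.update τ l (!c) k = b ∧
        σ = Function.update (Function.update τ l (!c)) k (!b) then
        M.jwSign k (Function.update τ l (!c)) * M.jwSign l τ else 0 := by
  rw [Matrix.mul_apply, Finset.sum_eq_single (Function.update τ l (!c))]
  · simp only [flipOp]
    split_ifs <;> simp_all
  · intro ρ _ hρ
    simp [flipOp, hρ]
  · simp

/-- Flipping the earlier of the two modes reverses the Jordan-Wigner sign of the later one, but not
conversely; so exactly one of the two orders picks up a minus sign. -/
lemma flipOp_anticomm (k l : M.Mode) (hkl : k ≠ l) (b c : Bool) :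
    M.flipOp k b * M.flipOp l c = -(M.flipOp l c * M.flipOp k b) := by
  ext σ τ
  rw [Matrix.neg_apply, flipOp_mul_apply, flipOp_mul_apply, Function.update_of_ne hkl,
    Function.update_of_ne hkl.symm, Function.update_comm hkl]
  by_cases h1 : τ l = c
  · by_cases h2 : τ k = b
    · by_cases h3 : σ = Function.update (Function.update τ k (!b)) l (!c)
      · rw [if_pos ⟨h1, h2, by rw [h3, Function.update_comm hkl]⟩, if_pos ⟨h2, h1, by
          first | exact h3 | rw [h3, Function.update_comm hkl]⟩,
          jwSign_update _ _ _ _ _ (by simpa using h1), jwSign_update _ _ _ _ _ (by simpa using h2)]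
        have hne : Fintype.equivFin M.Mode k ≠ Fintype.equivFin M.Mode l := by simpa using hkl
        rcases lt_or_gt_of_ne hne with h | h
        · rw [if_neg h.not_gt, if_pos h]; ring
        · rw [if_pos h, if_neg h.not_gt]; ring
      · have h3' : ¬ σ = Function.update (Function.update τ l (!c)) k (!b) := by
          rwa [Function.update_comm hkl.symm]
        simp [h3']
    · simp [h2]
  · simp [h1]

lemma exists_flipOp_of_mem_fermionOps {X : Finset L.site} {A : M.Op} (hA : A ∈ M.fermionOps X) :
    ∃ k b, k.1 ∈ X ∧ A = M.fockLift (M.flipOp k b) := by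
  obtain ⟨k, hk, h | h⟩ := hA
  · exact ⟨k, true, hk, by rw [h, annihilation_eq]⟩
  · exact ⟨k, false, hk, by rw [h, annihilation_eq, fockLift_conjTranspose, flipOp_conjTranspose]⟩

lemma spinOps_mul_apply {X Y : Finset L.site} (hXY : Disjoint X Y) {A B : M.Op}
    {a : (∀ i : X, Fin (M.spinDim i)) → (∀ i : X, Fin (M.spinDim i)) → ℂ}
    {b : (∀ i : Y, Fin (M.spinDim i)) → (∀ i : Y, Fin (M.spinDim i)) → ℂ}
    (hA : ∀ σ τ : M.Config, A σ τ = if σ.2 = τ.2 ∧ ∀ i, i ∉ X → σ.1 i = τ.1 i then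
        a (fun i => σ.1 i) (fun i => τ.1 i) else 0)
    (hB : ∀ σ τ : M.Config, B σ τ = if σ.2 = τ.2 ∧ ∀ i, i ∉ Y → σ.1 i = τ.1 i then
        b (fun i => σ.1 i) (fun i => τ.1 i) else 0) (σ τ : M.Config) :
    (A * B) σ τ = if σ.2 = τ.2 ∧ ∀ i, i ∉ X → i ∉ Y → σ.1 i = τ.1 i then
      a (fun i => σ.1 i) (fun i => τ.1 i) * b (fun i => σ.1 i) (fun i => τ.1 i) else 0 := by
  classical
  -- Only one intermediate configuration contributes: the one that already agrees with `τ` on `X`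
  -- and still agrees with `σ` elsewhere.
  rw [Matrix.mul_apply,
    Finset.sum_eq_single ((fun i => if i ∈ X then τ.1 i else σ.1 i, σ.2) : M.Config)]
  · rw [hA, hB, if_pos ⟨rfl, fun i hi => by simp [hi]⟩]
    have e1 : (fun i : X => if (i : L.site) ∈ X then τ.1 i else σ.1 i) = fun i : X => τ.1 i := by
      funext i; simp
    have e2 : (fun i : Y => if (i : L.site) ∈ X then τ.1 i else σ.1 i) = fun i : Y => σ.1 i := by
      funext i; simp [Finset.disjoint_right.1 hXY i.2]
    dsimp only
    rw [e1, e2]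
    by_cases h : σ.2 = τ.2 ∧ ∀ i, i ∉ X → i ∉ Y → σ.1 i = τ.1 i
    · rw [if_pos h, if_pos]
      refine ⟨h.1, fun i hi => ?_⟩
      by_cases hX : i ∈ X
      · simp [hX]
      · simp [hX, h.2 i hX hi]
    · rw [if_neg h, if_neg, mul_zero]
      rintro ⟨h1, h2⟩
      exact h ⟨h1, fun i hX hY => by simpa [hX] using h2 i hY⟩
  · intro ρ _ hρ
    rw [hA, hB]
    by_cases h1 : σ.2 = ρ.2 ∧ ∀ i, i ∉ X → σ.1 i = ρ.1 i
    · by_cases h2 : ρ.2 = τ.2 ∧ ∀ i, i ∉ Y → ρ.1 i = τ.1 i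
      · refine absurd ?_ hρ
        refine Prod.ext (funext fun i => ?_) h1.1.symm
        by_cases hX : i ∈ X
        · simp [hX, h2.2 i (Finset.disjoint_left.1 hXY hX)]
        · simp [hX, h1.2 i hX]
      · rw [if_neg h2, mul_zero]
    · rw [if_neg h1, zero_mul]
  · simp

lemma spinOps_commute {X Y : Finset L.site} (hXY : Disjoint X Y) {A B : M.Op}
    (hA : A ∈ M.spinOps X) (hB : B ∈ M.spinOps Y) : A * B = B * A := by
  obtain ⟨a, ha⟩ := hA
  obtain ⟨b, hb⟩ := hB
  ext σ τ
  rw [M.spinOps_mul_apply hXY ha hb, M.spinOps_mul_apply hXY.symm hb ha, mul_comm]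
  refine if_congr (and_congr_right fun _ => forall_congr' fun i => ?_) rfl rfl
  tauto

lemma spinOps_commute_fockLift {X : Finset L.site} {A : M.Op} (hA : A ∈ M.spinOps X)
    (m : Matrix (M.Mode → Bool) (M.Mode → Bool) ℂ) : A * M.fockLift m = M.fockLift m * A := by
  obtain ⟨a, ha⟩ := hA
  ext σ τ
  have h1 : (A * M.fockLift m) σ τ = if ∀ i, i ∉ X → σ.1 i = τ.1 i then
      a (fun i => σ.1 i) (fun i => τ.1 i) * m σ.2 τ.2 else 0 := by
    rw [Matrix.mul_apply, Finset.sum_eq_single ((τ.1, σ.2) : M.Config)]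
    · rw [ha]; simp [fockLift]
    · intro ρ _ hρ
      rw [ha]
      by_cases h1 : σ.2 = ρ.2
      · have : ρ.1 ≠ τ.1 := fun h => hρ (Prod.ext h h1.symm)
        simp [fockLift, this]
      · simp [h1]
    · simp
  have h2 : (M.fockLift m * A) σ τ = if ∀ i, i ∉ X → σ.1 i = τ.1 i then
      a (fun i => σ.1 i) (fun i => τ.1 i) * m σ.2 τ.2 else 0 := by
    rw [Matrix.mul_apply, Finset.sum_eq_single ((σ.1, τ.2) : M.Config)]
    · rw [ha]; simp [fockLift, mul_comm]
    · intro ρ _ hρ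
      rw [ha]
      by_cases h1 : σ.1 = ρ.1
      · have : ρ.2 ≠ τ.2 := fun h => hρ (Prod.ext h1.symm h)
        simp [this]
      · simp [fockLift, h1]
    · simp
  rw [h1, h2]

/-- Operators with disjoint supports commute. -/
theorem localAlg_commute {X Y : Finset L.site} (hXY : Disjoint X Y) {A B : M.Op}
    (hA : A ∈ M.localAlg X) (hB : B ∈ M.localAlg Y) : A * B = B * A := by
  have gen : ∀ x ∈ M.spinOps X ∪ {A | ∃ f ∈ M.fermionOps X, ∃ g ∈ M.fermionOps X, A = f * g},
      ∀ y ∈ M.spinOps Y ∪ {A | ∃ f ∈ M.fermionOps Y, ∃ g ∈ M.fermionOps Y, A = f * g},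
      x * y = y * x := by
    rintro x (hx | ⟨f, hf, g, hg, rfl⟩) y (hy | ⟨f', hf', g', hg', rfl⟩)
    · exact M.spinOps_commute hXY hx hy
    · obtain ⟨k, b, -, rfl⟩ := M.exists_flipOp_of_mem_fermionOps hf'
      obtain ⟨l, c, -, rfl⟩ := M.exists_flipOp_of_mem_fermionOps hg'
      rw [← fockLift_mul, M.spinOps_commute_fockLift hx]
    · obtain ⟨k, b, -, rfl⟩ := M.exists_flipOp_of_mem_fermionOps hf
      obtain ⟨l, c, -, rfl⟩ := M.exists_flipOp_of_mem_fermionOps hg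
      rw [← fockLift_mul, M.spinOps_commute_fockLift hy]
    · obtain ⟨k, b, hk, rfl⟩ := M.exists_flipOp_of_mem_fermionOps hf
      obtain ⟨l, c, hl, rfl⟩ := M.exists_flipOp_of_mem_fermionOps hg
      obtain ⟨k', b', hk', rfl⟩ := M.exists_flipOp_of_mem_fermionOps hf'
      obtain ⟨l', c', hl', rfl⟩ := M.exists_flipOp_of_mem_fermionOps hg'
      have ne : ∀ {m m' : M.Mode}, m.1 ∈ X → m'.1 ∈ Y → m ≠ m' := by
        rintro m m' hm hm' rfl
        exact Finset.disjoint_left.1 hXY hm hm'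
      have ac : ∀ {m m' : M.Mode} (b b' : Bool), m.1 ∈ X → m'.1 ∈ Y →
          M.fockLift (M.flipOp m b) * M.fockLift (M.flipOp m' b') =
            -(M.fockLift (M.flipOp m' b') * M.fockLift (M.flipOp m b)) := by
        intro m m' b b' hm hm'
        rw [← fockLift_mul, M.flipOp_anticomm _ _ (ne hm hm'), fockLift_neg, fockLift_mul]
      -- Moving two fermion operators past two others takes four transpositions, so the signs
      -- cancel; this is where evenness enters.
      calc _ = M.fockLift (M.flipOp k b) * (M.fockLift (M.flipOp l c) * M.fockLift (M.flipOp k' b'))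
            * M.fockLift (M.flipOp l' c') := by noncomm_ring
        _ = -((M.fockLift (M.flipOp k b) * M.fockLift (M.flipOp k' b')) *
            (M.fockLift (M.flipOp l c) * M.fockLift (M.flipOp l' c'))) := by
          rw [ac c b' hl hk']; noncomm_ring
        _ = -(M.fockLift (M.flipOp k' b') * (M.fockLift (M.flipOp k b) *
            M.fockLift (M.flipOp l' c')) * M.fockLift (M.flipOp l c)) := by
          rw [ac b b' hk hk', ac c c' hl hl']; noncomm_ring
        _ = _ := by
          rw [ac b c' hk hl']; noncomm_ring
  -- Commutation passes from generators to the generated algebras one factor at a time, since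
  -- centralizers are subalgebras.
  have h1 : M.localAlg Y ≤ Subalgebra.centralizer ℂ (M.spinOps X ∪
      {A | ∃ f ∈ M.fermionOps X, ∃ g ∈ M.fermionOps X, A = f * g}) :=
    Algebra.adjoin_le fun y hy x hx => gen x hx y hy
  have h2 : M.localAlg X ≤ Subalgebra.centralizer ℂ (M.localAlg Y : Set M.Op) :=
    Algebra.adjoin_le fun x hx y hy => (h1 hy x hx).symm
  exact (h2 hA B hB).symm

lemma spinOps_mono {X Y : Finset L.site} (h : X ⊆ Y) : M.spinOps X ⊆ M.spinOps Y := by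
  classical
  rintro A ⟨a, ha⟩
  refine ⟨fun s t => if ∀ i : Y, (i : L.site) ∉ X → s i = t i then
    a (fun i => s ⟨i, h i.2⟩) (fun i => t ⟨i, h i.2⟩) else 0, fun σ τ => ?_⟩
  rw [ha]
  by_cases h1 : σ.2 = τ.2 ∧ ∀ i, i ∉ X → σ.1 i = τ.1 i
  · rw [if_pos h1, if_pos ⟨h1.1, fun i hi => h1.2 i fun hX => hi (h hX)⟩]
    have h3 : ∀ i : Y, (i : L.site) ∉ X → σ.1 i = τ.1 i := fun i hi => h1.2 i hi
    simp only [if_pos h3]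
  · rw [if_neg h1]
    by_cases h2 : σ.2 = τ.2 ∧ ∀ i, i ∉ Y → σ.1 i = τ.1 i
    · rw [if_pos h2]
      refine (if_neg fun h3 => ?_).symm
      refine h1 ⟨h2.1, fun i hi => ?_⟩
      by_cases hY : i ∈ Y
      · exact h3 ⟨i, hY⟩ hi
      · exact h2.2 i hY
    · rw [if_neg h2]

theorem localAlg_mono {X Y : Finset L.site} (h : X ⊆ Y) : M.localAlg X ≤ M.localAlg Y := by
  have hf : M.fermionOps X ⊆ M.fermionOps Y := fun A ⟨k, hk, hA⟩ => ⟨k, h hk, hA⟩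
  refine Algebra.adjoin_mono (Set.union_subset_union (M.spinOps_mono h) ?_)
  rintro A ⟨f, hfX, g, hg, rfl⟩
  exact ⟨f, hf hfX, g, hf hg, rfl⟩

/-- A subalgebra of a finite-dimensional algebra is closed, so it contains the limit of the
exponential series. -/
theorem exp_mem_localAlg {X : Finset L.site} {A : M.Op} (hA : A ∈ M.localAlg X) :
    NormedSpace.exp A ∈ M.localAlg X := by
  have hc : IsClosed (M.localAlg X : Set M.Op) :=
    Submodule.closed_of_finiteDimensional (Subalgebra.toSubmodule (M.localAlg X))
  have := NormedSpace.exp_series_hasSum_exp' (𝕂 := ℂ) A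
  refine hc.mem_of_tendsto this (Filter.Eventually.of_forall fun s => ?_)
  exact (M.localAlg X).sum_mem fun n _ => (M.localAlg X).smul_mem ((M.localAlg X).pow_mem hA n) _

theorem heisenberg_mem_localAlg {X : Finset L.site} {H A : M.Op} (hH : H ∈ M.localAlg X)
    (hA : A ∈ M.localAlg X) (t : ℝ) : heisenberg H A t ∈ M.localAlg X := by
  have h := (M.localAlg X).smul_mem hH (Complex.I * (t : ℂ))
  exact (M.localAlg X).mul_mem ((M.localAlg X).mul_mem (M.exp_mem_localAlg h) hA)
    (M.exp_mem_localAlg ((M.localAlg X).neg_mem h))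

end Model

end

/-! ### Heisenberg dynamics, interaction picture and norm growth -/

section Dynamics

variable {ι : Type} [Fintype ι] [DecidableEq ι]

/-- The group `exp (i t H)`. -/
def evo (H : Matrix ι ι ℂ) (t : ℝ) : Matrix ι ι ℂ := NormedSpace.exp ((Complex.I * (t : ℂ)) • H)

lemma evo_neg (H : Matrix ι ι ℂ) (t : ℝ) :
    evo H (-t) = NormedSpace.exp (-((Complex.I * (t : ℂ)) • H)) := by
  rw [evo]; congr 1; simp

lemma heisenberg_eq (H A : Matrix ι ι ℂ) (t : ℝ) :
    heisenberg H A t = evo H t * A * evo H (-t) := by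
  rw [evo_neg]; rfl

lemma evo_zero (H : Matrix ι ι ℂ) : evo H 0 = 1 := by simp [evo]

lemma evo_add (H : Matrix ι ι ℂ) (s t : ℝ) : evo H (s + t) = evo H s * evo H t := by
  have hc : Commute ((Complex.I * (s : ℂ)) • H) ((Complex.I * (t : ℂ)) • H) :=
    ((Commute.refl H).smul_left _).smul_right _
  have h := Matrix.exp_add_of_commute _ _ hc
  rw [evo, evo, evo, ← h, ← add_smul]
  congr 2
  push_cast; ring

lemma evo_mul_evo_neg (H : Matrix ι ι ℂ) (t : ℝ) : evo H t * evo H (-t) = 1 := by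
  rw [← evo_add]; simp [evo_zero]

lemma evo_neg_mul_evo (H : Matrix ι ι ℂ) (t : ℝ) : evo H (-t) * evo H t = 1 := by
  rw [← evo_add]; simp [evo_zero]

lemma evo_commute {H A : Matrix ι ι ℂ} (h : H * A = A * H) (t : ℝ) : evo H t * A = A * evo H t := by
  have hc : Commute ((Complex.I * (t : ℂ)) • H) A := Commute.smul_left h _
  exact hc.exp_left.eq

lemma star_evo {H : Matrix ι ι ℂ} (hH : H.IsHermitian) (t : ℝ) : star (evo H t) = evo H (-t) := by
  rw [evo_neg, evo, NormedSpace.star_exp]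
  congr 1
  rw [star_smul, Matrix.star_eq_conjTranspose, hH.eq]
  simp

lemma evo_mem_unitary {H : Matrix ι ι ℂ} (hH : H.IsHermitian) (t : ℝ) :
    evo H t ∈ unitary (Matrix ι ι ℂ) := by
  rw [Unitary.mem_iff, star_evo hH]
  exact ⟨evo_neg_mul_evo H t, evo_mul_evo_neg H t⟩

lemma hasDerivAt_evo (H : Matrix ι ι ℂ) (t : ℝ) :
    HasDerivAt (evo H) (evo H t * (Complex.I • H)) t := by
  have h := (hasDerivAt_exp_smul_const (𝕂 := ℂ) (Complex.I • H) (t : ℂ)).scomp_of_eq t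
    (Complex.ofRealCLM.hasDerivAt (x := t)) rfl
  have e : (fun s : ℝ => NormedSpace.exp ((s : ℂ) • Complex.I • H)) = evo H := by
    funext s; rw [evo, smul_smul, mul_comm]
  have e' : NormedSpace.exp ((t : ℂ) • Complex.I • H) = evo H t := congrFun e t
  rw [e'] at h
  have h2 : HasDerivAt (fun s : ℝ => NormedSpace.exp ((s : ℂ) • Complex.I • H))
    (evo H t * (Complex.I • H)) t := by
    simpa [Function.comp_def] using h
  rwa [e] at h2

lemma hasDerivAt_heisenberg (H A : Matrix ι ι ℂ) (t : ℝ) :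
    HasDerivAt (heisenberg H A) (heisenberg H (Complex.I • (H * A - A * H)) t) t := by
  have h1 := hasDerivAt_evo H t
  have h2 : HasDerivAt (fun s => evo H (-s)) (-(evo H (-t) * (Complex.I • H))) t := by
    have := (hasDerivAt_evo H (-t)).scomp t (hasDerivAt_neg t)
    simpa [Function.comp_def] using this
  have h3 := (h1.mul_const A).mul h2
  have e : heisenberg H A = fun s => evo H s * A * evo H (-s) := funext (heisenberg_eq H A)
  rw [e]
  refine h3.congr_deriv ?_
  symm
  rw [heisenberg_eq, evo_commute (A := Complex.I • H) (by simp) (-t)]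
  simp only [smul_sub, mul_sub, sub_mul, mul_neg, ← sub_eq_add_neg]
  congr 1
  · simp [mul_assoc]
  · simp [mul_assoc]

lemma heisenberg_zero (H A : Matrix ι ι ℂ) : heisenberg H A 0 = A := by
  simp [heisenberg_eq, evo_zero]

lemma heisenberg_neg_time (H A : Matrix ι ι ℂ) (t : ℝ) :
    heisenberg H A (-t) = heisenberg (-H) A t := by
  simp [heisenberg]

lemma heisenberg_mul (H A B : Matrix ι ι ℂ) (t : ℝ) :
    heisenberg H (A * B) t = heisenberg H A t * heisenberg H B t := by
  simp only [heisenberg_eq]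
  calc _ = evo H t * A * 1 * B * evo H (-t) := by noncomm_ring
    _ = _ := by rw [← evo_neg_mul_evo H t]; noncomm_ring

lemma heisenberg_sub (H A B : Matrix ι ι ℂ) (t : ℝ) :
    heisenberg H (A - B) t = heisenberg H A t - heisenberg H B t := by
  simp only [heisenberg_eq]; noncomm_ring

lemma heisenberg_sum (H : Matrix ι ι ℂ) {β : Type*} (s : Finset β) (A : β → Matrix ι ι ℂ) (t : ℝ) :
    heisenberg H (∑ b ∈ s, A b) t = ∑ b ∈ s, heisenberg H (A b) t := by
  simp only [heisenberg_eq, Finset.mul_sum, Finset.sum_mul]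

lemma heisenberg_smul (H A : Matrix ι ι ℂ) (c : ℂ) (t : ℝ) :
    heisenberg H (c • A) t = c • heisenberg H A t := by
  simp [heisenberg_eq]

lemma heisenberg_heisenberg (H A : Matrix ι ι ℂ) (s t : ℝ) :
    heisenberg H (heisenberg H A s) t = heisenberg H A (t + s) := by
  simp only [heisenberg_eq]
  rw [evo_add, neg_add_rev, evo_add]
  noncomm_ring

lemma heisenberg_isHermitian {H A : Matrix ι ι ℂ} (hH : H.IsHermitian) (hA : A.IsHermitian)
    (t : ℝ) : (heisenberg H A t).IsHermitian := by
  have h1 : (evo H t)ᴴ = evo H (-t) := star_evo hH t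
  have h2 : (evo H (-t))ᴴ = evo H t := by rw [← h1, Matrix.conjTranspose_conjTranspose]
  rw [Matrix.IsHermitian, heisenberg_eq, Matrix.conjTranspose_mul, Matrix.conjTranspose_mul, h1, h2,
    hA.eq, mul_assoc]

lemma norm_heisenberg {H : Matrix ι ι ℂ} (hH : H.IsHermitian) (A : Matrix ι ι ℂ) (t : ℝ) :
    ‖heisenberg H A t‖ = ‖A‖ := by
  rw [heisenberg_eq, CStarRing.norm_mul_mem_unitary _ (evo_mem_unitary hH _),
    CStarRing.norm_mem_unitary_mul _ (evo_mem_unitary hH _)]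

lemma evo_add_of_commute {H₁ H₂ : Matrix ι ι ℂ} (h : H₁ * H₂ = H₂ * H₁) (t : ℝ) :
    evo (H₁ + H₂) t = evo H₁ t * evo H₂ t := by
  have hc : Commute ((Complex.I * (t : ℂ)) • H₁) ((Complex.I * (t : ℂ)) • H₂) :=
    Commute.smul_left (Commute.smul_right h _) _
  have h := Matrix.exp_add_of_commute _ _ hc
  rw [evo, evo, evo, ← h, ← smul_add]

/-- Terms that commute with the observable and with the rest of the Hamiltonian do not contribute. -/
lemma heisenberg_add_of_commute {H₁ H₂ A : Matrix ι ι ℂ} (h : H₁ * H₂ = H₂ * H₁)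
    (hA : H₂ * A = A * H₂) (t : ℝ) : heisenberg (H₁ + H₂) A t = heisenberg H₁ A t := by
  rw [heisenberg_eq, heisenberg_eq, evo_add_of_commute h, evo_add_of_commute h]
  calc evo H₁ t * evo H₂ t * A * (evo H₁ (-t) * evo H₂ (-t))
      = evo H₁ t * (evo H₂ t * A) * (evo H₁ (-t) * evo H₂ (-t)) := by noncomm_ring
    _ = evo H₁ t * A * (evo H₂ t * (evo H₁ (-t) * evo H₂ (-t))) := by
      rw [evo_commute hA]; noncomm_ring
    _ = _ := by
      rw [evo_commute (H := H₁) (A := evo H₂ (-t)) (evo_commute h.symm (-t)).symm,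
        ← mul_assoc (evo H₂ t), evo_mul_evo_neg, one_mul]

/-- The interaction picture `e^{iHs} e^{-iH₀s} O e^{iH₀s} e^{-iHs}`. -/
def intPic (H H₀ O : Matrix ι ι ℂ) (s : ℝ) : Matrix ι ι ℂ := heisenberg H (heisenberg H₀ O (-s)) s

/-- The observable is conjugated by `evo H s * evo H₀ (-s)`. Since `H₀` is fixed by its own
evolution, the two generators combine to `H - H₀`, evolved under `H`. -/
lemma hasDerivAt_intPic (H H₀ O : Matrix ι ι ℂ) (s : ℝ) :
    HasDerivAt (intPic H H₀ O) (Complex.I • (heisenberg H (H - H₀) s * intPic H H₀ O s -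
      intPic H H₀ O s * heisenberg H (H - H₀) s)) s := by
  have h1 := hasDerivAt_evo H s
  have h1' : HasDerivAt (fun s => evo H (-s)) (-(evo H (-s) * (Complex.I • H))) s := by
    have := (hasDerivAt_evo H (-s)).scomp s (hasDerivAt_neg s)
    simpa [Function.comp_def] using this
  have h2 : HasDerivAt (fun s => heisenberg H₀ O (-s))
      (-(heisenberg H₀ (Complex.I • (H₀ * O - O * H₀)) (-s))) s := by
    have := (hasDerivAt_heisenberg H₀ O (-s)).scomp s (hasDerivAt_neg s)
    simpa [Function.comp_def] using this
  have h3 := (h1.mul h2).mul h1'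
  have e : intPic H H₀ O = fun s => evo H s * heisenberg H₀ O (-s) * evo H (-s) :=
    funext fun s => heisenberg_eq _ _ _
  have hH₀ : heisenberg H₀ H₀ (-s) = H₀ := by
    rw [heisenberg_eq, evo_commute rfl, mul_assoc, evo_mul_evo_neg, mul_one]
  rw [e]
  refine h3.congr_deriv ?_
  symm
  rw [heisenberg_smul, heisenberg_sub H₀, heisenberg_mul, heisenberg_mul, hH₀]
  have hk : heisenberg H (H - H₀) s = evo H s * (H - H₀) * evo H (-s) := heisenberg_eq _ _ _
  rw [hk]
  set x := heisenberg H₀ O (-s)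
  have hc : evo H (-s) * (Complex.I • H) = Complex.I • (H * evo H (-s)) := by
    rw [evo_commute (A := Complex.I • H) (by simp)]; simp
  rw [hc]
  have a1 : evo H s * (H - H₀) * evo H (-s) * (evo H s * x * evo H (-s)) =
      evo H s * (H - H₀) * (evo H (-s) * evo H s) * x * evo H (-s) := by noncomm_ring
  have a2 : evo H s * x * evo H (-s) * (evo H s * (H - H₀) * evo H (-s)) =
      evo H s * x * (evo H (-s) * evo H s) * (H - H₀) * evo H (-s) := by noncomm_ring
  have a3 : (evo H * fun s => heisenberg H₀ O (-s)) s = evo H s * x := rfl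
  rw [a1, a2, a3, evo_neg_mul_evo]
  simp only [mul_one, Matrix.mul_smul, Matrix.smul_mul, mul_neg,
    Matrix.neg_mul, smul_sub, sub_mul, mul_sub, mul_assoc, Matrix.add_mul]
  abel

lemma intPic_mul (H H₀ A B : Matrix ι ι ℂ) (s : ℝ) :
    intPic H H₀ (A * B) s = intPic H H₀ A s * intPic H H₀ B s := by
  simp only [intPic, heisenberg_mul]

lemma intPic_sub (H H₀ A B : Matrix ι ι ℂ) (s : ℝ) :
    intPic H H₀ (A - B) s = intPic H H₀ A s - intPic H H₀ B s := by
  simp only [intPic, heisenberg_sub]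

lemma intPic_sum (H H₀ : Matrix ι ι ℂ) {β : Type*} (S : Finset β) (A : β → Matrix ι ι ℂ) (s : ℝ) :
    intPic H H₀ (∑ b ∈ S, A b) s = ∑ b ∈ S, intPic H H₀ (A b) s := by
  simp only [intPic, heisenberg_sum]

lemma norm_intPic {H H₀ : Matrix ι ι ℂ} (hH : H.IsHermitian) (hH₀ : H₀.IsHermitian)
    (A : Matrix ι ι ℂ) (s : ℝ) : ‖intPic H H₀ A s‖ = ‖A‖ := by
  rw [intPic, norm_heisenberg hH, norm_heisenberg hH₀]

lemma intPic_heisenberg (H H₀ A : Matrix ι ι ℂ) (s : ℝ) :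
    intPic H H₀ (heisenberg H₀ A s) s = heisenberg H A s := by
  rw [intPic, heisenberg_heisenberg, neg_add_cancel, heisenberg_zero]

/-- To first order in `h` the left-hand side is `W * y * star W` with `W = 1 + i h K`, and `star W *
W = 1 + h² K²` because `K` is Hermitian. So a commutator changes the norm only at second order. -/
lemma norm_one_add_I_smul_sq_le {K : Matrix ι ι ℂ} (hK : K.IsHermitian) (y : Matrix ι ι ℂ) (h : ℝ) :
    ‖y + (h : ℂ) • (Complex.I • (K * y - y * K))‖ ≤ ‖y‖ + 2 * h ^ 2 * ‖K‖ ^ 2 * ‖y‖ := by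
  set W : Matrix ι ι ℂ := 1 + ((h : ℂ) * Complex.I) • K
  have hW : star W = 1 - ((h : ℂ) * Complex.I) • K := by
    simp only [W, star_add, star_one, star_smul, Matrix.star_eq_conjTranspose, hK.eq]
    simp [sub_eq_add_neg]
  have hWW : star W * W = 1 + ((h : ℂ) ^ 2) • (K * K) := by
    rw [hW]
    simp only [W, sub_mul, mul_add, one_mul, mul_one, Matrix.smul_mul, Matrix.mul_smul, smul_smul]
    have : (h : ℂ) * Complex.I * ((h : ℂ) * Complex.I) = -(h : ℂ) ^ 2 := by
      ring_nf; rw [Complex.I_sq]; ring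
    rw [this, neg_smul]
    abel
  have e : y + (h : ℂ) • (Complex.I • (K * y - y * K)) =
      W * y * star W - ((h : ℂ) ^ 2) • (K * y * K) := by
    rw [hW]
    simp only [W, add_mul, mul_sub, one_mul, mul_one, Matrix.smul_mul, Matrix.mul_smul, smul_smul,
      smul_sub]
    have : (h : ℂ) * Complex.I * ((h : ℂ) * Complex.I) = -(h : ℂ) ^ 2 := by
      ring_nf; rw [Complex.I_sq]; ring
    rw [this, neg_smul]
    abel
  have hK2 : ‖((h : ℂ) ^ 2) • (K * y * K)‖ ≤ h ^ 2 * ‖K‖ ^ 2 * ‖y‖ := by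
    rw [norm_smul, norm_pow, Complex.norm_real, Real.norm_eq_abs, sq_abs]
    calc h ^ 2 * ‖K * y * K‖ ≤ h ^ 2 * (‖K‖ * ‖y‖ * ‖K‖) := by
          gcongr
          exact (norm_mul_le _ _).trans (by gcongr; exact norm_mul_le _ _)
      _ = _ := by ring
  rcases isEmpty_or_nonempty ι with hι | hι
  · have : ∀ z : Matrix ι ι ℂ, z = 0 := fun z => Subsingleton.elim _ _
    rw [this (y + _), this y]; simp
  have hW2 : ‖W‖ * ‖W‖ ≤ 1 + h ^ 2 * ‖K‖ ^ 2 := by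
    rw [← CStarRing.norm_star_mul_self, hWW]
    refine (norm_add_le _ _).trans ?_
    rw [norm_one, norm_smul, norm_pow, Complex.norm_real, Real.norm_eq_abs, sq_abs, sq ‖K‖]
    gcongr
    exact norm_mul_le _ _
  rw [e]
  calc _ ≤ ‖W * y * star W‖ + ‖((h : ℂ) ^ 2) • (K * y * K)‖ := norm_sub_le _ _
    _ ≤ (‖W‖ * ‖W‖) * ‖y‖ + h ^ 2 * ‖K‖ ^ 2 * ‖y‖ := by
      refine add_le_add ?_ hK2
      calc _ ≤ ‖W‖ * ‖y‖ * ‖star W‖ := (norm_mul_le _ _).trans (by gcongr; exact norm_mul_le _ _)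
        _ = _ := by rw [norm_star]; ring
    _ ≤ (1 + h ^ 2 * ‖K‖ ^ 2) * ‖y‖ + h ^ 2 * ‖K‖ ^ 2 * ‖y‖ := by gcongr
    _ = _ := by ring

/-- A commutator with a Hermitian matrix does not contribute to the growth of the norm. -/
theorem norm_le_of_hasDerivAt_commutator {y K r : ℝ → Matrix ι ι ℂ} {b b' : ℝ → ℝ} {T : ℝ}
    (hK : ∀ s, (K s).IsHermitian)
    (hy : ∀ s, HasDerivAt y (Complex.I • (K s * y s - y s * K s) + r s) s)
    (h0 : ‖y 0‖ ≤ b 0) (hb : ∀ s, HasDerivAt b (b' s) s)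
    (hr : ∀ s ∈ Set.Ico 0 T, ‖r s‖ ≤ b' s) : ∀ s ∈ Set.Icc 0 T, ‖y s‖ ≤ b s := by
  intro s hs
  refine image_le_of_liminf_slope_right_le_deriv_boundary (f := fun s => ‖y s‖)
    (fun s _ => (hy s).continuousAt.norm.continuousWithinAt) h0
    (fun s _ => (hb s).continuousAt.continuousWithinAt) (fun s _ => (hb s).hasDerivWithinAt)
    (fun x hx q hq => ?_) hs
  refine Filter.Eventually.frequently ?_
  -- Half of the slack pays for the error of differentiability (`h1`), half for the second-order
  -- growth caused by the commutator (`h2`).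
  set ε := (q - b' x) / 2 with hε
  have hε0 : 0 < ε := by rw [hε]; linarith
  have h1 : ∀ᶠ z in nhdsWithin x (Set.Ioi x),
      ‖y z - y x - (z - x) • (Complex.I • (K x * y x - y x * K x) + r x)‖ ≤ ε * ‖z - x‖ :=
    (hasDerivAt_iff_isLittleO.1 (hy x)).bound hε0 |>.filter_mono nhdsWithin_le_nhds
  have h2 : ∀ᶠ z in nhdsWithin x (Set.Ioi x), (z - x) * (2 * ‖K x‖ ^ 2 * ‖y x‖) < ε := by
    have : Filter.Tendsto (fun z => (z - x) * (2 * ‖K x‖ ^ 2 * ‖y x‖)) (nhdsWithin x (Set.Ioi x))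
        (nhds ((x - x) * (2 * ‖K x‖ ^ 2 * ‖y x‖))) := by
      refine Filter.Tendsto.mono_left ?_ nhdsWithin_le_nhds
      exact (Continuous.tendsto (by fun_prop) x)
    rw [sub_self, zero_mul] at this
    exact this.eventually (gt_mem_nhds hε0)
  filter_upwards [h1, h2, self_mem_nhdsWithin] with z hz1 hz2 hz
  have hz0 : 0 < z - x := sub_pos.2 hz
  rw [slope_def_field, div_lt_iff₀ hz0]
  have h3 := norm_one_add_I_smul_sq_le (hK x) (y x) (z - x)
  have h4 : y z = (y z - y x - (z - x) • (Complex.I • (K x * y x - y x * K x) + r x)) +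
      (y x + ((z - x : ℝ) : ℂ) • (Complex.I • (K x * y x - y x * K x))) + (z - x) • r x := by
    have : ((z - x : ℝ) : ℂ) • (Complex.I • (K x * y x - y x * K x)) =
      (z - x) • (Complex.I • (K x * y x - y x * K x)) := by
      ext i j; simp
    rw [this, smul_add]; abel
  have h5 : ‖y z‖ ≤ ε * (z - x) + (‖y x‖ + 2 * (z - x) ^ 2 * ‖K x‖ ^ 2 * ‖y x‖) + (z - x) * b' x := by
    conv_lhs => rw [h4]
    refine (norm_add_le _ _).trans (add_le_add ((norm_add_le _ _).trans (add_le_add ?_ h3)) ?_)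
    · rwa [Real.norm_of_nonneg hz0.le] at hz1
    · rw [norm_smul, Real.norm_of_nonneg hz0.le]
      exact mul_le_mul_of_nonneg_left (hr x hx) hz0.le
  have h6 : 2 * (z - x) ^ 2 * ‖K x‖ ^ 2 * ‖y x‖ < ε * (z - x) := by
    have := mul_lt_mul_of_pos_right hz2 hz0
    nlinarith
  have : q = b' x + 2 * ε := by rw [hε]; ring
  rw [this]
  nlinarith

end Dynamics

/-! ### The comparison principle for commutators -/

section

lemma norm_commutator_le {ι : Type} [Fintype ι] [DecidableEq ι] (A B : Matrix ι ι ℂ) :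
    ‖A * B - B * A‖ ≤ 2 * ‖A‖ * ‖B‖ := by
  calc _ ≤ ‖A * B‖ + ‖B * A‖ := norm_sub_le _ _
    _ ≤ ‖A‖ * ‖B‖ + ‖B‖ * ‖A‖ := add_le_add (norm_mul_le _ _) (norm_mul_le _ _)
    _ = _ := by ring

section Master

variable {M : Model L} {Ω : Type*} [Fintype Ω] {H H₀ : M.Op} {T : ℝ} {S : Ω → Finset L.site}
  {k : Ω → ℝ → M.Op} {b u : Ω → ℝ} {v : ℝ} {B : M.Op} {Y : Finset L.site}

/-- The weight `w` of the region `Z` dominates the commutator with `B` at time zero, and its growth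
at rate `v` dominates the effect of the terms that touch `Z`. -/
def IsSupersolution (S : Ω → Finset L.site) (b u : Ω → ℝ) (v : ℝ) (B : M.Op) (Y Z : Finset L.site)
    (w : ℝ) : Prop :=
  0 ≤ w ∧ (¬ Disjoint Z Y → 2 * ‖B‖ ≤ w) ∧
    2 * ∑ ω ∈ Finset.univ.filter (fun ω => ¬ Disjoint (S ω) Z), b ω * u ω ≤ v * w

/-- Differentiation lowers the degree of the remainder by one, which is the step of the induction in
`norm_commutator_intPic_le`. -/
lemma hasDerivAt_exp_add_pow (o w c Λ v : ℝ) (n : ℕ) (s : ℝ) :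
    HasDerivAt (fun s => o * (w * Real.exp (v * s) + c * ((Λ * s) ^ (n + 1) / (n + 1).factorial)))
      (o * (w * (Real.exp (v * s) * v) + c * (Λ * ((Λ * s) ^ n / n.factorial)))) s := by
  have h1 : HasDerivAt (fun s => Real.exp (v * s)) (Real.exp (v * s) * v) s := by
    have := (hasDerivAt_id s).const_mul v
    simp only [mul_one] at this
    exact this.exp
  have h2 : HasDerivAt (fun s => (Λ * s) ^ (n + 1) / ((n + 1).factorial : ℝ))
      (Λ * ((Λ * s) ^ n / n.factorial)) s := by
    have h := ((hasDerivAt_id s).const_mul Λ).pow (n + 1)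
    have h := h.div_const ((n + 1).factorial : ℝ)
    refine h.congr_deriv ?_
    have : (n.factorial : ℝ) ≠ 0 := by positivity
    rw [Nat.factorial_succ]
    push_cast
    simp only [id, mul_one]
    field_simp
  exact ((h1.const_mul w).add (h2.const_mul c)).const_mul o

lemma two_mul_sum_mul_add_le {Ω : Type*} (F : Finset Ω) (b u : Ω → ℝ) {o x e Λ y : ℝ} (ho : 0 ≤ o)
    (hx : 0 ≤ x) (he : 0 ≤ e) (h1 : 2 * ∑ ω ∈ F, b ω * u ω ≤ y) (h2 : 2 * ∑ ω ∈ F, b ω ≤ Λ) :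
    2 * (∑ ω ∈ F, b ω * (u ω * x + e)) * o ≤ o * (y * x + Λ * e) := by
  have e1 : ∑ ω ∈ F, b ω * (u ω * x + e) = (∑ ω ∈ F, b ω * u ω) * x + (∑ ω ∈ F, b ω) * e := by
    simp only [mul_add, Finset.sum_add_distrib, Finset.sum_mul, mul_assoc]
  rw [e1]
  calc _ = o * ((2 * ∑ ω ∈ F, b ω * u ω) * x + (2 * ∑ ω ∈ F, b ω) * e) := by ring
    _ ≤ _ := by gcongr

/-- A Lieb-Robinson bound in the interaction picture, from a supersolution. -/
theorem norm_commutator_intPic_le (hH : H.IsHermitian) (hH₀ : H₀.IsHermitian)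
    (hB : B ∈ M.localAlg Y) (hkm : ∀ ω s, k ω s ∈ M.localAlg (S ω))
    (hkh : ∀ ω s, (k ω s).IsHermitian) (hb0 : ∀ ω, 0 ≤ b ω)
    (hkb : ∀ ω, ∀ s ∈ Set.Icc 0 T, ‖k ω s‖ ≤ b ω)
    (hsum : ∀ s, heisenberg H₀ (H - H₀) s = ∑ ω, k ω s)
    (hu : ∀ ω, IsSupersolution S b u v B Y (S ω) (u ω))
    {Z : Finset L.site} {w : ℝ} (hZ : IsSupersolution S b u v B Y Z w)
    {O : M.Op} (hO : O ∈ M.localAlg Z) {s : ℝ} (hs : s ∈ Set.Icc 0 T) :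
    ‖intPic H H₀ O s * B - B * intPic H H₀ O s‖ ≤ ‖O‖ * (w * Real.exp (v * s)) := by
  -- `Λ` is a crude growth rate that depends on the system size. It enters only through the
  -- remainder `(Λ s) ^ n / n!`, which is zeroth order the trivial bound, improves with each
  -- iteration, and vanishes as `n → ∞`.
  set Λ : ℝ := 2 * ∑ ω, b ω with hΛ
  have claim : ∀ (n : ℕ) (Z : Finset L.site) (w : ℝ), IsSupersolution S b u v B Y Z w →
      ∀ O ∈ M.localAlg Z, ∀ s ∈ Set.Icc 0 T,
      ‖intPic H H₀ O s * B - B * intPic H H₀ O s‖ ≤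
        ‖O‖ * (w * Real.exp (v * s) + 2 * ‖B‖ * ((Λ * s) ^ n / n.factorial)) := by
    intro n
    induction n with
    | zero =>
      intro Z w hZ O hO s hs
      refine (norm_commutator_le _ _).trans ?_
      rw [norm_intPic hH hH₀]
      have := mul_nonneg hZ.1 (Real.exp_pos (v * s)).le
      have := norm_nonneg O
      simp only [pow_zero, Nat.factorial_zero, Nat.cast_one, div_one, mul_one]
      nlinarith
    | succ n ih =>
      intro Z w hZ O hO
      set hit := Finset.univ.filter (fun ω => ¬ Disjoint (S ω) Z) with hhit
      set x := intPic H H₀ O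
      set K : ℝ → M.Op := fun s => ∑ ω ∈ hit, intPic H H₀ (k ω s) s with hK
      have hKh : ∀ s, (K s).IsHermitian := by
        intro s
        change IsSelfAdjoint (∑ ω ∈ hit, intPic H H₀ (k ω s) s)
        refine isSelfAdjoint_sum _ fun ω _ => ?_
        exact heisenberg_isHermitian hH (heisenberg_isHermitian hH₀ (hkh ω s) _) _
      -- A term away from `Z` commutes with `O`, and the interaction picture is multiplicative, so
      -- only the terms in `hit` drive `x`.
      have hder : ∀ s, Complex.I • (heisenberg H (H - H₀) s * x s - x s * heisenberg H (H - H₀) s) =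
          Complex.I • (K s * x s - x s * K s) := by
        intro s
        congr 1
        rw [← intPic_heisenberg H H₀, hsum]
        have e1 : (∑ ω, k ω s) * O - O * ∑ ω, k ω s =
            (∑ ω ∈ hit, k ω s) * O - O * ∑ ω ∈ hit, k ω s := by
          simp only [Finset.sum_mul, Finset.mul_sum, ← Finset.sum_sub_distrib]
          refine (Finset.sum_subset (Finset.subset_univ _) fun ω _ hω => ?_).symm
          have hd : Disjoint (S ω) Z := by
            by_contra hd; exact hω (by simp [hhit, hd])
          rw [M.localAlg_commute hd (hkm ω s) hO, sub_self]
        have e2 := congrArg (fun A => intPic H H₀ A s) e1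
        simp only [intPic_sub, intPic_mul] at e2
        rw [show x s = intPic H H₀ O s from rfl, hK, e2, intPic_sum]
      -- Jacobi identity: the first commutator rotates `[x, B]` without changing its norm, so only
      -- `[K, B]` acts as a source.
      have hy : ∀ s, HasDerivAt (fun s => x s * B - B * x s)
          (Complex.I • (K s * (x s * B - B * x s) - (x s * B - B * x s) * K s) +
            Complex.I • ((K s * B - B * K s) * x s - x s * (K s * B - B * K s))) s := by
        intro s
        have h1 : HasDerivAt x (Complex.I • (K s * x s - x s * K s)) s := by
          rw [← hder s]; exact hasDerivAt_intPic H H₀ O s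
        refine ((h1.mul_const B).sub (h1.const_mul B)).congr_deriv ?_
        rw [Matrix.smul_mul, Matrix.mul_smul, ← smul_sub, ← smul_add]
        congr 1
        noncomm_ring
      refine norm_le_of_hasDerivAt_commutator hKh hy ?_
        (hasDerivAt_exp_add_pow ‖O‖ w (2 * ‖B‖) Λ v n) ?_
      · have hx0 : x 0 = O := by simp [x, intPic, heisenberg_zero]
        rw [hx0]
        simp only [mul_zero, Real.exp_zero, mul_one, ne_eq, Nat.add_eq_zero_iff, one_ne_zero,
          and_false, not_false_eq_true, zero_pow, zero_div, add_zero]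
        by_cases hd : Disjoint Z Y
        · rw [M.localAlg_commute hd hO hB, sub_self, norm_zero]
          exact mul_nonneg (norm_nonneg _) hZ.1
        · refine (norm_commutator_le _ _).trans ?_
          have := hZ.2.1 hd
          have := norm_nonneg O
          nlinarith
      · intro s hs
        have hs' : s ∈ Set.Icc 0 T := ⟨hs.1, hs.2.le⟩
        set E : ℝ := 2 * ‖B‖ * ((Λ * s) ^ n / n.factorial) with hE
        have hΛ0 : 0 ≤ Λ := mul_nonneg zero_le_two (Finset.sum_nonneg fun ω _ => hb0 ω)
        have hE0 : 0 ≤ E := by have := hs.1; positivity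
        -- The induction hypothesis is applied to each generator term, frozen at the time `s` at
        -- which it is needed.
        have hKB : ‖K s * B - B * K s‖ ≤ ∑ ω ∈ hit, b ω * (u ω * Real.exp (v * s) + E) := by
          rw [hK, Finset.sum_mul, Finset.mul_sum, ← Finset.sum_sub_distrib]
          refine (norm_sum_le _ _).trans (Finset.sum_le_sum fun ω _ => ?_)
          refine (ih (S ω) (u ω) (hu ω) _ (hkm ω s) s hs').trans ?_
          have : 0 ≤ u ω * Real.exp (v * s) + E := by have := (hu ω).1; positivity
          exact mul_le_mul_of_nonneg_right (hkb ω s hs') this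
        have hxn : ‖x s‖ = ‖O‖ := norm_intPic hH hH₀ O s
        calc _ = ‖(K s * B - B * K s) * x s - x s * (K s * B - B * K s)‖ := by
              rw [norm_smul, Complex.norm_I, one_mul]
          _ ≤ 2 * ‖K s * B - B * K s‖ * ‖O‖ := by rw [← hxn]; exact norm_commutator_le _ _
          _ ≤ 2 * (∑ ω ∈ hit, b ω * (u ω * Real.exp (v * s) + E)) * ‖O‖ := by gcongr
          _ ≤ ‖O‖ * ((v * w) * Real.exp (v * s) + Λ * E) := by
              refine two_mul_sum_mul_add_le hit b u (norm_nonneg O) (Real.exp_pos _).le hE0 hZ.2.2 ?_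
              rw [hΛ]
              gcongr
              · exact fun ω _ _ => hb0 ω
              · exact Finset.subset_univ _
          _ = _ := by rw [hE]; ring
  have hlim : Filter.Tendsto (fun n : ℕ => ‖O‖ * (w * Real.exp (v * s) +
      2 * ‖B‖ * ((Λ * s) ^ n / n.factorial))) Filter.atTop
      (nhds (‖O‖ * (w * Real.exp (v * s) + 2 * ‖B‖ * 0))) :=
    ((FloorSemiring.tendsto_pow_div_factorial_atTop (Λ * s)).const_mul _ |>.const_add _).const_mul _
  rw [mul_zero, add_zero] at hlim
  exact ge_of_tendsto' hlim fun n => claim n Z w hZ O hO s hs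

end Master

namespace Interaction

variable {M : Model L}

open Classical in
/-- The terms of an interaction on the regions that satisfy `p`. -/
def restrict (Φ : Interaction M) (p : Finset L.site → Prop) : Interaction M where
  term X := if p X then Φ.term X else 0
  term_mem X := by
    split_ifs
    · exact Φ.term_mem X
    · exact (M.localAlg X).zero_mem
  term_isHermitian X := by
    split_ifs
    · exact Φ.term_isHermitian X
    · exact Matrix.isHermitian_zero

/-- The interaction with all signs reversed. -/
def neg (Φ : Interaction M) : Interaction M where
  term X := -Φ.term X
  term_mem X := (M.localAlg X).neg_mem (Φ.term_mem X)
  term_isHermitian X := (Φ.term_isHermitian X).neg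

lemma neg_hamiltonian (Φ : Interaction M) : Φ.neg.hamiltonian = -Φ.hamiltonian := by
  simp [hamiltonian, neg]

lemma hamiltonian_isHermitian (Φ : Interaction M) : Φ.hamiltonian.IsHermitian :=
  isSelfAdjoint_sum _ fun X _ => Φ.term_isHermitian X

lemma restrict_add_restrict_not (Φ : Interaction M) (p q : Finset L.site → Prop) :
    (Φ.restrict p).hamiltonian = (Φ.restrict fun X => p X ∧ q X).hamiltonian +
      (Φ.restrict fun X => p X ∧ ¬ q X).hamiltonian := by
  simp only [hamiltonian, restrict, ← Finset.sum_add_distrib]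
  refine Finset.sum_congr rfl fun X _ => ?_
  by_cases hp : p X <;> by_cases hq : q X <;> simp [hp, hq]

lemma norm_restrict_term_le (Φ : Interaction M) (p : Finset L.site → Prop) (X : Finset L.site) :
    ‖(Φ.restrict p).term X‖ ≤ ‖Φ.term X‖ := by
  simp only [restrict]
  split_ifs <;> simp

lemma hamiltonian_mem_localAlg (Φ : Interaction M) {Z : Finset L.site}
    (h : ∀ X, Φ.term X ≠ 0 → X ⊆ Z) : Φ.hamiltonian ∈ M.localAlg Z := by
  refine (M.localAlg Z).sum_mem fun X _ => ?_
  by_cases hX : Φ.term X = 0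
  · rw [hX]; exact (M.localAlg Z).zero_mem
  · exact M.localAlg_mono (h X hX) (Φ.term_mem X)

lemma hamiltonian_commute (Φ : Interaction M) {Z : Finset L.site} {A : M.Op}
    (hA : A ∈ M.localAlg Z) (h : ∀ X, Φ.term X ≠ 0 → Disjoint X Z) :
    Φ.hamiltonian * A = A * Φ.hamiltonian := by
  simp only [hamiltonian, Finset.sum_mul, Finset.mul_sum]
  refine Finset.sum_congr rfl fun X _ => ?_
  by_cases hX : Φ.term X = 0
  · simp [hX]
  · exact M.localAlg_commute (h X hX) (Φ.term_mem X) hA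

/-- If every term lies inside `Z` or is disjoint from `Z`, the evolution preserves the operators
on `Z`. -/
lemma heisenberg_mem_localAlg_of_decoupled (Φ : Interaction M) {Z : Finset L.site} {A : M.Op}
    (hA : A ∈ M.localAlg Z) (h : ∀ X, Φ.term X ≠ 0 → X ⊆ Z ∨ Disjoint X Z) (t : ℝ) :
    heisenberg Φ.hamiltonian A t ∈ M.localAlg Z := by
  have e0 : Φ.hamiltonian = (Φ.restrict fun _ => True).hamiltonian := by
    simp [hamiltonian, restrict]
  have h1 : (Φ.restrict fun X => True ∧ X ⊆ Z).hamiltonian ∈ M.localAlg Z := by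
    refine hamiltonian_mem_localAlg _ fun X hX => ?_
    by_contra hc; exact hX (by simp [restrict, hc])
  have h2 : ∀ {C : M.Op}, C ∈ M.localAlg Z → (Φ.restrict fun X => True ∧ ¬ X ⊆ Z).hamiltonian * C =
      C * (Φ.restrict fun X => True ∧ ¬ X ⊆ Z).hamiltonian := by
    intro C hC
    refine hamiltonian_commute _ hC fun X hX => ?_
    have hs : ¬ X ⊆ Z := by
      intro hc; exact hX (by simp [restrict, hc])
    have hn : Φ.term X ≠ 0 := by
      intro hc; exact hX (by simp [restrict, hc])
    exact (h X hn).resolve_left hs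
  rw [e0, restrict_add_restrict_not Φ _ (fun X => X ⊆ Z),
    heisenberg_add_of_commute (h2 h1).symm (h2 hA)]
  exact M.heisenberg_mem_localAlg h1 hA t

/-- If `X` contains `i` and has at least two sites, then `∑ j ∈ X, φ j` is at most the sum of `φ i +
φ j` over the other sites `j` of `X`: there is at least one of them to carry `φ i`. Exchanging the
sums then produces the pair couplings. -/
lemma sum_touching_le (Φ : Interaction M) {J : L.site → L.site → ℝ}
    (hJ : ∀ i j, i ≠ j → ∑ X ∈ Finset.univ.filter (fun X : Finset L.site => i ∈ X ∧ j ∈ X),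
      ‖Φ.term X‖ ≤ J i j)
    {φ : L.site → ℝ} (hφ0 : ∀ i, 0 ≤ φ i) (i : L.site) :
    ∑ X ∈ Finset.univ.filter (fun X : Finset L.site => i ∈ X),
      (if 2 ≤ X.card then ‖Φ.term X‖ else 0) * ∑ j ∈ X, φ j ≤
    ∑ j ∈ Finset.univ.erase i, J i j * (φ i + φ j) := by
  calc _ ≤ ∑ X ∈ Finset.univ.filter (fun X : Finset L.site => i ∈ X),
        ∑ j ∈ Finset.univ.erase i, if j ∈ X then ‖Φ.term X‖ * (φ i + φ j) else 0 := by
        refine Finset.sum_le_sum fun X hX => ?_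
        have hi : i ∈ X := by simpa using hX
        rw [← Finset.sum_filter]
        have e : (Finset.univ.erase i).filter (fun j => j ∈ X) = X.erase i := by
          ext j; simp
        rw [e]
        split_ifs with hc
        · rw [← Finset.mul_sum]
          refine mul_le_mul_of_nonneg_left ?_ (norm_nonneg _)
          rw [Finset.sum_add_distrib, ← Finset.add_sum_erase _ _ hi, Finset.sum_const,
            nsmul_eq_mul, Finset.card_erase_of_mem hi]
          have : (1 : ℝ) ≤ ((X.card - 1 : ℕ) : ℝ) := by
            exact_mod_cast (by omega : 1 ≤ X.card - 1)
          have := hφ0 i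
          nlinarith
        · rw [zero_mul]
          exact Finset.sum_nonneg fun j _ => mul_nonneg (norm_nonneg _) (add_nonneg (hφ0 i) (hφ0 j))
    _ = ∑ j ∈ Finset.univ.erase i, (∑ X ∈ Finset.univ.filter
          (fun X : Finset L.site => i ∈ X ∧ j ∈ X), ‖Φ.term X‖) * (φ i + φ j) := by
        rw [Finset.sum_comm]
        refine Finset.sum_congr rfl fun j _ => ?_
        rw [← Finset.sum_filter, Finset.filter_filter, Finset.sum_mul]
    _ ≤ _ := by
        refine Finset.sum_le_sum fun j hj => ?_
        exact mul_le_mul_of_nonneg_right (hJ i j (Finset.ne_of_mem_erase hj).symm)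
          (add_nonneg (hφ0 i) (hφ0 j))

/-- A sum over the regions that touch `Z` is at most the sum over the sites of `Z`. -/
lemma sum_not_disjoint_le (Z : Finset L.site) {Ω : Type*} [Fintype Ω] (S : Ω → Finset L.site)
    {f : Ω → ℝ} (hf : ∀ ω, 0 ≤ f ω) :
    ∑ ω ∈ Finset.univ.filter (fun ω => ¬ Disjoint (S ω) Z), f ω ≤
      ∑ i ∈ Z, ∑ ω ∈ Finset.univ.filter (fun ω => i ∈ S ω), f ω := by
  simp only [Finset.sum_filter]
  rw [Finset.sum_comm]
  refine Finset.sum_le_sum fun ω _ => ?_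
  have h0 : ∀ j ∈ Z, 0 ≤ if j ∈ S ω then f ω else 0 := fun j _ => by split_ifs <;> simp [hf]
  by_cases h : Disjoint (S ω) Z
  · rw [if_neg (not_not.2 h)]
    exact Finset.sum_nonneg h0
  · obtain ⟨i, hi, hiZ⟩ := Finset.not_disjoint_iff.1 h
    refine le_trans ?_ (Finset.single_le_sum h0 hiZ)
    simp [hi, h]

/-- The terms on at most one site are not controlled by the pair couplings `J`. They are moved into
the free evolution, which preserves supports and norms. For the others, the weight `2‖B‖ ∑ i ∈ Z, φ
i` is a supersolution by `sum_touching_le`; the rate doubles because a commutator has two terms. -/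
theorem norm_commutator_heisenberg_le_of_nonneg (Φ : Interaction M) {J : L.site → L.site → ℝ}
    (hJ : ∀ i j, i ≠ j → ∑ X ∈ Finset.univ.filter (fun X : Finset L.site => i ∈ X ∧ j ∈ X),
      ‖Φ.term X‖ ≤ J i j)
    {φ : L.site → ℝ} (hφ0 : ∀ i, 0 ≤ φ i) {Y : Finset L.site} (hφY : ∀ y ∈ Y, 1 ≤ φ y) {v : ℝ}
    (hv : ∀ i, ∑ j ∈ Finset.univ.erase i, J i j * (φ i + φ j) ≤ v * φ i)
    {X : Finset L.site} {A B : M.Op} (hA : A ∈ M.localAlg X) (hB : B ∈ M.localAlg Y) {t : ℝ}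
    (ht : 0 ≤ t) :
    ‖heisenberg Φ.hamiltonian A t * B - B * heisenberg Φ.hamiltonian A t‖ ≤
      2 * ‖A‖ * ‖B‖ * Real.exp (2 * v * t) * ∑ i ∈ X, φ i := by
  set Ψ := Φ.restrict fun X => X.card ≤ 1 with hΨ
  have hdec : ∀ Z W : Finset L.site, Ψ.term W ≠ 0 → W ⊆ Z ∨ Disjoint W Z := by
    intro Z W hW
    have hc : W.card ≤ 1 := by
      by_contra hc; exact hW (by simp [hΨ, restrict, hc])
    rcases W.eq_empty_or_nonempty with rfl | ⟨x, hxW⟩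
    · exact Or.inl (Finset.empty_subset Z)
    have hx : W ⊆ {x} := fun y hy => Finset.mem_singleton.2 (Finset.card_le_one.1 hc y hy x hxW)
    by_cases hxZ : x ∈ Z
    · exact Or.inl (hx.trans (by simpa using hxZ))
    · exact Or.inr (Finset.disjoint_of_subset_left hx (by simpa using hxZ))
  set b : Finset L.site → ℝ := fun X => if 2 ≤ X.card then ‖Φ.term X‖ else 0 with hbdef
  set u : Finset L.site → ℝ := fun X => 2 * ‖B‖ * ∑ i ∈ X, φ i with hudef
  have hb0 : ∀ X, 0 ≤ b X := fun X => by rw [hbdef]; dsimp only; split_ifs <;> simp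
  have hsup : ∀ Z, IsSupersolution (fun X => X) b u (2 * v) B Y Z (u Z) := by
    intro Z
    refine ⟨mul_nonneg (by positivity) (Finset.sum_nonneg fun i _ => hφ0 i), fun hd => ?_, ?_⟩
    · obtain ⟨y, hyZ, hy⟩ := Finset.not_disjoint_iff.1 hd
      have : 1 ≤ ∑ i ∈ Z, φ i :=
        (hφY y hy).trans (Finset.single_le_sum (fun i _ => hφ0 i) hyZ)
      have := norm_nonneg B
      rw [hudef]
      nlinarith
    · have h1 := sum_not_disjoint_le Z (fun X : Finset L.site => X) (f := fun X => b X * ∑ i ∈ X, φ i)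
        fun X => mul_nonneg (hb0 X) (Finset.sum_nonneg fun i _ => hφ0 i)
      have h2 : ∑ i ∈ Z, ∑ X ∈ Finset.univ.filter (fun X : Finset L.site => i ∈ X),
          b X * ∑ i ∈ X, φ i ≤ ∑ i ∈ Z, v * φ i :=
        Finset.sum_le_sum fun i _ => (Φ.sum_touching_le hJ hφ0 i).trans (hv i)
      rw [← Finset.mul_sum] at h2
      have h3 : ∑ X ∈ Finset.univ.filter (fun X : Finset L.site => ¬ Disjoint X Z), b X * u X =
          2 * ‖B‖ * ∑ X ∈ Finset.univ.filter (fun X : Finset L.site => ¬ Disjoint X Z),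
            b X * ∑ i ∈ X, φ i := by
        rw [Finset.mul_sum]
        exact Finset.sum_congr rfl fun X _ => by rw [hudef]; ring
      rw [h3, hudef]
      have := norm_nonneg B
      calc _ ≤ 2 * (2 * ‖B‖ * (v * ∑ i ∈ Z, φ i)) := by
            gcongr
            exact h1.trans h2
        _ = _ := by ring
  have key := norm_commutator_intPic_le (H := Φ.hamiltonian) (H₀ := Ψ.hamiltonian) (T := t)
    (S := fun X : Finset L.site => X) (k := fun X s => if 2 ≤ X.card then
      heisenberg Ψ.hamiltonian (Φ.term X) s else 0) (b := b) (u := u) (v := 2 * v)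
    Φ.hamiltonian_isHermitian Ψ.hamiltonian_isHermitian hB ?_ ?_ hb0 ?_ ?_ hsup (hsup X)
    (O := heisenberg Ψ.hamiltonian A t) (Ψ.heisenberg_mem_localAlg_of_decoupled hA (hdec X) t)
    (s := t) ⟨ht, le_rfl⟩
  · rw [intPic_heisenberg, norm_heisenberg Ψ.hamiltonian_isHermitian] at key
    refine key.trans (le_of_eq ?_)
    rw [hudef]; ring
  · intro X s
    split_ifs
    · exact Ψ.heisenberg_mem_localAlg_of_decoupled (Φ.term_mem X) (hdec X) s
    · exact (M.localAlg X).zero_mem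
  · intro X s
    split_ifs
    · exact heisenberg_isHermitian Ψ.hamiltonian_isHermitian (Φ.term_isHermitian X) s
    · exact Matrix.isHermitian_zero
  · intro X s _
    rw [hbdef]
    dsimp only
    split_ifs
    · rw [norm_heisenberg Ψ.hamiltonian_isHermitian]
    · simp
  · intro s
    have : Φ.hamiltonian - Ψ.hamiltonian = ∑ X : Finset L.site,
        if 2 ≤ X.card then Φ.term X else 0 := by
      simp only [hamiltonian, hΨ, restrict, ← Finset.sum_sub_distrib]
      refine Finset.sum_congr rfl fun X _ => ?_
      by_cases hc : X.card ≤ 1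
      · simp [hc, show ¬ 2 ≤ X.card by omega]
      · simp [hc, show 2 ≤ X.card by omega]
    rw [this, heisenberg_sum]
    refine Finset.sum_congr rfl fun X _ => ?_
    split_ifs
    · rfl
    · simp [heisenberg_eq]

/-- A Lieb-Robinson bound from a positive function that is nearly invariant under the couplings. -/
theorem norm_commutator_heisenberg_le (Φ : Interaction M) {J : L.site → L.site → ℝ}
    (hJ : ∀ i j, i ≠ j → ∑ X ∈ Finset.univ.filter (fun X : Finset L.site => i ∈ X ∧ j ∈ X),
      ‖Φ.term X‖ ≤ J i j)
    {φ : L.site → ℝ} (hφ0 : ∀ i, 0 ≤ φ i) {Y : Finset L.site} (hφY : ∀ y ∈ Y, 1 ≤ φ y) {v : ℝ}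
    (hv : ∀ i, ∑ j ∈ Finset.univ.erase i, J i j * (φ i + φ j) ≤ v * φ i)
    {X : Finset L.site} {A B : M.Op} (hA : A ∈ M.localAlg X) (hB : B ∈ M.localAlg Y) (t : ℝ) :
    ‖heisenberg Φ.hamiltonian A t * B - B * heisenberg Φ.hamiltonian A t‖ ≤
      2 * ‖A‖ * ‖B‖ * Real.exp (2 * v * |t|) * ∑ i ∈ X, φ i := by
  rcases le_total 0 t with ht | ht
  · rw [abs_of_nonneg ht]
    exact Φ.norm_commutator_heisenberg_le_of_nonneg hJ hφ0 hφY hv hA hB ht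
  · rw [abs_of_nonpos ht]
    have h := Φ.neg.norm_commutator_heisenberg_le_of_nonneg (J := J)
      (fun i j hij => by simpa [neg] using hJ i j hij) hφ0 hφY hv hA hB (neg_nonneg.2 ht)
    rwa [neg_hamiltonian, ← heisenberg_neg_time, neg_neg] at h

end Interaction

end

/-! ### Lattice sums and Lieb-Robinson bounds with exponential growth -/

section

section Distances

lemma regionDist_le {X Y : Finset L.site} {i j : L.site} (hi : i ∈ X) (hj : j ∈ Y) :
    regionDist X Y ≤ dist i j :=
  csInf_le ⟨0, by rintro r ⟨i, -, j, -, rfl⟩; exact dist_nonneg⟩ ⟨i, hi, j, hj, rfl⟩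

lemma one_le_regionDist {X Y : Finset L.site} (hX : X.Nonempty) (hY : Y.Nonempty)
    (hXY : Disjoint X Y) : 1 ≤ regionDist X Y := by
  obtain ⟨i, hi⟩ := hX
  obtain ⟨j, hj⟩ := hY
  refine le_csInf ⟨_, i, hi, j, hj, rfl⟩ ?_
  rintro r ⟨i, hi, j, hj, rfl⟩
  exact L.one_le_dist i j fun h => Finset.disjoint_left.1 hXY hi (h ▸ hj)

lemma card_filter_dist_le (a : L.site) {r : ℝ} (hr : 0 ≤ r) :
    ((Finset.univ.filter fun b : L.site => dist a b ≤ r).card : ℝ) ≤ κ * (1 + r) ^ D := by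
  have h := L.card_ball_le a r hr
  rwa [← Set.ncard_coe_finset, Finset.coe_filter_univ]

lemma add_rpow_le_two_rpow_mul {x y α : ℝ} (hx : 0 ≤ x) (hy : 0 ≤ y) (hα : 0 ≤ α) :
    (x + y) ^ α ≤ 2 ^ α * (x ^ α + y ^ α) := by
  have h1 : (x + y) ^ α ≤ (2 * max x y) ^ α := by
    refine Real.rpow_le_rpow (by positivity) ?_ hα
    have := le_max_left x y
    have := le_max_right x y
    linarith
  rw [Real.mul_rpow zero_le_two (le_max_of_le_left hx)] at h1
  refine h1.trans (mul_le_mul_of_nonneg_left ?_ (by positivity))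
  rcases max_cases x y with ⟨h, -⟩ | ⟨h, -⟩ <;> rw [h]
  · linarith [Real.rpow_nonneg hy α]
  · linarith [Real.rpow_nonneg hx α]

end Distances

variable (D κ)

/-- Dyadic decomposition: the shell `1 + d/ρ ≈ 2 ^ m` has at most a constant times `(ρ 2 ^ m) ^ D`
sites, each contributing at most `2 ^ (-α m)`, so the shells form a geometric series of ratio `2 ^
(D - α) < 1`. -/
theorem exists_sum_rpow_le {α : ℝ} (hα : (D : ℝ) < α) : ∃ C : ℝ, 0 < C ∧
    ∀ (L : Lattice D κ) (a : L.site) (ρ : ℝ), 1 ≤ ρ →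
      ∑ b, (1 + dist a b / ρ) ^ (-α) ≤ C * ρ ^ D := by
  set q : ℝ := 2 ^ ((D : ℝ) - α) with hq
  have hq0 : 0 < q := Real.rpow_pos_of_pos two_pos _
  have hq1 : q < 1 := Real.rpow_lt_one_of_one_lt_of_neg one_lt_two (by linarith)
  refine ⟨(|κ| + 1) * 4 ^ D * (1 - q)⁻¹, by have := sub_pos.2 hq1; positivity, ?_⟩
  intro L a ρ hρ
  have hρ0 : 0 < ρ := by linarith
  set n : L.site → ℕ := fun b => Nat.log 2 ⌊1 + dist a b / ρ⌋₊ with hn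
  have hx1 : ∀ b, 1 ≤ 1 + dist a b / ρ := fun b => by
    have : 0 ≤ dist a b / ρ := by positivity
    linarith
  have hfl : ∀ b, ⌊1 + dist a b / ρ⌋₊ ≠ 0 := fun b => by
    have := Nat.le_floor (n := 1) (a := 1 + dist a b / ρ) (by simpa using hx1 b)
    omega
  have hlow : ∀ b, (2 : ℝ) ^ n b ≤ 1 + dist a b / ρ := fun b => by
    have h1 := Nat.pow_log_le_self 2 (hfl b)
    have h2 : ((2 ^ n b : ℕ) : ℝ) ≤ (⌊1 + dist a b / ρ⌋₊ : ℝ) := by exact_mod_cast h1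
    have h3 := Nat.floor_le (zero_le_one.trans (hx1 b))
    push_cast at h2
    linarith
  have hup : ∀ b, 1 + dist a b / ρ ≤ 2 ^ (n b + 1) := fun b => by
    have h1 := Nat.lt_pow_succ_log_self (b := 2) one_lt_two ⌊1 + dist a b / ρ⌋₊
    have h2 : ((⌊1 + dist a b / ρ⌋₊ + 1 : ℕ) : ℝ) ≤ ((2 ^ (n b + 1) : ℕ) : ℝ) := by
      exact_mod_cast h1
    have h3 := Nat.lt_floor_add_one (1 + dist a b / ρ)
    push_cast at h2
    linarith
  obtain ⟨N, hN⟩ : ∃ N, ∀ b, n b < N := by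
    refine ⟨Finset.univ.sup n + 1, fun b => Nat.lt_succ_of_le (Finset.le_sup (Finset.mem_univ b))⟩
  have hD : (0 : ℝ) ≤ D := Nat.cast_nonneg D
  calc ∑ b, (1 + dist a b / ρ) ^ (-α) ≤ ∑ b, ((2 : ℝ) ^ n b) ^ (-α) := by
        refine Finset.sum_le_sum fun b _ => ?_
        exact Real.rpow_le_rpow_of_nonpos (by positivity) (hlow b) (by linarith)
    _ = ∑ m ∈ Finset.range N, ∑ b ∈ Finset.univ.filter (fun b => n b = m), ((2 : ℝ) ^ n b) ^ (-α) :=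
        (Finset.sum_fiberwise_of_maps_to (fun b _ => Finset.mem_range.2 (hN b)) _).symm
    _ ≤ ∑ m ∈ Finset.range N, (|κ| + 1) * 4 ^ D * ρ ^ D * q ^ m := by
        refine Finset.sum_le_sum fun m _ => ?_
        have e : ∑ b ∈ Finset.univ.filter (fun b => n b = m), ((2 : ℝ) ^ n b) ^ (-α) =
            (Finset.univ.filter (fun b => n b = m)).card * ((2 : ℝ) ^ m) ^ (-α) := by
          rw [Finset.sum_congr rfl fun b hb => by rw [(Finset.mem_filter.1 hb).2],
            Finset.sum_const, nsmul_eq_mul]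
        rw [e]
        have hc : ((Finset.univ.filter (fun b => n b = m)).card : ℝ) ≤
            (|κ| + 1) * (4 * ρ * 2 ^ m) ^ D := by
          have h1 : ((Finset.univ.filter (fun b => n b = m)).card : ℝ) ≤
              (Finset.univ.filter fun b : L.site => dist a b ≤ 2 ^ (m + 1) * ρ).card := by
            refine Nat.cast_le.2 (Finset.card_le_card fun b hb => ?_)
            have hb := (Finset.mem_filter.1 hb).2
            have h2 := hup b
            rw [hb] at h2
            have h3 : dist a b / ρ ≤ 2 ^ (m + 1) := by linarith
            rw [div_le_iff₀ hρ0] at h3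
            simpa using h3
          refine h1.trans ((card_filter_dist_le a (by positivity)).trans ?_)
          have h4 : 1 + 2 ^ (m + 1) * ρ ≤ 4 * ρ * 2 ^ m := by
            have : (1 : ℝ) ≤ 2 ^ m := one_le_pow₀ one_le_two
            rw [pow_succ]
            nlinarith
          have h5 : κ ≤ |κ| + 1 := by linarith [le_abs_self κ]
          gcongr
        have e2 : ((2 : ℝ) ^ m) ^ D * ((2 : ℝ) ^ m) ^ (-α) = q ^ m := by
          rw [hq, ← Real.rpow_natCast _ D, ← Real.rpow_add (by positivity), ← Real.rpow_natCast,
            ← Real.rpow_natCast, ← Real.rpow_mul zero_le_two, ← Real.rpow_mul zero_le_two]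
          congr 1; ring
        calc _ ≤ (|κ| + 1) * (4 * ρ * 2 ^ m) ^ D * ((2 : ℝ) ^ m) ^ (-α) := by gcongr
          _ = (|κ| + 1) * 4 ^ D * ρ ^ D * (((2 : ℝ) ^ m) ^ D * ((2 : ℝ) ^ m) ^ (-α)) := by
            rw [mul_pow, mul_pow]; ring
          _ = _ := by rw [e2]
    _ = (|κ| + 1) * 4 ^ D * ρ ^ D * ∑ m ∈ Finset.range N, q ^ m := by rw [Finset.mul_sum]
    _ ≤ (|κ| + 1) * 4 ^ D * ρ ^ D * (1 - q)⁻¹ := by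
        gcongr
        rw [← tsum_geometric_of_lt_one hq0.le hq1]
        exact (summable_geometric_of_lt_one hq0.le hq1).sum_le_tsum _ fun _ _ => by positivity
    _ = _ := by ring

/-- For `d ≥ χ` one has `d ≥ (χ / 2)(1 + d / χ)`, which reduces the tail to the full sum at scale
`χ`. -/
theorem exists_sum_far_rpow_le {α : ℝ} (hα : (D : ℝ) < α) : ∃ C : ℝ, 0 < C ∧
    ∀ (L : Lattice D κ) (a : L.site) (χ : ℝ), 1 ≤ χ →
      ∑ b ∈ Finset.univ.filter (fun b => χ ≤ dist a b), dist a b ^ (-α) ≤ C * χ ^ ((D : ℝ) - α) := by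
  obtain ⟨C, hC, h⟩ := exists_sum_rpow_le D κ hα
  refine ⟨2 ^ α * C, by positivity, fun L a χ hχ => ?_⟩
  have hχ0 : 0 < χ := by linarith
  have hα0 : 0 ≤ α := (Nat.cast_nonneg D).trans hα.le
  calc _ ≤ ∑ b ∈ Finset.univ.filter (fun b => χ ≤ dist a b),
        2 ^ α * χ ^ (-α) * (1 + dist a b / χ) ^ (-α) := by
        refine Finset.sum_le_sum fun b hb => ?_
        have hb : χ ≤ dist a b := (Finset.mem_filter.1 hb).2
        have hd : 0 < dist a b := by linarith
        have h1 : χ / 2 * (1 + dist a b / χ) ≤ dist a b := by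
          have : χ / 2 * (1 + dist a b / χ) = χ / 2 + dist a b / 2 := by field_simp
          linarith
        have h2 := Real.rpow_le_rpow_of_nonpos (by positivity) h1 (neg_nonpos.2 hα0)
        rw [Real.mul_rpow (by positivity) (by positivity), Real.div_rpow hχ0.le zero_le_two,
          Real.rpow_neg zero_le_two, div_inv_eq_mul] at h2
        linarith
    _ ≤ ∑ b, 2 ^ α * χ ^ (-α) * (1 + dist a b / χ) ^ (-α) :=
        Finset.sum_le_sum_of_subset_of_nonneg (Finset.filter_subset _ _)
          fun b _ _ => by positivity
    _ ≤ 2 ^ α * χ ^ (-α) * (C * χ ^ D) := by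
        rw [← Finset.mul_sum]
        exact mul_le_mul_of_nonneg_left (h L a χ hχ) (by positivity)
    _ = _ := by
        rw [sub_eq_neg_add, Real.rpow_add hχ0, Real.rpow_natCast]; ring

/-- Power laws reproduce themselves under convolution: by the triangle inequality, one of the two
factors is already of the size of the right-hand profile, and the other can be summed. The factor
summed at scale `ρ` yields `ρ ^ (D - α)`, which is no larger than `χ ^ (D - α)` since `χ ≤ ρ`. -/
theorem exists_conv_rpow_le {α : ℝ} (hα : (D : ℝ) < α) : ∃ C : ℝ, 0 < C ∧
    ∀ (L : Lattice D κ) (a y : L.site) (χ ρ : ℝ), 1 ≤ χ → χ ≤ ρ →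
      ∑ b ∈ Finset.univ.filter (fun b => χ ≤ dist a b),
        dist a b ^ (-α) * (1 + dist b y / ρ) ^ (-α) ≤
      C * χ ^ ((D : ℝ) - α) * (1 + dist a y / ρ) ^ (-α) := by
  obtain ⟨C₁, hC₁, h₁⟩ := exists_sum_rpow_le D κ hα
  obtain ⟨C₂, hC₂, h₂⟩ := exists_sum_far_rpow_le D κ hα
  refine ⟨2 ^ α * (C₁ + C₂), by positivity, fun L a y χ ρ hχ hρ => ?_⟩
  have hχ0 : 0 < χ := by linarith
  have hρ0 : 0 < ρ := by linarith
  have hα0 : 0 ≤ α := (Nat.cast_nonneg D).trans hα.le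
  set F : L.site → ℝ := fun b => (1 + dist b y / ρ) ^ (-α) with hF
  have hF0 : ∀ b, 0 < F b := fun b => by rw [hF]; positivity
  have hpt : ∀ b ∈ Finset.univ.filter (fun b => χ ≤ dist a b), dist a b ^ (-α) * F b ≤
      2 ^ α * F a * (dist a b ^ (-α) + ρ ^ (-α) * F b) := by
    intro b hb
    have hd : 0 < dist a b := lt_of_lt_of_le hχ0 (Finset.mem_filter.1 hb).2
    have h3 : 1 + dist a y / ρ ≤ (1 + dist b y / ρ) + dist a b / ρ := by
      rw [add_assoc, ← add_div]
      have := dist_triangle a b y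
      gcongr
      linarith
    have h4 := (Real.rpow_le_rpow (by positivity) h3 hα0).trans
      (add_rpow_le_two_rpow_mul (by positivity) (by positivity) hα0)
    rw [Real.div_rpow hd.le hρ0.le] at h4
    have i1 : F b * (1 + dist b y / ρ) ^ α = 1 := by
      rw [hF]; dsimp only; rw [← Real.rpow_add (by positivity)]; simp
    have i2 : F a * (1 + dist a y / ρ) ^ α = 1 := by
      rw [hF]; dsimp only; rw [← Real.rpow_add (by positivity)]; simp
    have i3 : dist a b ^ (-α) * dist a b ^ α = 1 := by rw [← Real.rpow_add hd]; simp
    have i4 : ρ ^ (-α) = (ρ ^ α)⁻¹ := Real.rpow_neg hρ0.le α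
    have hdα := Real.rpow_pos_of_pos hd (-α)
    have := hF0 a
    have := hF0 b
    calc dist a b ^ (-α) * F b = dist a b ^ (-α) * F b * (F a * (1 + dist a y / ρ) ^ α) := by
          rw [i2, mul_one]
      _ ≤ dist a b ^ (-α) * F b * (F a * (2 ^ α * ((1 + dist b y / ρ) ^ α +
          dist a b ^ α / ρ ^ α))) := by gcongr
      _ = 2 ^ α * F a * (dist a b ^ (-α) * (F b * (1 + dist b y / ρ) ^ α) +
          (dist a b ^ (-α) * dist a b ^ α) * (ρ ^ α)⁻¹ * F b) := by
          rw [div_eq_mul_inv]; ring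
      _ = _ := by rw [i1, i3, i4]; ring
  refine (Finset.sum_le_sum hpt).trans ?_
  rw [← Finset.mul_sum, Finset.sum_add_distrib, ← Finset.mul_sum]
  have h5 : ρ ^ (-α) * ∑ b ∈ Finset.univ.filter (fun b => χ ≤ dist a b), F b ≤
      C₁ * χ ^ ((D : ℝ) - α) := by
    have h6 : ∑ b ∈ Finset.univ.filter (fun b => χ ≤ dist a b), F b ≤ C₁ * ρ ^ D := by
      refine (Finset.sum_le_sum_of_subset_of_nonneg (Finset.filter_subset _ _)
        fun b _ _ => (hF0 b).le).trans ?_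
      refine le_trans (le_of_eq ?_) (h₁ L y ρ (hχ.trans hρ))
      exact Finset.sum_congr rfl fun b _ => by rw [hF, dist_comm]
    calc _ ≤ ρ ^ (-α) * (C₁ * ρ ^ D) := by gcongr
      _ = C₁ * ρ ^ ((D : ℝ) - α) := by
        rw [sub_eq_neg_add, Real.rpow_add hρ0, Real.rpow_natCast]; ring
      _ ≤ _ := by
        gcongr ?_ * ?_
        exact Real.rpow_le_rpow_of_nonpos hχ0 hρ (by linarith)
  have h7 := h₂ L a χ hχ
  have := hF0 a
  calc _ ≤ 2 ^ α * F a * (C₂ * χ ^ ((D : ℝ) - α) + C₁ * χ ^ ((D : ℝ) - α)) := by gcongr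
    _ = _ := by rw [hF]; ring

/-- An exponential is dominated by the summable power `-(D + 1)`. -/
theorem exists_sum_exp_le {δ : ℝ} (hδ : 0 < δ) : ∃ C : ℝ, 0 < C ∧
    ∀ (L : Lattice D κ) (a : L.site), ∑ b, Real.exp (-δ * dist a b) ≤ C := by
  obtain ⟨C, hC, h⟩ := exists_sum_rpow_le D κ (α := ((D + 1 : ℕ) : ℝ)) (by push_cast; linarith)
  set K : ℝ := (D + 1).factorial / δ ^ (D + 1) * Real.exp δ with hK
  have hK0 : 0 < K := by positivity
  refine ⟨K * C, by positivity, fun L a => ?_⟩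
  calc _ ≤ ∑ b, K * (1 + dist a b / 1) ^ (-((D + 1 : ℕ) : ℝ)) := by
        refine Finset.sum_le_sum fun b _ => ?_
        have hd : 0 ≤ dist a b := dist_nonneg
        rw [div_one, Real.rpow_neg (by positivity), Real.rpow_natCast]
        have h1 := Real.pow_div_factorial_le_exp (x := δ * (1 + dist a b)) (by positivity) (D + 1)
        rw [mul_pow, div_le_iff₀ (by positivity)] at h1
        rw [← div_eq_mul_inv, le_div_iff₀ (by positivity), hK]
        have h2 : Real.exp (δ * (1 + dist a b)) = Real.exp δ * Real.exp (δ * dist a b) := by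
          rw [← Real.exp_add]; ring_nf
        have h3 : Real.exp (-δ * dist a b) * Real.exp (δ * dist a b) = 1 := by
          rw [← Real.exp_add]; simp
        rw [h2] at h1
        have h4 : (1 + dist a b) ^ (D + 1) ≤
            (D + 1).factorial / δ ^ (D + 1) * Real.exp δ * Real.exp (δ * dist a b) := by
          have : (D + 1).factorial / δ ^ (D + 1) * Real.exp δ * Real.exp (δ * dist a b) =
            (Real.exp δ * Real.exp (δ * dist a b) * (D + 1).factorial) / δ ^ (D + 1) := by ring
          rw [this, le_div_iff₀ (by positivity)]
          linarith
        calc _ ≤ Real.exp (-δ * dist a b) * ((D + 1).factorial / δ ^ (D + 1) * Real.exp δ *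
              Real.exp (δ * dist a b)) := by gcongr
          _ = (D + 1).factorial / δ ^ (D + 1) * Real.exp δ *
              (Real.exp (-δ * dist a b) * Real.exp (δ * dist a b)) := by ring
          _ = _ := by rw [h3, mul_one]
    _ ≤ K * C := by
        rw [← Finset.mul_sum]
        have := h L a 1 le_rfl
        rw [one_pow, mul_one] at this
        gcongr

/-- The comparison function is the power-law profile `φ` of `Y`; the convolution estimate at `χ = ρ
= 1` bounds its growth, as distinct sites have distance at least one. -/
theorem exists_hasLiebRobinson_powerLR (h₀ : ℝ) {α : ℝ} (hα : (D : ℝ) < α) :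
    ∃ v C : ℝ, 0 < v ∧ 0 < C ∧ ∀ (L : Lattice D κ) (M : Model L) (Φ : Interaction M),
      Φ.DecaysLike (fun r => h₀ / r ^ α) → HasLiebRobinson Φ (powerLR α C v) := by
  obtain ⟨C₁, hC₁, h₁⟩ := exists_sum_far_rpow_le D κ hα
  obtain ⟨C₂, hC₂, h₂⟩ := exists_conv_rpow_le D κ hα
  have hα0 : 0 ≤ α := (Nat.cast_nonneg D).trans hα.le
  set w : ℝ := |h₀| * (C₁ + C₂) + 1 with hw
  have hw0 : 0 < w := by positivity
  refine ⟨2 * w, 2, by positivity, two_pos, fun L M Φ hΦ X Y hX hY hXY A hA B hB t => ?_⟩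
  set φ : L.site → ℝ := fun i => ∑ y ∈ Y, (1 + dist i y / 1) ^ (-α) with hφ
  have hφ0 : ∀ i, 0 ≤ φ i := fun i => Finset.sum_nonneg fun y _ => by positivity
  have hfil : ∀ i : L.site, Finset.univ.erase i = Finset.univ.filter (fun j => 1 ≤ dist i j) := by
    intro i
    ext j
    simp only [Finset.mem_erase, Finset.mem_univ, and_true, Finset.mem_filter, true_and]
    refine ⟨fun h => L.one_le_dist i j (Ne.symm h), ?_⟩
    rintro h rfl
    simp only [dist_self] at h
    linarith
  have h := Φ.norm_commutator_heisenberg_le (J := fun i j => |h₀| * dist i j ^ (-α)) ?_ hφ0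
    (Y := Y) ?_ (v := w) ?_ hA hB t
  · refine h.trans ?_
    set r := regionDist X Y with hr
    have hr1 : 1 ≤ r := one_le_regionDist hX hY hXY
    have hS : ∑ i ∈ X, φ i ≤ X.card * (Y.card * (r ^ α)⁻¹) := by
      rw [← nsmul_eq_mul]
      refine Finset.sum_le_card_nsmul _ _ _ fun i hi => ?_
      rw [← nsmul_eq_mul]
      refine Finset.sum_le_card_nsmul _ _ _ fun y hy => ?_
      rw [← Real.rpow_neg (by linarith), div_one]
      refine Real.rpow_le_rpow_of_nonpos (by linarith) ?_ (by linarith)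
      linarith [regionDist_le hi hy]
    calc _ ≤ 2 * ‖A‖ * ‖B‖ * Real.exp (2 * w * |t|) * (X.card * (Y.card * (r ^ α)⁻¹)) := by gcongr
      _ = _ := by rw [powerLR]; ring
  · intro i j hij
    refine (hΦ i j hij).trans ?_
    dsimp only
    rw [Real.rpow_neg dist_nonneg, div_eq_mul_inv]
    have := le_abs_self h₀
    have : 0 ≤ (dist i j ^ α)⁻¹ := by positivity
    gcongr
  · intro y hy
    refine le_trans ?_ (Finset.single_le_sum (f := fun z => (1 + dist y z / 1) ^ (-α))
      (fun z _ => by positivity) hy)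
    simp
  · intro i
    rw [hfil]
    have e : ∑ j ∈ Finset.univ.filter (fun j => 1 ≤ dist i j), |h₀| * dist i j ^ (-α) * (φ i + φ j) =
        |h₀| * ((∑ j ∈ Finset.univ.filter (fun j => 1 ≤ dist i j), dist i j ^ (-α)) * φ i +
          ∑ y ∈ Y, ∑ j ∈ Finset.univ.filter (fun j => 1 ≤ dist i j),
            dist i j ^ (-α) * (1 + dist j y / 1) ^ (-α)) := by
      rw [Finset.sum_comm, Finset.sum_mul, ← Finset.sum_add_distrib, Finset.mul_sum]
      refine Finset.sum_congr rfl fun j _ => ?_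
      rw [← Finset.mul_sum]
      ring
    rw [e]
    have b1 := h₁ L i 1 le_rfl
    rw [Real.one_rpow, mul_one] at b1
    have b2 : ∑ y ∈ Y, ∑ j ∈ Finset.univ.filter (fun j => 1 ≤ dist i j),
        dist i j ^ (-α) * (1 + dist j y / 1) ^ (-α) ≤ C₂ * φ i := by
      rw [hφ, Finset.mul_sum]
      refine Finset.sum_le_sum fun y _ => ?_
      have := h₂ L i y 1 1 le_rfl le_rfl
      rwa [Real.one_rpow, mul_one] at this
    have := hφ0 i
    calc _ ≤ |h₀| * (C₁ * φ i + C₂ * φ i) := by gcongr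
      _ ≤ _ := by rw [hw]; nlinarith

/-- With `φ` decaying at rate `ν`, passing from `i` to `j` costs at most `exp(ν d)`. The coupling
pays for this and leaves the summable `exp(-(μ - ν) d)`; this is why `ν` has to be smaller than `μ`.
The velocity absorbs a factor `1 / ν`, so that `ν v` is the growth rate. -/
theorem exists_hasLiebRobinson_expLR (h₀ : ℝ) {μ ν : ℝ} (hν : 0 < ν) (hνμ : ν < μ) :
    ∃ v C : ℝ, 0 < v ∧ 0 < C ∧ ∀ (L : Lattice D κ) (M : Model L) (Φ : Interaction M),
      Φ.DecaysLike (fun r => h₀ * Real.exp (-μ * r)) → HasLiebRobinson Φ (expLR ν C v) := by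
  obtain ⟨C₁, hC₁, h₁⟩ := exists_sum_exp_le D κ (sub_pos.2 hνμ)
  set w : ℝ := |h₀| * (2 * C₁) + 1 with hw
  have hw0 : 0 < w := by positivity
  refine ⟨2 * w / ν, 2, by positivity, two_pos, fun L M Φ hΦ X Y hX hY hXY A hA B hB t => ?_⟩
  set φ : L.site → ℝ := fun i => ∑ y ∈ Y, Real.exp (-ν * dist i y) with hφ
  have hφ0 : ∀ i, 0 ≤ φ i := fun i => Finset.sum_nonneg fun y _ => by positivity
  have h := Φ.norm_commutator_heisenberg_le (J := fun i j => |h₀| * Real.exp (-μ * dist i j)) ?_ hφ0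
    (Y := Y) ?_ (v := w) ?_ hA hB t
  · refine h.trans ?_
    set r := regionDist X Y with hr
    have hS : ∑ i ∈ X, φ i ≤ X.card * (Y.card * Real.exp (-ν * r)) := by
      rw [← nsmul_eq_mul]
      refine Finset.sum_le_card_nsmul _ _ _ fun i hi => ?_
      rw [← nsmul_eq_mul]
      refine Finset.sum_le_card_nsmul _ _ _ fun y hy => ?_
      have := regionDist_le hi hy
      exact Real.exp_le_exp.2 (by nlinarith)
    calc _ ≤ 2 * ‖A‖ * ‖B‖ * Real.exp (2 * w * |t|) * (X.card * (Y.card * Real.exp (-ν * r))) := by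
          gcongr
      _ = _ := by
        have : Real.exp (-ν * (r - 2 * w / ν * |t|)) = Real.exp (2 * w * |t|) * Real.exp (-ν * r) := by
          rw [← Real.exp_add]; congr 1; field_simp; ring
        rw [expLR, this]; ring
  · intro i j hij
    refine (hΦ i j hij).trans ?_
    have := le_abs_self h₀
    dsimp only
    gcongr
  · intro y hy
    refine le_trans ?_ (Finset.single_le_sum (f := fun z => Real.exp (-ν * dist y z))
      (fun z _ => by positivity) hy)
    simp
  · intro i
    have hpt : ∀ j, |h₀| * Real.exp (-μ * dist i j) * (φ i + φ j) ≤
        |h₀| * (Real.exp (-(μ - ν) * dist i j) * (2 * φ i)) := by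
      intro j
      have hd : 0 ≤ dist i j := dist_nonneg
      have h2 : φ j ≤ Real.exp (ν * dist i j) * φ i := by
        rw [hφ, Finset.mul_sum]
        refine Finset.sum_le_sum fun y _ => ?_
        rw [← Real.exp_add]
        have := dist_triangle i j y
        exact Real.exp_le_exp.2 (by nlinarith)
      have h3 : (1 : ℝ) ≤ Real.exp (ν * dist i j) := Real.one_le_exp (by positivity)
      have h4 : Real.exp (-(μ - ν) * dist i j) = Real.exp (-μ * dist i j) * Real.exp (ν * dist i j) := by
        rw [← Real.exp_add]; congr 1; ring
      have := hφ0 i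
      rw [h4, mul_assoc, mul_assoc]
      gcongr
      nlinarith
    calc _ ≤ ∑ j ∈ Finset.univ.erase i, |h₀| * (Real.exp (-(μ - ν) * dist i j) * (2 * φ i)) :=
          Finset.sum_le_sum fun j _ => hpt j
      _ ≤ ∑ j, |h₀| * (Real.exp (-(μ - ν) * dist i j) * (2 * φ i)) := by
          have := hφ0 i
          exact Finset.sum_le_sum_of_subset_of_nonneg (Finset.subset_univ _)
            fun j _ _ => by positivity
      _ = |h₀| * ((∑ j, Real.exp (-(μ - ν) * dist i j)) * (2 * φ i)) := by
          rw [← Finset.mul_sum, ← Finset.sum_mul]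
      _ ≤ |h₀| * (C₁ * (2 * φ i)) := by
          have := h₁ L i
          have := hφ0 i
          gcongr
      _ ≤ _ := by have := hφ0 i; rw [hw]; nlinarith

end

/-! ### Evolution under the terms of range at most χ -/

section

/-- Duhamel's formula as a bound on the difference of two evolutions. -/
theorem norm_heisenberg_sub_le {ι : Type} [Fintype ι] [DecidableEq ι] {H H' : Matrix ι ι ℂ}
    (hH' : H'.IsHermitian) (A : Matrix ι ι ℂ) {b b' : ℝ → ℝ} {t : ℝ} (ht : 0 ≤ t)
    (hb : ∀ s, HasDerivAt b (b' s) s)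
    (h : ∀ s ∈ Set.Icc 0 t,
      ‖(H' - H) * heisenberg H A s - heisenberg H A s * (H' - H)‖ ≤ b' s) :
    ‖heisenberg H' A t - heisenberg H A t‖ ≤ b t - b 0 := by
  -- With `O` fixed, `intPic H' H O s` interpolates from `heisenberg H A t` at `s = 0` to
  -- `heisenberg H' A t` at `s = t`. The speed at `s` involves `A` at time `t - s`, whence the
  -- comparison function `b t - b (t - s)`.
  set O := heisenberg H A t with hO
  have h1 : ∀ s, HasDerivAt (fun s => intPic H' H O s - O)
      (heisenberg H' (Complex.I • ((H' - H) * heisenberg H A (t - s) -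
        heisenberg H A (t - s) * (H' - H))) s) s := by
    intro s
    refine ((hasDerivAt_intPic H' H O s).sub_const O).congr_deriv ?_
    have e : intPic H' H O s = heisenberg H' (heisenberg H A (t - s)) s := by
      rw [intPic, hO, heisenberg_heisenberg, neg_add_eq_sub]
    rw [e, heisenberg_smul, ← heisenberg_mul, ← heisenberg_mul, ← heisenberg_sub]
  have h2 : ∀ s, HasDerivAt (fun s => b t - b (t - s)) (b' (t - s)) s := by
    intro s
    have h3 : HasDerivAt (fun s => t - s) (-1) s := by
      simpa using (hasDerivAt_id s).const_sub t
    have := ((hb (t - s)).comp s h3).const_sub (b t)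
    simpa [Function.comp_def] using this
  have key := image_norm_le_of_norm_deriv_right_le_deriv_boundary' (a := 0) (b := t)
    (f := fun s => intPic H' H O s - O) (B := fun s => b t - b (t - s))
    (fun s _ => (h1 s).continuousAt.continuousWithinAt) (fun s _ => (h1 s).hasDerivWithinAt)
    (by simp [intPic, heisenberg_zero]) (fun s _ => (h2 s).continuousAt.continuousWithinAt)
    (fun s _ => (h2 s).hasDerivWithinAt) (fun s hs => by
      rw [norm_heisenberg hH', norm_smul, Complex.norm_I, one_mul]
      exact h (t - s) ⟨by linarith [hs.2], by linarith [hs.1]⟩) (⟨ht, le_rfl⟩ : t ∈ Set.Icc 0 t)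
  have e : intPic H' H O t = heisenberg H' A t := by
    rw [hO, intPic_heisenberg]
  simpa [e] using key

/-- All distances within `X` are at most `χ`. -/
def IsShort (χ : ℝ) (X : Finset L.site) : Prop := ∀ i ∈ X, ∀ j ∈ X, dist i j ≤ χ

open Classical in
/-- The sites within distance `ℓ` of `X`. -/
def nbhd (X : Finset L.site) (ℓ : ℝ) : Finset L.site :=
  Finset.univ.filter fun x => ∃ i ∈ X, dist i x ≤ ℓ

lemma mem_nbhd {X : Finset L.site} {ℓ : ℝ} {x : L.site} :
    x ∈ nbhd X ℓ ↔ ∃ i ∈ X, dist i x ≤ ℓ := by simp [nbhd]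

lemma subset_nbhd (X : Finset L.site) {ℓ : ℝ} (hℓ : 0 ≤ ℓ) : X ⊆ nbhd X ℓ :=
  fun x hx => mem_nbhd.2 ⟨x, hx, by simpa using hℓ⟩

lemma nbhd_mono (X : Finset L.site) {ℓ ℓ' : ℝ} (h : ℓ ≤ ℓ') : nbhd X ℓ ⊆ nbhd X ℓ' := by
  intro x hx
  obtain ⟨i, hi, hd⟩ := mem_nbhd.1 hx
  exact mem_nbhd.2 ⟨i, hi, hd.trans h⟩

lemma card_nbhd_le (X : Finset L.site) {ℓ : ℝ} (hℓ : 0 ≤ ℓ) :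
    ((nbhd X ℓ).card : ℝ) ≤ X.card * (κ * (1 + ℓ) ^ D) := by
  classical
  have h1 : nbhd X ℓ ⊆ X.biUnion fun i => Finset.univ.filter fun x => dist i x ≤ ℓ := by
    intro x hx
    obtain ⟨i, hi, hd⟩ := mem_nbhd.1 hx
    exact Finset.mem_biUnion.2 ⟨i, hi, by simpa using hd⟩
  have h2 : ((nbhd X ℓ).card : ℝ) ≤ ∑ i ∈ X, ((Finset.univ.filter fun x => dist i x ≤ ℓ).card : ℝ) := by
    exact_mod_cast (Finset.card_le_card h1).trans Finset.card_biUnion_le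
  refine h2.trans ?_
  rw [← nsmul_eq_mul]
  exact Finset.sum_le_card_nsmul _ _ _ fun i _ => card_filter_dist_le i hℓ

namespace Interaction

variable {M : Model L}

/-- The terms of range at most `χ` inside `N`. -/
def shortOn (Φ : Interaction M) (χ : ℝ) (N : Finset L.site) : Interaction M :=
  Φ.restrict fun X => IsShort χ X ∧ X ⊆ N

section Short

variable {Φ : Interaction M} {h₀ α χ C₁ : ℝ}

/-- A coupling of range at most `χ` changes `exp(1 - d(i, w)/χ)` by at most a factor `e`, so the
rate is independent of `χ`. The shift by 1 in the exponent makes this function at least 1 on the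
short region `W`. -/
theorem short_lieb_robinson (hχ : 0 < χ) (hΦ : Φ.DecaysLike fun r => h₀ / r ^ α)
    (hC₁ : ∀ i : L.site, ∑ j ∈ Finset.univ.erase i, dist i j ^ (-α) ≤ C₁)
    (N : Finset L.site) {X W : Finset L.site} {A B : M.Op} (hA : A ∈ M.localAlg X)
    (hB : B ∈ M.localAlg W) (hW : IsShort χ W) {w : L.site} (hw : w ∈ W) (s : ℝ) :
    ‖heisenberg (Φ.shortOn χ N).hamiltonian A s * B -
      B * heisenberg (Φ.shortOn χ N).hamiltonian A s‖ ≤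
    2 * ‖A‖ * ‖B‖ * Real.exp (2 * ((1 + Real.exp 1) * |h₀| * C₁) * |s|) *
      ∑ i ∈ X, Real.exp (1 - dist i w / χ) := by
  refine norm_commutator_heisenberg_le _ (J := fun i j => if dist i j ≤ χ then
    |h₀| * dist i j ^ (-α) else 0) (φ := fun i => Real.exp (1 - dist i w / χ)) ?_
    (fun i => (Real.exp_pos _).le) ?_ ?_ hA hB s
  · intro i j hij
    split_ifs with hd
    · refine le_trans (Finset.sum_le_sum fun X _ => Φ.norm_restrict_term_le _ X) ?_
      refine (hΦ i j hij).trans ?_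
      dsimp only
      rw [Real.rpow_neg dist_nonneg, div_eq_mul_inv]
      have := le_abs_self h₀
      have : 0 ≤ (dist i j ^ α)⁻¹ := by positivity
      gcongr
    · refine le_of_eq (Finset.sum_eq_zero fun X hX => ?_)
      have hX := (Finset.mem_filter.1 hX).2
      have : ¬ (IsShort χ X ∧ X ⊆ N) := fun h => hd (h.1 i hX.1 j hX.2)
      simp [shortOn, restrict, this]
  · intro y hy
    refine Real.one_le_exp ?_
    have := (div_le_one hχ).2 (hW y hy w hw)
    linarith
  · intro i
    have hpt : ∀ j, (if dist i j ≤ χ then |h₀| * dist i j ^ (-α) else 0) *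
        (Real.exp (1 - dist i w / χ) + Real.exp (1 - dist j w / χ)) ≤
        (1 + Real.exp 1) * |h₀| * Real.exp (1 - dist i w / χ) * dist i j ^ (-α) := by
      intro j
      have hd0 : 0 ≤ dist i j ^ (-α) := Real.rpow_nonneg dist_nonneg _
      split_ifs with hd
      · have h1 : Real.exp (1 - dist j w / χ) ≤ Real.exp 1 * Real.exp (1 - dist i w / χ) := by
          rw [← Real.exp_add]
          refine Real.exp_le_exp.2 ?_
          have h2 : dist i w / χ ≤ 1 + dist j w / χ := by
            have h3 := (div_le_one hχ).2 hd
            have h4 : dist i w / χ ≤ (dist i j + dist j w) / χ := by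
              gcongr; exact dist_triangle i j w
            rw [add_div] at h4
            linarith
          linarith
        calc _ ≤ |h₀| * dist i j ^ (-α) * (Real.exp (1 - dist i w / χ) +
              Real.exp 1 * Real.exp (1 - dist i w / χ)) := by gcongr
          _ = _ := by ring
      · rw [zero_mul]; positivity
    refine (Finset.sum_le_sum fun j _ => hpt j).trans ?_
    rw [← Finset.mul_sum]
    calc _ ≤ (1 + Real.exp 1) * |h₀| * Real.exp (1 - dist i w / χ) * C₁ := by
          gcongr; exact hC₁ i
      _ = _ := by ring

lemma sum_norm_crossing_le (hΦ : Φ.DecaysLike fun r => h₀ / r ^ α)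
    (hC₁ : ∀ i : L.site, ∑ j ∈ Finset.univ.erase i, dist i j ^ (-α) ≤ C₁) (N : Finset L.site) :
    ∑ W ∈ Finset.univ.filter (fun W : Finset L.site => ¬ W ⊆ N ∧ ¬ Disjoint W N), ‖Φ.term W‖ ≤
      N.card * (|h₀| * C₁) := by
  have h1 : ∀ i, ∑ W ∈ Finset.univ.filter (fun W : Finset L.site => i ∈ W),
      (if 2 ≤ W.card then ‖Φ.term W‖ else 0) ≤ |h₀| * C₁ := by
    intro i
    -- The indicator of `i` as test function turns the weighted estimate into a bound on the total
    -- strength of the terms at `i`.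
    have h := Φ.sum_touching_le (J := fun i j => |h₀| * dist i j ^ (-α)) (fun i j hij => by
      refine (hΦ i j hij).trans ?_
      dsimp only
      rw [Real.rpow_neg dist_nonneg, div_eq_mul_inv]
      have := le_abs_self h₀
      have : 0 ≤ (dist i j ^ α)⁻¹ := by positivity
      gcongr) (φ := fun j => if j = i then 1 else 0) (fun j => by split_ifs <;> simp) i
    have e1 : ∀ W ∈ Finset.univ.filter (fun W : Finset L.site => i ∈ W),
        (if 2 ≤ W.card then ‖Φ.term W‖ else 0) * (∑ j ∈ W, if j = i then (1 : ℝ) else 0) =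
        if 2 ≤ W.card then ‖Φ.term W‖ else 0 := by
      intro W hW
      rw [Finset.sum_ite_eq' W i, if_pos (Finset.mem_filter.1 hW).2, mul_one]
    rw [Finset.sum_congr rfl e1] at h
    refine h.trans ?_
    calc _ = |h₀| * ∑ j ∈ Finset.univ.erase i, dist i j ^ (-α) := by
          rw [Finset.mul_sum]
          refine Finset.sum_congr rfl fun j hj => ?_
          simp [Finset.ne_of_mem_erase hj]
      _ ≤ _ := by gcongr; exact hC₁ i
  calc _ ≤ ∑ W ∈ Finset.univ.filter (fun W : Finset L.site => ¬ Disjoint W N),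
        (if 2 ≤ W.card then ‖Φ.term W‖ else 0) := by
        calc _ ≤ ∑ W ∈ Finset.univ.filter (fun W : Finset L.site => ¬ W ⊆ N ∧ ¬ Disjoint W N),
              (if 2 ≤ W.card then ‖Φ.term W‖ else 0) := by
              refine Finset.sum_le_sum fun W hW => ?_
              obtain ⟨hW1, hW2⟩ := (Finset.mem_filter.1 hW).2
              obtain ⟨x, hx, hxN⟩ := Finset.not_subset.1 hW1
              obtain ⟨y, hy, hyN⟩ := Finset.not_disjoint_iff.1 hW2
              have : 2 ≤ W.card := Finset.one_lt_card.2 ⟨x, hx, y, hy, fun h => hxN (h ▸ hyN)⟩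
              rw [if_pos this]
          _ ≤ _ := Finset.sum_le_sum_of_subset_of_nonneg
              (fun W hW => by simp only [Finset.mem_filter] at hW ⊢; exact ⟨hW.1, hW.2.2⟩)
              fun W _ _ => by split_ifs <;> simp
    _ ≤ ∑ i ∈ N, ∑ W ∈ Finset.univ.filter (fun W : Finset L.site => i ∈ W),
        (if 2 ≤ W.card then ‖Φ.term W‖ else 0) :=
        sum_not_disjoint_le N (fun W : Finset L.site => W) fun W => by split_ifs <;> simp
    _ ≤ ∑ i ∈ N, |h₀| * C₁ := Finset.sum_le_sum fun i _ => h1 i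
    _ = _ := by rw [Finset.sum_const, nsmul_eq_mul]

/-- In Duhamel's formula only short terms that cross the boundary of `nbhd X ℓ` survive: terms
inside occur in both Hamiltonians, and terms outside commute with the evolved observable, which
stays in `nbhd X ℓ`. A crossing term has a site at distance more than `ℓ` from `X`, so
`short_lieb_robinson` gives `exp(1 - ℓ/χ)`; the last factor bounds the total strength of crossing
terms by the volume. -/
theorem norm_heisenberg_shortOn_sub_le (hχ : 0 < χ) (hΦ : Φ.DecaysLike fun r => h₀ / r ^ α)
    (hC₁ : ∀ i : L.site, ∑ j ∈ Finset.univ.erase i, dist i j ^ (-α) ≤ C₁) (hC₁0 : 0 ≤ C₁)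
    {X N' : Finset L.site} {ℓ : ℝ} (hℓ : 0 ≤ ℓ) (hN : nbhd X ℓ ⊆ N') {A : M.Op}
    (hA : A ∈ M.localAlg X) {P : ℝ} (hP : X.card ≤ P) {t s : ℝ} (hs : 0 ≤ s) (hst : s ≤ t) :
    ‖heisenberg (Φ.shortOn χ N').hamiltonian A s -
      heisenberg (Φ.shortOn χ (nbhd X ℓ)).hamiltonian A s‖ ≤
    t * (2 * ‖A‖ * Real.exp (2 * ((1 + Real.exp 1) * |h₀| * C₁) * t) *
      (P * Real.exp (1 - ℓ / χ)) * (P * (|κ| * (1 + ℓ) ^ D) * (|h₀| * C₁))) := by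
  set N := nbhd X ℓ with hNdef
  set v := 2 * ((1 + Real.exp 1) * |h₀| * C₁) with hv
  have hv0 : 0 ≤ v := by positivity
  have hP0 : 0 ≤ P := (Nat.cast_nonneg _).trans hP
  set c := 2 * ‖A‖ * Real.exp (v * t) *
      (P * Real.exp (1 - ℓ / χ)) * (P * (|κ| * (1 + ℓ) ^ D) * (|h₀| * C₁)) with hc
  have hc0 : 0 ≤ c := by positivity
  have key := norm_heisenberg_sub_le (H := (Φ.shortOn χ N).hamiltonian)
    (Φ.shortOn χ N').hamiltonian_isHermitian A (b := fun x => x * c) (b' := fun _ => c) hs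
    (fun x => by simpa using (hasDerivAt_id x).mul_const c) ?_
  · refine key.trans ?_
    simp only [zero_mul, sub_zero]
    gcongr
  intro x hx
  have hloc : heisenberg (Φ.shortOn χ N).hamiltonian A x ∈ M.localAlg N := by
    refine M.heisenberg_mem_localAlg (hamiltonian_mem_localAlg _ fun W hW => ?_)
      (M.localAlg_mono (subset_nbhd X hℓ) hA) x
    by_contra hcon
    have hcon : ¬ W ⊆ N := hcon
    exact hW (by simp [shortOn, restrict, hcon])
  set Ax := heisenberg (Φ.shortOn χ N).hamiltonian A x with hAx
  have e : (Φ.shortOn χ N').hamiltonian - (Φ.shortOn χ N).hamiltonian =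
      ∑ W, ((Φ.shortOn χ N').term W - (Φ.shortOn χ N).term W) := by
    simp [hamiltonian]
  have hW : ∀ W, ‖((Φ.shortOn χ N').term W - (Φ.shortOn χ N).term W) * Ax -
      Ax * ((Φ.shortOn χ N').term W - (Φ.shortOn χ N).term W)‖ ≤
      if ¬ W ⊆ N ∧ ¬ Disjoint W N then ‖Φ.term W‖ * (2 * ‖A‖ * Real.exp (v * t) *
        (P * Real.exp (1 - ℓ / χ))) else 0 := by
    intro W
    by_cases hWs : IsShort χ W
    swap
    · simp only [shortOn, restrict, hWs, false_and, if_false, sub_zero, zero_mul, mul_zero, norm_zero]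
      split_ifs <;> positivity
    by_cases hWN : W ⊆ N
    · have := hWN.trans hN
      simp only [shortOn, restrict, hWs, hWN, this, and_self, if_true, sub_self, zero_mul, mul_zero,
        norm_zero]
      split_ifs <;> positivity
    by_cases hWN' : W ⊆ N'
    swap
    · simp only [shortOn, restrict, hWs, hWN, hWN', and_false, if_false, sub_zero, zero_mul, mul_zero,
        norm_zero]
      split_ifs <;> positivity
    have e2 : (Φ.shortOn χ N').term W - (Φ.shortOn χ N).term W = Φ.term W := by
      simp [shortOn, restrict, hWs, hWN, hWN']
    rw [e2]
    by_cases hd : Disjoint W N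
    · rw [M.localAlg_commute hd (Φ.term_mem W) hloc, sub_self, norm_zero]
      split_ifs <;> positivity
    rw [if_pos ⟨hWN, hd⟩]
    obtain ⟨w, hwW, hwN⟩ := Finset.not_subset.1 hWN
    have h1 := short_lieb_robinson hχ hΦ hC₁ N hA (Φ.term_mem W) hWs hwW x
    rw [← norm_neg, neg_sub]
    refine h1.trans ?_
    have h2 : ∑ i ∈ X, Real.exp (1 - dist i w / χ) ≤ P * Real.exp (1 - ℓ / χ) := by
      calc _ ≤ ∑ i ∈ X, Real.exp (1 - ℓ / χ) := by
            refine Finset.sum_le_sum fun i hi => Real.exp_le_exp.2 ?_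
            have h3 : ℓ < dist i w := by
              by_contra hcon
              exact hwN (mem_nbhd.2 ⟨i, hi, not_lt.1 hcon⟩)
            have : ℓ / χ ≤ dist i w / χ := by gcongr
            linarith
        _ = X.card * Real.exp (1 - ℓ / χ) := by rw [Finset.sum_const, nsmul_eq_mul]
        _ ≤ _ := by gcongr
    have h4 : Real.exp (v * |x|) ≤ Real.exp (v * t) := by
      rw [abs_of_nonneg hx.1]
      exact Real.exp_le_exp.2 (mul_le_mul_of_nonneg_left (hx.2.trans hst) hv0)
    calc _ ≤ 2 * ‖A‖ * ‖Φ.term W‖ * Real.exp (v * t) * (P * Real.exp (1 - ℓ / χ)) := by gcongr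
      _ = _ := by ring
  rw [e, Finset.sum_mul, Finset.mul_sum, ← Finset.sum_sub_distrib]
  refine (norm_sum_le _ _).trans ((Finset.sum_le_sum fun W _ => hW W).trans ?_)
  rw [← Finset.sum_filter, ← Finset.sum_mul]
  have h5 := sum_norm_crossing_le hΦ hC₁ N
  have h6 : (N.card : ℝ) ≤ P * (|κ| * (1 + ℓ) ^ D) := by
    refine (card_nbhd_le X hℓ).trans ?_
    calc _ ≤ X.card * (|κ| * (1 + ℓ) ^ D) := by gcongr; exact le_abs_self κ
      _ ≤ _ := by gcongr
  calc _ ≤ (P * (|κ| * (1 + ℓ) ^ D) * (|h₀| * C₁)) * (2 * ‖A‖ * Real.exp (v * t) *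
        (P * Real.exp (1 - ℓ / χ))) := by
        gcongr
        exact h5.trans (by gcongr)
    _ = _ := by rw [hc]; ring

end Short

/-- The part of the short-range evolution of `A` that is due to the `m`-th shell around `X`. -/
def layer (Φ : Interaction M) (χ ρ : ℝ) (X : Finset L.site) (A : M.Op) (s : ℝ) : ℕ → M.Op
  | 0 => heisenberg (Φ.shortOn χ (nbhd X ρ)).hamiltonian A s
  | m + 1 => heisenberg (Φ.shortOn χ (nbhd X ((m + 2 : ℝ) * ρ))).hamiltonian A s -
      heisenberg (Φ.shortOn χ (nbhd X ((m + 1 : ℝ) * ρ))).hamiltonian A s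

section Layers

variable (Φ : Interaction M) (χ ρ : ℝ) (X : Finset L.site) (A : M.Op) (s : ℝ)

lemma sum_layer (n : ℕ) : ∑ m ∈ Finset.range (n + 1), Φ.layer χ ρ X A s m =
    heisenberg (Φ.shortOn χ (nbhd X ((n + 1 : ℝ) * ρ))).hamiltonian A s := by
  induction n with
  | zero => simp [layer]
  | succ n ih =>
    rw [Finset.sum_range_succ, ih, layer]
    push_cast
    rw [show (n : ℝ) + 1 + 1 = n + 2 by ring]
    abel

variable {A ρ}

lemma heisenberg_shortOn_mem (hA : A ∈ M.localAlg X) {ℓ ℓ' : ℝ} (hℓ : 0 ≤ ℓ) (h : ℓ ≤ ℓ') :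
    heisenberg (Φ.shortOn χ (nbhd X ℓ)).hamiltonian A s ∈ M.localAlg (nbhd X ℓ') := by
  refine M.localAlg_mono (nbhd_mono X h) ?_
  refine M.heisenberg_mem_localAlg (hamiltonian_mem_localAlg _ fun W hW => ?_)
    (M.localAlg_mono (subset_nbhd X hℓ) hA) s
  by_contra hcon
  exact hW (by simp [shortOn, restrict, hcon])

lemma layer_mem (hρ : 0 ≤ ρ) (hA : A ∈ M.localAlg X) (m : ℕ) :
    Φ.layer χ ρ X A s m ∈ M.localAlg (nbhd X ((m + 1 : ℝ) * ρ)) := by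
  cases m with
  | zero => exact Φ.heisenberg_shortOn_mem χ X s hA hρ (by simp)
  | succ m =>
    refine (M.localAlg _).sub_mem (Φ.heisenberg_shortOn_mem χ X s hA (by positivity) ?_)
      (Φ.heisenberg_shortOn_mem χ X s hA (by positivity) ?_)
    · push_cast; nlinarith
    · push_cast; nlinarith

lemma layer_isHermitian (hA : A.IsHermitian) (m : ℕ) : (Φ.layer χ ρ X A s m).IsHermitian := by
  cases m with
  | zero => exact heisenberg_isHermitian (hamiltonian_isHermitian _) hA s
  | succ m =>
    exact (heisenberg_isHermitian (hamiltonian_isHermitian _) hA s).sub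
      (heisenberg_isHermitian (hamiltonian_isHermitian _) hA s)

end Layers

end Interaction

end

/-! ### Long-range terms dressed by the short-range evolution -/

section

/-- The profile `∑ y ∈ Y, (1 + d(i, y) / ρ) ^ (-α)`. -/
def profile (α ρ : ℝ) (Y : Finset L.site) (i : L.site) : ℝ := ∑ y ∈ Y, (1 + dist i y / ρ) ^ (-α)

section Profile

variable {α ρ : ℝ} {Y : Finset L.site}

lemma profile_nonneg (hρ : 0 < ρ) (i : L.site) : 0 ≤ profile α ρ Y i :=
  Finset.sum_nonneg fun y _ => by positivity

/-- Moving by `q ρ` adds at most `q` to `1 + d/ρ`, and `1 + x + q ≤ exp q * (1 + x)` for `x ≥ 0`. -/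
lemma one_add_rpow_neg_le (hα : 0 ≤ α) (hρ : 0 < ρ) {q : ℝ} {e x : L.site}
    (h : dist e x ≤ q * ρ) (y : L.site) :
    (1 + dist x y / ρ) ^ (-α) ≤ Real.exp (α * q) * (1 + dist e y / ρ) ^ (-α) := by
  have h1 : 1 + dist e y / ρ ≤ Real.exp q * (1 + dist x y / ρ) := by
    have h2 : dist e y / ρ ≤ q + dist x y / ρ := by
      rw [div_le_iff₀ hρ, add_mul, div_mul_cancel₀ _ hρ.ne']
      linarith [dist_triangle e x y]
    have hq : 0 ≤ q := by
      by_contra hc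
      have : q * ρ < 0 := mul_neg_of_neg_of_pos (not_le.1 hc) hρ
      linarith [dist_nonneg (x := e) (y := x)]
    have h3 := Real.add_one_le_exp q
    have h4 : 0 ≤ dist x y / ρ := by positivity
    nlinarith
  have h5 := Real.rpow_le_rpow (by positivity) h1 hα
  rw [Real.mul_rpow (Real.exp_pos q).le (by positivity), ← Real.exp_mul] at h5
  rw [Real.rpow_neg (by positivity), Real.rpow_neg (by positivity), ← div_eq_mul_inv,
    le_div_iff₀ (by positivity), inv_mul_le_iff₀ (by positivity)]
  rw [mul_comm q α] at h5
  linarith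

lemma profile_le (hα : 0 ≤ α) (hρ : 0 < ρ) {q : ℝ} {e x : L.site} (h : dist e x ≤ q * ρ) :
    profile α ρ Y x ≤ Real.exp (α * q) * profile α ρ Y e := by
  rw [profile, profile, Finset.mul_sum]
  exact Finset.sum_le_sum fun y _ => one_add_rpow_neg_le hα hρ h y

end Profile

lemma sum_exp_neg_le_two (n : ℕ) : ∑ m : Fin n, Real.exp (-(m : ℝ)) ≤ 2 := by
  have h : ∀ m : ℕ, Real.exp (-(m : ℝ)) ≤ (1 / 2) ^ m := by
    intro m
    have h2 : (2 : ℝ) ^ m ≤ Real.exp m := by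
      rw [← Real.exp_one_pow]
      have := Real.add_one_le_exp (1 : ℝ)
      gcongr
      linarith
    rw [Real.exp_neg, one_div, inv_pow]
    gcongr
  calc _ ≤ ∑ m : Fin n, ((1 : ℝ) / 2) ^ (m : ℕ) := Finset.sum_le_sum fun m _ => h m
    _ = ∑ m ∈ Finset.range n, ((1 : ℝ) / 2) ^ m := Fin.sum_univ_eq_sum_range (fun m => (1 / 2 : ℝ) ^ m) n
    _ ≤ ∑' m : ℕ, ((1 : ℝ) / 2) ^ m := summable_geometric_two.sum_le_tsum _ fun _ _ => by positivity
    _ = 2 := tsum_geometric_two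

namespace Interaction

variable {M : Model L} (Φ : Interaction M) (χ : ℝ)

/-- The regions of the nonzero terms whose range exceeds `χ`. -/
abbrev LongRegion : Type := {X : Finset L.site // Φ.term X ≠ 0 ∧ ¬ IsShort χ X}

open Classical in
instance : Fintype (Φ.LongRegion χ) := inferInstanceAs (Fintype (Subtype _))

section LongRange

variable {Φ χ} {h₀ α C ρ : ℝ} {Y : Finset L.site} {ca cb : Φ.LongRegion χ → L.site}

-- Each long term is counted through the pair of its centers, which are at least `χ` apart. Summing
-- over the far partner gives `χ ^ (D - α)` and reproduces the profile. The near center ranges over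
-- a ball of `O((ρ exp q) ^ D)` sites, and moving the profile to `e` costs `exp(α q)`. Only one
-- center is confined to the ball, so a single volume factor `ρ ^ D` appears.
open Classical in
lemma sum_longRegion_le (hα : 0 ≤ α) (hχ : 1 ≤ χ) (hρ : 1 ≤ ρ) (hC : 0 ≤ C)
    (hΦ : Φ.DecaysLike fun r => h₀ / r ^ α)
    (h₁ : ∀ a : L.site, ∑ b ∈ Finset.univ.filter (fun b => χ ≤ dist a b), dist a b ^ (-α) ≤
      C * χ ^ ((D : ℝ) - α))
    (h₂ : ∀ a y : L.site, ∑ b ∈ Finset.univ.filter (fun b => χ ≤ dist a b),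
        dist a b ^ (-α) * (1 + dist b y / ρ) ^ (-α) ≤
      C * χ ^ ((D : ℝ) - α) * (1 + dist a y / ρ) ^ (-α))
    (hca : ∀ X, ca X ∈ X.1) (hcb : ∀ X, cb X ∈ X.1) (hd : ∀ X, χ ≤ dist (ca X) (cb X))
    (e : L.site) {q : ℝ} (hq : 0 ≤ q) :
    ∑ X : Φ.LongRegion χ, (if dist e (ca X) ≤ q * ρ ∨ dist e (cb X) ≤ q * ρ then
      ‖Φ.term X.1‖ * (profile α ρ Y (ca X) + profile α ρ Y (cb X)) else 0) ≤
    2 * C * |h₀| * |κ| * χ ^ ((D : ℝ) - α) * ρ ^ D * Real.exp ((α + D) * q) * profile α ρ Y e := by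
  have hρ0 : 0 < ρ := by linarith
  have hχ0 : 0 < χ := by linarith
  set F := profile (L := L) α ρ Y with hF
  have hF0 : ∀ x, 0 ≤ F x := profile_nonneg hρ0
  set Ball := Finset.univ.filter fun x : L.site => dist e x ≤ q * ρ with hBall
  set far : L.site → Finset L.site := fun x => Finset.univ.filter fun y => χ ≤ dist x y with hfar
  have hpt : ∀ X : Φ.LongRegion χ, (if dist e (ca X) ≤ q * ρ ∨ dist e (cb X) ≤ q * ρ then
      ‖Φ.term X.1‖ * (F (ca X) + F (cb X)) else 0) ≤
      ∑ x ∈ Ball, ∑ y ∈ far x, if x ∈ X.1 ∧ y ∈ X.1 then ‖Φ.term X.1‖ * (F x + F y) else 0 := by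
    intro X
    have hn : ∀ x y, 0 ≤ if x ∈ X.1 ∧ y ∈ X.1 then ‖Φ.term X.1‖ * (F x + F y) else 0 := by
      intro x y
      split_ifs
      · exact mul_nonneg (norm_nonneg _) (add_nonneg (hF0 x) (hF0 y))
      · exact le_rfl
    have hxy : ∀ x y, x ∈ X.1 → y ∈ X.1 → χ ≤ dist x y → dist e x ≤ q * ρ →
        ‖Φ.term X.1‖ * (F x + F y) ≤
        ∑ x ∈ Ball, ∑ y ∈ far x, if x ∈ X.1 ∧ y ∈ X.1 then ‖Φ.term X.1‖ * (F x + F y) else 0 := by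
      intro x y hx hy hxy hxe
      refine le_trans ?_ (Finset.single_le_sum (f := fun x => ∑ y ∈ far x,
        if x ∈ X.1 ∧ y ∈ X.1 then ‖Φ.term X.1‖ * (F x + F y) else 0)
        (fun x _ => Finset.sum_nonneg fun y _ => hn x y) (by simpa [hBall] using hxe : x ∈ Ball))
      refine le_trans ?_ (Finset.single_le_sum (f := fun y =>
        if x ∈ X.1 ∧ y ∈ X.1 then ‖Φ.term X.1‖ * (F x + F y) else 0)
        (fun y _ => hn x y) (by simpa [hfar] using hxy : y ∈ far x))
      rw [if_pos ⟨hx, hy⟩]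
    split_ifs with h
    · rcases h with h | h
      · exact hxy _ _ (hca X) (hcb X) (hd X) h
      · rw [add_comm (F (ca X))]
        exact hxy _ _ (hcb X) (hca X) (by rw [dist_comm]; exact hd X) h
    · exact Finset.sum_nonneg fun x _ => Finset.sum_nonneg fun y _ => hn x y
  have hJ : ∀ x, ∀ y ∈ far x, ∑ X : Φ.LongRegion χ, (if x ∈ X.1 ∧ y ∈ X.1 then
      ‖Φ.term X.1‖ * (F x + F y) else 0) ≤ |h₀| * dist x y ^ (-α) * (F x + F y) := by
    intro x y hy
    have hy : χ ≤ dist x y := by simpa [hfar] using hy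
    have hne : x ≠ y := by
      rintro rfl
      rw [dist_self] at hy
      linarith
    have h3 : ∑ X : Φ.LongRegion χ, (if x ∈ X.1 ∧ y ∈ X.1 then ‖Φ.term X.1‖ * (F x + F y) else 0) ≤
        ∑ X : Finset L.site, if x ∈ X ∧ y ∈ X then ‖Φ.term X‖ * (F x + F y) else 0 := by
      rw [← Finset.sum_subtype (Finset.univ.filter fun X => Φ.term X ≠ 0 ∧ ¬ IsShort χ X)
        (fun X => by simp) (fun X : Finset L.site =>
          if x ∈ X ∧ y ∈ X then ‖Φ.term X‖ * (F x + F y) else 0)]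
      refine Finset.sum_le_sum_of_subset_of_nonneg (Finset.subset_univ _) fun X _ _ => ?_
      split_ifs
      · exact mul_nonneg (norm_nonneg _) (add_nonneg (hF0 x) (hF0 y))
      · exact le_rfl
    refine h3.trans ?_
    rw [← Finset.sum_filter, ← Finset.sum_mul]
    refine mul_le_mul_of_nonneg_right ((hΦ x y hne).trans ?_) (add_nonneg (hF0 x) (hF0 y))
    dsimp only
    rw [Real.rpow_neg dist_nonneg, div_eq_mul_inv]
    have := le_abs_self h₀
    have : 0 ≤ (dist x y ^ α)⁻¹ := by positivity
    gcongr
  have hfarsum : ∀ x, ∑ y ∈ far x, |h₀| * dist x y ^ (-α) * (F x + F y) ≤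
      |h₀| * (2 * C * χ ^ ((D : ℝ) - α) * F x) := by
    intro x
    have e1 : ∑ y ∈ far x, |h₀| * dist x y ^ (-α) * (F x + F y) =
        |h₀| * ((∑ y ∈ far x, dist x y ^ (-α)) * F x +
          ∑ z ∈ Y, ∑ y ∈ far x, dist x y ^ (-α) * (1 + dist y z / ρ) ^ (-α)) := by
      rw [Finset.sum_comm, Finset.sum_mul, ← Finset.sum_add_distrib, Finset.mul_sum]
      refine Finset.sum_congr rfl fun y _ => ?_
      rw [← Finset.mul_sum, hF, profile, profile]
      ring
    have e2 : ∑ z ∈ Y, ∑ y ∈ far x, dist x y ^ (-α) * (1 + dist y z / ρ) ^ (-α) ≤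
        C * χ ^ ((D : ℝ) - α) * F x := by
      rw [hF, profile, Finset.mul_sum]
      exact Finset.sum_le_sum fun z _ => h₂ x z
    rw [e1]
    have := hF0 x
    calc _ ≤ |h₀| * (C * χ ^ ((D : ℝ) - α) * F x + C * χ ^ ((D : ℝ) - α) * F x) := by
          gcongr
          exact h₁ x
      _ = _ := by ring
  calc _ ≤ ∑ X : Φ.LongRegion χ, ∑ x ∈ Ball, ∑ y ∈ far x,
        (if x ∈ X.1 ∧ y ∈ X.1 then ‖Φ.term X.1‖ * (F x + F y) else 0) :=
        Finset.sum_le_sum fun X _ => hpt X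
    _ = ∑ x ∈ Ball, ∑ y ∈ far x, ∑ X : Φ.LongRegion χ,
        (if x ∈ X.1 ∧ y ∈ X.1 then ‖Φ.term X.1‖ * (F x + F y) else 0) := by
        rw [Finset.sum_comm]
        exact Finset.sum_congr rfl fun x _ => Finset.sum_comm
    _ ≤ ∑ x ∈ Ball, ∑ y ∈ far x, |h₀| * dist x y ^ (-α) * (F x + F y) :=
        Finset.sum_le_sum fun x _ => Finset.sum_le_sum fun y hy => hJ x y hy
    _ ≤ ∑ x ∈ Ball, |h₀| * (2 * C * χ ^ ((D : ℝ) - α) * (Real.exp (α * q) * F e)) := by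
        refine Finset.sum_le_sum fun x hx => (hfarsum x).trans ?_
        have := profile_le (Y := Y) hα hρ0 (by simpa [hBall] using hx : dist e x ≤ q * ρ)
        gcongr
    _ = Ball.card * (|h₀| * (2 * C * χ ^ ((D : ℝ) - α) * (Real.exp (α * q) * F e))) := by
        rw [Finset.sum_const, nsmul_eq_mul]
    _ ≤ (|κ| * (ρ * Real.exp q) ^ D) *
        (|h₀| * (2 * C * χ ^ ((D : ℝ) - α) * (Real.exp (α * q) * F e))) := by
        have hFe := hF0 e
        have h4 : (Ball.card : ℝ) ≤ |κ| * (ρ * Real.exp q) ^ D := by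
          refine (card_filter_dist_le e (by positivity)).trans ?_
          have h5 : 1 + q * ρ ≤ ρ * Real.exp q := by
            have := Real.add_one_le_exp q
            nlinarith
          calc κ * (1 + q * ρ) ^ D ≤ |κ| * (1 + q * ρ) ^ D := by gcongr; exact le_abs_self κ
            _ ≤ _ := by gcongr
        gcongr
    _ = _ := by
        rw [mul_pow, ← Real.exp_nat_mul, add_mul, Real.exp_add]
        ring

-- The weight of a region within `(m + 2) ρ` of the points `E` is the profile summed over `E`,
-- inflated by `exp((α + D) m)`; the factor `exp(2 α)` pays for the remaining `2 ρ`. For layer `m'`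
-- of a long term, the weight contributes `exp((α + D) m')` and the terms in reach `exp((α + D)(m +
-- m' + 4))`. The decay rate `2(α + D) + 1` of the layers is chosen to leave `exp(-m')`, which is
-- summable.
open Classical in
lemma isSupersolution_of_centers (hα : 0 ≤ α) (hχ : 1 ≤ χ) (hρ : 1 ≤ ρ) (hC : 0 ≤ C)
    (hΦ : Φ.DecaysLike fun r => h₀ / r ^ α)
    (h₁ : ∀ a : L.site, ∑ b ∈ Finset.univ.filter (fun b => χ ≤ dist a b), dist a b ^ (-α) ≤
      C * χ ^ ((D : ℝ) - α))
    (h₂ : ∀ a y : L.site, ∑ b ∈ Finset.univ.filter (fun b => χ ≤ dist a b),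
        dist a b ^ (-α) * (1 + dist b y / ρ) ^ (-α) ≤
      C * χ ^ ((D : ℝ) - α) * (1 + dist a y / ρ) ^ (-α))
    (hca : ∀ X, ca X ∈ X.1) (hcb : ∀ X, cb X ∈ X.1) (hd : ∀ X, χ ≤ dist (ca X) (cb X))
    (hcl : ∀ X, ∀ k ∈ X.1, dist (ca X) k ≤ ρ ∨ dist (cb X) k ≤ ρ)
    (B : M.Op) (n : ℕ) (m : ℕ) {Z E : Finset L.site}
    (hZ : ∀ z ∈ Z, ∃ e ∈ E, dist e z ≤ (m + 2 : ℝ) * ρ) :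
    IsSupersolution (fun ω : Φ.LongRegion χ × Fin n => nbhd ω.1.1 ((ω.2 + 1 : ℝ) * ρ))
      (fun ω => ‖Φ.term ω.1.1‖ * Real.exp (-(2 * (α + D) + 1) * ω.2))
      (fun ω => 2 * ‖B‖ * Real.exp (2 * α) * Real.exp ((α + D) * ω.2) *
        (profile α ρ Y (ca ω.1) + profile α ρ Y (cb ω.1)))
      (8 * C * |h₀| * |κ| * χ ^ ((D : ℝ) - α) * ρ ^ D * Real.exp (4 * (α + D))) B Y Z
      (2 * ‖B‖ * Real.exp (2 * α) * Real.exp ((α + D) * m) * ∑ e ∈ E, profile α ρ Y e) := by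
  have hρ0 : 0 < ρ := by linarith
  have hχ0 : 0 < χ := by linarith
  set F := profile (L := L) α ρ Y with hF
  have hF0 : ∀ x, 0 ≤ F x := profile_nonneg hρ0
  have hE0 : 0 ≤ ∑ e ∈ E, F e := Finset.sum_nonneg fun e _ => hF0 e
  set G := 2 * ‖B‖ * Real.exp (2 * α) with hG
  have hG0 : 0 ≤ G := by positivity
  set c := α + D with hc
  refine ⟨by positivity, fun hdis => ?_, ?_⟩
  · obtain ⟨y, hyZ, hyY⟩ := Finset.not_disjoint_iff.1 hdis
    obtain ⟨e, he, hey⟩ := hZ y hyZ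
    have h3 := profile_le (Y := Y) hα hρ0 hey
    have h4 : 1 ≤ profile α ρ Y y := by
      refine le_trans ?_ (Finset.single_le_sum (f := fun z => (1 + dist y z / ρ) ^ (-α))
        (fun z _ => by positivity) hyY)
      simp
    have h5 : F e ≤ ∑ e ∈ E, F e := Finset.single_le_sum (fun e _ => hF0 e) he
    have h6 : Real.exp (α * (m + 2)) ≤ Real.exp (2 * α) * Real.exp (c * m) := by
      rw [← Real.exp_add]
      refine Real.exp_le_exp.2 ?_
      have : (0 : ℝ) ≤ D * m := by positivity
      rw [hc]; nlinarith
    calc 2 * ‖B‖ = 2 * ‖B‖ * 1 := (mul_one _).symm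
      _ ≤ 2 * ‖B‖ * (Real.exp (2 * α) * Real.exp (c * m) * ∑ e ∈ E, F e) := by
        gcongr
        refine h4.trans (h3.trans ?_)
        have := hF0 e
        gcongr
      _ = _ := by rw [hG]; ring
  · set b : Φ.LongRegion χ × Fin n → ℝ :=
      fun ω => ‖Φ.term ω.1.1‖ * Real.exp (-(2 * c + 1) * ω.2) with hb
    set u : Φ.LongRegion χ × Fin n → ℝ :=
      fun ω => G * Real.exp (c * ω.2) * (F (ca ω.1) + F (cb ω.1)) with hu
    have hbu : ∀ ω, 0 ≤ b ω * u ω := fun ω => by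
      have := hF0 (ca ω.1)
      have := hF0 (cb ω.1)
      positivity
    -- The reach adds up: `m + 2` from `E` to the common point, `m' + 1` for the thickness of the
    -- layer, and 1 from the term's site to its center.
    have hhit : ∀ ω : Φ.LongRegion χ × Fin n, ¬ Disjoint (nbhd ω.1.1 ((ω.2 + 1 : ℝ) * ρ)) Z →
        ∃ e ∈ E, dist e (ca ω.1) ≤ (m + ω.2 + 4 : ℝ) * ρ ∨ dist e (cb ω.1) ≤ (m + ω.2 + 4 : ℝ) * ρ := by
      intro ω hω
      obtain ⟨z, hz, hzZ⟩ := Finset.not_disjoint_iff.1 hω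
      obtain ⟨k, hk, hkz⟩ := mem_nbhd.1 hz
      obtain ⟨e, he, hez⟩ := hZ z hzZ
      refine ⟨e, he, ?_⟩
      have h7 : ∀ x : L.site, dist x k ≤ ρ → dist e x ≤ (m + ω.2 + 4 : ℝ) * ρ := by
        intro x hx
        have t1 := dist_triangle e z x
        have t2 := dist_triangle_left z x k
        rw [dist_comm k x] at t2
        nlinarith
      exact (hcl ω.1 k hk).imp (h7 _) (h7 _)
    have hstep : ∑ ω ∈ Finset.univ.filter (fun ω : Φ.LongRegion χ × Fin n =>
        ¬ Disjoint (nbhd ω.1.1 ((ω.2 + 1 : ℝ) * ρ)) Z), b ω * u ω ≤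
        ∑ e ∈ E, ∑ ω : Φ.LongRegion χ × Fin n,
          if dist e (ca ω.1) ≤ (m + ω.2 + 4 : ℝ) * ρ ∨ dist e (cb ω.1) ≤ (m + ω.2 + 4 : ℝ) * ρ then
            b ω * u ω else 0 := by
      rw [Finset.sum_filter, Finset.sum_comm]
      refine Finset.sum_le_sum fun ω _ => ?_
      have hn : ∀ e ∈ E, 0 ≤ if dist e (ca ω.1) ≤ (m + ω.2 + 4 : ℝ) * ρ ∨
          dist e (cb ω.1) ≤ (m + ω.2 + 4 : ℝ) * ρ then b ω * u ω else 0 := fun e _ => by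
        split_ifs
        · exact hbu ω
        · exact le_rfl
      by_cases hω : Disjoint (nbhd ω.1.1 ((ω.2 + 1 : ℝ) * ρ)) Z
      · rw [if_neg (not_not.2 hω)]
        exact Finset.sum_nonneg hn
      · obtain ⟨e, he, h8⟩ := hhit ω hω
        refine le_trans ?_ (Finset.single_le_sum hn he)
        rw [if_pos hω, if_pos h8]
    have hinner : ∀ e ∈ E, ∑ ω : Φ.LongRegion χ × Fin n,
        (if dist e (ca ω.1) ≤ (m + ω.2 + 4 : ℝ) * ρ ∨ dist e (cb ω.1) ≤ (m + ω.2 + 4 : ℝ) * ρ then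
            b ω * u ω else 0) ≤
        2 * (2 * C * |h₀| * |κ| * χ ^ ((D : ℝ) - α) * ρ ^ D) * Real.exp (4 * c) *
          (G * Real.exp (c * m) * F e) := by
      intro e _
      rw [Fintype.sum_prod_type_right]
      have h9 : ∀ m' : Fin n, ∑ X : Φ.LongRegion χ,
          (if dist e (ca X) ≤ (m + m' + 4 : ℝ) * ρ ∨ dist e (cb X) ≤ (m + m' + 4 : ℝ) * ρ then
            b (X, m') * u (X, m') else 0) ≤
          Real.exp (-(m' : ℝ)) * ((2 * C * |h₀| * |κ| * χ ^ ((D : ℝ) - α) * ρ ^ D) *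
            Real.exp (4 * c) * (G * Real.exp (c * m) * F e)) := by
        intro m'
        have h10 := sum_longRegion_le (Y := Y) hα hχ hρ hC hΦ h₁ h₂ hca hcb hd e
          (q := (m + m' + 4 : ℝ)) (by positivity)
        calc _ = Real.exp (-(2 * c + 1) * m') * (G * Real.exp (c * m')) * ∑ X : Φ.LongRegion χ,
              (if dist e (ca X) ≤ (m + m' + 4 : ℝ) * ρ ∨ dist e (cb X) ≤ (m + m' + 4 : ℝ) * ρ then
                ‖Φ.term X.1‖ * (F (ca X) + F (cb X)) else 0) := by
              rw [Finset.mul_sum]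
              refine Finset.sum_congr rfl fun X _ => ?_
              split_ifs
              · simp only [hb, hu]; ring
              · rw [mul_zero]
          _ ≤ Real.exp (-(2 * c + 1) * m') * (G * Real.exp (c * m')) *
              (2 * C * |h₀| * |κ| * χ ^ ((D : ℝ) - α) * ρ ^ D * Real.exp (c * (m + m' + 4)) * F e) := by
              gcongr
          _ = (Real.exp (-(2 * c + 1) * m') * Real.exp (c * m') * Real.exp (c * (m + m' + 4))) *
              (2 * C * |h₀| * |κ| * χ ^ ((D : ℝ) - α) * ρ ^ D * G * F e) := by ring
          _ = (Real.exp (-(m' : ℝ)) * Real.exp (4 * c) * Real.exp (c * m)) *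
              (2 * C * |h₀| * |κ| * χ ^ ((D : ℝ) - α) * ρ ^ D * G * F e) := by
              rw [← Real.exp_add, ← Real.exp_add, ← Real.exp_add, ← Real.exp_add]
              congr 2
              ring
          _ = _ := by ring
      refine (Finset.sum_le_sum fun m' _ => h9 m').trans ?_
      rw [← Finset.sum_mul]
      have := hF0 e
      calc _ ≤ 2 * ((2 * C * |h₀| * |κ| * χ ^ ((D : ℝ) - α) * ρ ^ D) *
            Real.exp (4 * c) * (G * Real.exp (c * m) * F e)) := by
            gcongr
            exact sum_exp_neg_le_two n
        _ = _ := by ring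
    calc _ ≤ 2 * ∑ e ∈ E, 2 * (2 * C * |h₀| * |κ| * χ ^ ((D : ℝ) - α) * ρ ^ D) * Real.exp (4 * c) *
          (G * Real.exp (c * m) * F e) := by
          gcongr
          exact hstep.trans (Finset.sum_le_sum hinner)
      _ = _ := by
          rw [← Finset.mul_sum, ← Finset.mul_sum]
          ring

set_option maxHeartbeats 1000000 in
/-- A Lieb-Robinson bound for two-body interactions, with a range `χ` that separates short from long
terms and a radius `ρ` outside of which the short-range evolution is negligible. -/
theorem norm_commutator_heisenberg_le_profile (hα : 0 ≤ α) (hχ : 1 ≤ χ) (hρ : 1 ≤ ρ) (hC : 0 ≤ C)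
    (hΦ : Φ.DecaysLike fun r => h₀ / r ^ α)
    (h₁ : ∀ a : L.site, ∑ b ∈ Finset.univ.filter (fun b => χ ≤ dist a b), dist a b ^ (-α) ≤
      C * χ ^ ((D : ℝ) - α))
    (h₂ : ∀ a y : L.site, ∑ b ∈ Finset.univ.filter (fun b => χ ≤ dist a b),
        dist a b ^ (-α) * (1 + dist b y / ρ) ^ (-α) ≤
      C * χ ^ ((D : ℝ) - α) * (1 + dist a y / ρ) ^ (-α))
    (hcent : ∀ X : Φ.LongRegion χ, ∃ a ∈ X.1, ∃ b ∈ X.1, χ ≤ dist a b ∧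
      ∀ k ∈ X.1, dist a k ≤ ρ ∨ dist b k ≤ ρ)
    {P : ℝ} {t : ℝ} (ht : 0 ≤ t)
    (hloc : ∀ (X : Finset L.site) (A : M.Op), A ∈ M.localAlg X → (X.card : ℝ) ≤ P →
      ∀ s ∈ Set.Icc 0 t, ∀ m : ℕ,
        ‖Φ.layer χ ρ X A s m‖ ≤ ‖A‖ * Real.exp (-(2 * (α + D) + 1) * m))
    (hcard : ∀ X : Φ.LongRegion χ, (X.1.card : ℝ) ≤ P)
    {X : Finset L.site} (hXP : (X.card : ℝ) ≤ P) (hX : X.Nonempty) {A B : M.Op}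
    (hA : A ∈ M.localAlg X) (hB : B ∈ M.localAlg Y) :
    ‖heisenberg Φ.hamiltonian A t * B - B * heisenberg Φ.hamiltonian A t‖ ≤
      4 * Real.exp (2 * α) * ‖A‖ * ‖B‖ *
        Real.exp (8 * C * |h₀| * |κ| * χ ^ ((D : ℝ) - α) * ρ ^ D * Real.exp (4 * (α + D)) * t) *
        ∑ i ∈ X, profile α ρ Y i := by
  classical
  have hρ0 : 0 < ρ := by linarith
  have htt : t ∈ Set.Icc 0 t := Set.right_mem_Icc.2 ht
  choose ca hca cb hcb hd hcl using hcent
  set c := α + D with hc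
  set v := 8 * C * |h₀| * |κ| * χ ^ ((D : ℝ) - α) * ρ ^ D * Real.exp (4 * c) with hv
  -- The lattice is finite, so finitely many layers exhaust it and the decomposition of the
  -- short-range evolution is exact; no final bound depends on `N`.
  obtain ⟨N, hN⟩ : ∃ N : ℕ, ∀ i j : L.site, dist i j ≤ (N + 1 : ℝ) * ρ := by
    obtain ⟨r, hr⟩ := (Set.finite_range fun p : L.site × L.site => dist p.1 p.2).bddAbove
    obtain ⟨N, hN⟩ := exists_nat_ge r
    refine ⟨N, fun i j => ?_⟩
    have h3 : dist i j ≤ r := hr ⟨(i, j), rfl⟩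
    have : (0 : ℝ) ≤ N := Nat.cast_nonneg N
    nlinarith
  have hfull : ∀ (W : Finset L.site), W.Nonempty → nbhd W ((N + 1 : ℝ) * ρ) = Finset.univ := by
    rintro W ⟨w, hw⟩
    exact Finset.eq_univ_iff_forall.2 fun x => mem_nbhd.2 ⟨w, hw, hN w x⟩
  set Ψ := Φ.shortOn χ Finset.univ with hΨ
  have hlay : ∀ (W : Finset L.site) (O : M.Op) (s : ℝ), W.Nonempty →
      heisenberg Ψ.hamiltonian O s = ∑ m : Fin (N + 1), Φ.layer χ ρ W O s m := by
    intro W O s hW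
    rw [Fin.sum_univ_eq_sum_range (fun m => Φ.layer χ ρ W O s m), sum_layer, hfull W hW]
  have hsum : ∀ s, heisenberg Ψ.hamiltonian (Φ.hamiltonian - Ψ.hamiltonian) s =
      ∑ ω : Φ.LongRegion χ × Fin (N + 1), Φ.layer χ ρ ω.1.1 (Φ.term ω.1.1) s ω.2 := by
    intro s
    have e1 : Φ.hamiltonian - Ψ.hamiltonian = ∑ X : Φ.LongRegion χ, Φ.term X.1 := by
      rw [← Finset.sum_subtype (Finset.univ.filter fun X => Φ.term X ≠ 0 ∧ ¬ IsShort χ X)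
        (fun X => by simp) (fun X : Finset L.site => Φ.term X), Finset.sum_filter]
      simp only [hamiltonian, hΨ, shortOn, restrict, ← Finset.sum_sub_distrib]
      refine Finset.sum_congr rfl fun W _ => ?_
      by_cases h3 : IsShort χ W
      · simp [h3]
      · by_cases h4 : Φ.term W = 0 <;> simp [h3, h4]
    rw [e1, heisenberg_sum, Fintype.sum_prod_type]
    refine Finset.sum_congr rfl fun X _ => ?_
    have hne : X.1.Nonempty := ⟨ca X, hca X⟩
    rw [hlay X.1 (Φ.term X.1) s hne]
  have hsuper := fun (m : ℕ) (Z E : Finset L.site)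
      (hZ : ∀ z ∈ Z, ∃ e ∈ E, dist e z ≤ (m + 2 : ℝ) * ρ) =>
    isSupersolution_of_centers (Y := Y) hα hχ hρ hC hΦ h₁ h₂ hca hcb hd hcl B (N + 1) m hZ
  have hω : ∀ ω : Φ.LongRegion χ × Fin (N + 1), IsSupersolution
      (fun ω : Φ.LongRegion χ × Fin (N + 1) => nbhd ω.1.1 ((ω.2 + 1 : ℝ) * ρ))
      (fun ω => ‖Φ.term ω.1.1‖ * Real.exp (-(2 * c + 1) * ω.2))
      (fun ω => 2 * ‖B‖ * Real.exp (2 * α) * Real.exp (c * ω.2) *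
        (profile α ρ Y (ca ω.1) + profile α ρ Y (cb ω.1))) v B Y
      (nbhd ω.1.1 ((ω.2 + 1 : ℝ) * ρ)) (2 * ‖B‖ * Real.exp (2 * α) * Real.exp (c * ω.2) *
        (profile α ρ Y (ca ω.1) + profile α ρ Y (cb ω.1))) := by
    intro ω
    have hne : ca ω.1 ≠ cb ω.1 := by
      intro h3
      have := hd ω.1
      rw [h3, dist_self] at this
      linarith
    have h3 := hsuper ω.2 (nbhd ω.1.1 ((ω.2 + 1 : ℝ) * ρ)) {ca ω.1, cb ω.1} ?_
    · rwa [Finset.sum_pair hne] at h3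
    · intro z hz
      obtain ⟨k, hk, hkz⟩ := mem_nbhd.1 hz
      rcases hcl ω.1 k hk with h4 | h4
      · refine ⟨ca ω.1, by simp, ?_⟩
        have := dist_triangle (ca ω.1) k z
        linarith
      · refine ⟨cb ω.1, by simp, ?_⟩
        have := dist_triangle (cb ω.1) k z
        linarith
  -- The initial observable is dressed as well: its free evolution at time `t` is cut into layers,
  -- and the comparison principle is applied to each of them, with the sites of `X` as centers.
  have hm : ∀ m : Fin (N + 1),
      ‖intPic Φ.hamiltonian Ψ.hamiltonian (Φ.layer χ ρ X A t m) t * B -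
        B * intPic Φ.hamiltonian Ψ.hamiltonian (Φ.layer χ ρ X A t m) t‖ ≤
      Real.exp (-(m : ℝ)) * (2 * Real.exp (2 * α) * ‖A‖ * ‖B‖ * Real.exp (v * t) *
        ∑ i ∈ X, profile α ρ Y i) := by
    intro m
    have hZ := hsuper m (nbhd X ((m + 1 : ℝ) * ρ)) X (fun z hz => by
      obtain ⟨i, hi, hiz⟩ := mem_nbhd.1 hz
      exact ⟨i, hi, by nlinarith⟩)
    have h3 := norm_commutator_intPic_le (T := t)
      (S := fun ω : Φ.LongRegion χ × Fin (N + 1) => nbhd ω.1.1 ((ω.2 + 1 : ℝ) * ρ))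
      (k := fun ω s => Φ.layer χ ρ ω.1.1 (Φ.term ω.1.1) s ω.2)
      (b := fun ω => ‖Φ.term ω.1.1‖ * Real.exp (-(2 * c + 1) * ω.2))
      Φ.hamiltonian_isHermitian Ψ.hamiltonian_isHermitian
      hB (fun ω s => Φ.layer_mem χ ω.1.1 s hρ0.le (Φ.term_mem ω.1.1) ω.2)
      (fun ω s => Φ.layer_isHermitian χ ω.1.1 s (Φ.term_isHermitian ω.1.1) ω.2)
      (fun ω => mul_nonneg (norm_nonneg _) (Real.exp_pos _).le)
      (fun ω s hs => hloc ω.1.1 _ (Φ.term_mem ω.1.1) (hcard ω.1) s hs ω.2)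
      hsum hω hZ (Φ.layer_mem χ X t hρ0.le hA m) (s := t) htt
    refine h3.trans ?_
    have h4 := hloc X A hA hXP t htt m
    have hF0 : 0 ≤ ∑ i ∈ X, profile α ρ Y i :=
      Finset.sum_nonneg fun i _ => profile_nonneg hρ0 i
    calc _ ≤ ‖A‖ * Real.exp (-(2 * c + 1) * m) * (2 * ‖B‖ * Real.exp (2 * α) * Real.exp (c * m) *
          (∑ i ∈ X, profile α ρ Y i) * Real.exp (v * t)) := by gcongr
      _ = (Real.exp (-(2 * c + 1) * m) * Real.exp (c * m)) * (2 * Real.exp (2 * α) * ‖A‖ * ‖B‖ *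
          Real.exp (v * t) * ∑ i ∈ X, profile α ρ Y i) := by ring
      _ ≤ _ := by
        gcongr
        rw [← Real.exp_add]
        refine Real.exp_le_exp.2 ?_
        have : 0 ≤ c * m := by positivity
        linarith
  have e2 : heisenberg Φ.hamiltonian A t =
      ∑ m : Fin (N + 1), intPic Φ.hamiltonian Ψ.hamiltonian (Φ.layer χ ρ X A t m) t := by
    rw [← intPic_heisenberg Φ.hamiltonian Ψ.hamiltonian A t, hlay X A t hX, intPic_sum]
  rw [e2, Finset.sum_mul, Finset.mul_sum, ← Finset.sum_sub_distrib]
  refine (norm_sum_le _ _).trans ((Finset.sum_le_sum fun m _ => hm m).trans ?_)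
  rw [← Finset.sum_mul]
  have hF0 : 0 ≤ ∑ i ∈ X, profile α ρ Y i :=
    Finset.sum_nonneg fun i _ => profile_nonneg hρ0 i
  calc _ ≤ 2 * (2 * Real.exp (2 * α) * ‖A‖ * ‖B‖ * Real.exp (v * t) *
        ∑ i ∈ X, profile α ρ Y i) := by
        gcongr
        exact sum_exp_neg_le_two (N + 1)
    _ = _ := by ring

end LongRange

end Interaction

end

/-! ### Polynomial growth of commutators for two-body interactions -/

section

namespace Interaction

variable {M : Model L} {Φ : Interaction M}

/-- Two sites of the same cluster are at distance at most `2 R ≤ χ`. A pair at distance more than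
`χ` therefore represents both clusters, and every other site of the term is close to one member of
the pair. -/
lemma IsTwoBody.exists_centers {R χ ρ : ℝ} (hΦ : Φ.IsTwoBody R) (hR : 2 * R ≤ χ) (hχ : χ ≤ ρ)
    (X : Φ.LongRegion χ) : ∃ a ∈ X.1, ∃ b ∈ X.1, χ ≤ dist a b ∧
      ∀ k ∈ X.1, dist a k ≤ ρ ∨ dist b k ≤ ρ := by
  obtain ⟨X, hX, hs⟩ := X
  obtain ⟨i, j, hij⟩ := hΦ X hX
  simp only [IsShort, not_forall, not_le] at hs
  obtain ⟨a, ha, b, hb, hab⟩ := hs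
  refine ⟨a, ha, b, hb, hab.le, fun k hk => ?_⟩
  have tri : ∀ x y z : L.site, dist x z ≤ R → dist y z ≤ R → dist x y ≤ χ := by
    intro x y z hx hy
    have := dist_triangle_right x y z
    linarith
  rcases hij a ha with h1 | h1 <;> rcases hij b hb with h2 | h2
  · exact absurd (tri a b i h1 h2) (not_le.2 hab)
  · rcases hij k hk with h3 | h3
    · exact Or.inl ((tri a k i h1 h3).trans hχ)
    · exact Or.inr ((tri b k j h2 h3).trans hχ)
  · rcases hij k hk with h3 | h3
    · exact Or.inr ((tri b k i h2 h3).trans hχ)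
    · exact Or.inl ((tri a k j h1 h3).trans hχ)
  · exact absurd (tri a b j h1 h2) (not_le.2 hab)

lemma IsTwoBody.card_le {R : ℝ} (hΦ : Φ.IsTwoBody R) (hR : 0 ≤ R) {X : Finset L.site}
    (hX : Φ.term X ≠ 0) : (X.card : ℝ) ≤ 2 * |κ| * (1 + R) ^ D := by
  classical
  obtain ⟨i, j, hij⟩ := hΦ X hX
  have h1 : X ⊆ (Finset.univ.filter fun k => dist i k ≤ R) ∪
      Finset.univ.filter fun k => dist j k ≤ R := by
    intro k hk
    simpa [dist_comm] using hij k hk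
  have h2 : (X.card : ℝ) ≤ ((Finset.univ.filter fun k => dist i k ≤ R).card : ℝ) +
      ((Finset.univ.filter fun k => dist j k ≤ R).card : ℝ) := by
    exact_mod_cast (Finset.card_le_card h1).trans (Finset.card_union_le _ _)
  have h3 := card_filter_dist_le i hR
  have h4 := card_filter_dist_le j hR
  have h5 : κ * (1 + R) ^ D ≤ |κ| * (1 + R) ^ D := by gcongr; exact le_abs_self κ
  linarith

lemma IsTwoBody.mono {R R' : ℝ} (hΦ : Φ.IsTwoBody R) (h : R ≤ R') : Φ.IsTwoBody R' := by
  intro X hX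
  obtain ⟨i, j, hij⟩ := hΦ X hX
  exact ⟨i, j, fun k hk => (hij k hk).imp (fun h1 => h1.trans h) fun h1 => h1.trans h⟩

/-- The layers decay exponentially if their spacing grows linearly with time. -/
lemma norm_layer_le {h₀ α C₁ χ lam P t c : ℝ} (hχ : 1 ≤ χ)
    (hΦ : Φ.DecaysLike fun r => h₀ / r ^ α) (hC₁0 : 0 ≤ C₁)
    (hC₁ : ∀ i : L.site, ∑ j ∈ Finset.univ.erase i, dist i j ^ (-α) ≤ C₁)
    {χ₀ : ℝ} {n : ℕ} (hχ₀ : 0 ≤ χ₀) (hχt : χ = χ₀ * (1 + t) ^ n) (ht : 0 ≤ t) (hc : 0 ≤ c)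
    {K a : ℝ} (ha : a = 1 + 2 * ((1 + Real.exp 1) * |h₀| * C₁) + n * D)
    (hK : K = 2 * Real.exp 1 * P * P * |κ| * |h₀| * C₁ * (2 * χ₀) ^ D * (2 ^ D * D.factorial))
    (hlam : 2 * (c + a + K) ≤ lam) (hlam1 : 1 ≤ lam)
    {X : Finset L.site} {A : M.Op} (hA : A ∈ M.localAlg X) (hP : (X.card : ℝ) ≤ P)
    {s : ℝ} (hs : s ∈ Set.Icc 0 t) (m : ℕ) :
    ‖Φ.layer χ (χ * (lam * (1 + t))) X A s m‖ ≤ ‖A‖ * Real.exp (-c * m) := by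
  set ρ := χ * (lam * (1 + t)) with hρ
  have hχ0 : 0 < χ := by linarith
  have hP0 : 0 ≤ P := (Nat.cast_nonneg _).trans hP
  have hlt : 1 ≤ lam * (1 + t) := one_le_mul_of_one_le_of_one_le hlam1 (by linarith)
  have hρ1 : 1 ≤ ρ := one_le_mul_of_one_le_of_one_le (by linarith) hlt
  have hK0 : 0 ≤ K := by rw [hK]; positivity
  have ha0 : 0 ≤ a := by rw [ha]; positivity
  cases m with
  | zero =>
    simp only [layer, Nat.cast_zero, mul_zero, Real.exp_zero, mul_one]
    rw [norm_heisenberg (hamiltonian_isHermitian _)]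
  | succ m =>
    have hm1 : (0 : ℝ) ≤ m := Nat.cast_nonneg m
    set ℓ := (m + 1 : ℝ) * ρ with hℓ
    have hℓ1 : 1 ≤ ℓ := one_le_mul_of_one_le_of_one_le (by linarith) hρ1
    have h1 := norm_heisenberg_shortOn_sub_le hχ0 hΦ hC₁ hC₁0 (N' := nbhd X ((m + 2 : ℝ) * ρ))
      (by linarith : 0 ≤ ℓ) (nbhd_mono X (by rw [hℓ]; linarith)) hA hP hs.1 hs.2
    refine h1.trans ?_
    set v := 2 * ((1 + Real.exp 1) * |h₀| * C₁) with hv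
    set y := (m + 1 : ℝ) * (lam * (1 + t)) with hy
    have hy0 : 0 ≤ y := mul_nonneg (by linarith) (by linarith)
    have hℓy : ℓ = χ * y := by rw [hℓ, hρ, hy]; ring
    have e1 : ℓ / χ = y := by rw [hℓy]; field_simp
    -- The volume factor is paid for by half of the decay `exp(-y)`, and powers of `1 + t` by
    -- exponentials in `t`.
    have b1 : (1 + ℓ) ^ D ≤ (2 * χ₀) ^ D * Real.exp (n * D * t) * (2 ^ D * D.factorial * Real.exp (y / 2)) := by
      have c1 : (1 + ℓ) ^ D ≤ (2 * (χ * y)) ^ D := by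
        rw [← hℓy]; gcongr; linarith
      have c2 : χ ^ D ≤ χ₀ ^ D * Real.exp (n * D * t) := by
        rw [hχt, mul_pow, ← pow_mul]
        have : (1 + t) ^ (n * D) ≤ Real.exp (n * D * t) := by
          have h3 := Real.add_one_le_exp t
          calc (1 + t) ^ (n * D) ≤ (Real.exp t) ^ (n * D) := by gcongr; linarith
            _ = _ := by rw [← Real.exp_nat_mul]; push_cast; ring_nf
        gcongr
      have c3 : y ^ D ≤ 2 ^ D * D.factorial * Real.exp (y / 2) := by
        have h4 := Real.pow_div_factorial_le_exp (x := y / 2) (by positivity) D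
        rw [div_pow, div_div, div_le_iff₀ (by positivity)] at h4
        linarith
      calc _ ≤ 2 ^ D * χ ^ D * y ^ D := by rw [mul_assoc, ← mul_pow, ← mul_pow]; exact c1
        _ ≤ 2 ^ D * (χ₀ ^ D * Real.exp (n * D * t)) * (2 ^ D * D.factorial * Real.exp (y / 2)) := by
          gcongr
        _ = _ := by rw [mul_pow]; ring
    have b2 : t ≤ Real.exp t := by linarith [Real.add_one_le_exp t]
    rw [e1]
    calc _ ≤ Real.exp t * (2 * ‖A‖ * Real.exp (v * t) * (P * Real.exp (1 - y)) *
          (P * (|κ| * ((2 * χ₀) ^ D * Real.exp (n * D * t) *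
            (2 ^ D * D.factorial * Real.exp (y / 2)))) * (|h₀| * C₁))) := by gcongr
      _ = ‖A‖ * (K * (Real.exp t * Real.exp (v * t) * Real.exp (n * D * t) * Real.exp (-y) *
          Real.exp (y / 2))) := by
          rw [hK, sub_eq_add_neg, Real.exp_add]; ring
      _ = ‖A‖ * (K * Real.exp (a * t - y / 2)) := by
          rw [← Real.exp_add, ← Real.exp_add, ← Real.exp_add, ← Real.exp_add, ha]
          ring_nf
      _ ≤ ‖A‖ * (Real.exp K * Real.exp (a * t - y / 2)) := by
          gcongr
          linarith [Real.add_one_le_exp K]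
      _ ≤ _ := by
          rw [← Real.exp_add]
          gcongr
          -- The remaining half `y / 2` grows like `(m + 1)(1 + t)`; with slope `lam / 2 ≥ c + a +
          -- K` it covers the desired decay, the exponential growth in `t`, and the constant `K ≤
          -- exp K`.
          have h6 : (m + 1 : ℝ) * ((c + a + K) * (1 + t)) ≤ y / 2 := by
            rw [hy, mul_div_assoc]
            gcongr
            have : (c + a + K) * (1 + t) ≤ lam / 2 * (1 + t) := by gcongr; linarith
            linarith
          have h7 : c * (m + 1) + a * t + K ≤ (m + 1 : ℝ) * ((c + a + K) * (1 + t)) := by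
            have : 0 ≤ c * t := by positivity
            have : 0 ≤ K * t := by positivity
            have : 0 ≤ a * t := by positivity
            have : 0 ≤ m * (c * t) := by positivity
            have : 0 ≤ m * (K * t) := by positivity
            have : 0 ≤ m * (a * t) := by positivity
            have : 0 ≤ m * a := by positivity
            have : 0 ≤ m * K := by positivity
            linarith
          push_cast
          linarith

end Interaction

-- The cutoff `χ` and the spreading radius `ρ` are chosen as powers of `1 + t` for the final time
-- `t`. The dressed long terms then have bounded total effect, and all growth in time sits in the
-- factor `ρ ^ α` of the profile.
set_option maxHeartbeats 1000000 in
open Interaction in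
theorem exists_lieb_robinson_two_body_of_nonneg (D : ℕ) (κ h₀ : ℝ) {α : ℝ} (hα : 2 * (D : ℝ) < α)
    (R : ℝ) (p : ℕ) : ∃ (K : ℝ) (k : ℕ), 0 < K ∧
    ∀ (L : Lattice D κ) (M : Model L) (Φ : Interaction M),
      Φ.DecaysLike (fun r => h₀ / r ^ α) → Φ.IsTwoBody R →
      ∀ X Y : Finset L.site, X.Nonempty → Y.Nonempty → Disjoint X Y → X.card ≤ p →
      ∀ A ∈ M.localAlg X, ∀ B ∈ M.localAlg Y, ∀ t : ℝ, 0 ≤ t →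
        ‖heisenberg Φ.hamiltonian A t * B - B * heisenberg Φ.hamiltonian A t‖ ≤
          K * Y.card * ‖A‖ * ‖B‖ * (1 + t) ^ k / regionDist X Y ^ α := by
  have hD0 : (0 : ℝ) ≤ D := Nat.cast_nonneg D
  have hαD : (D : ℝ) < α := by linarith
  have hα0 : 0 ≤ α := by linarith
  obtain ⟨C₁, hC₁, h₁⟩ := exists_sum_far_rpow_le D κ hαD
  obtain ⟨C₂, hC₂, h₂⟩ := exists_conv_rpow_le D κ hαD
  set C := max C₁ C₂ with hC
  have hC0 : 0 ≤ C := hC₁.le.trans (le_max_left _ _)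
  set R₀ := max R 1 with hR₀
  have hR₀1 : 1 ≤ R₀ := le_max_right _ _
  set P : ℝ := p + 2 * |κ| * (1 + R₀) ^ D with hP
  have hP0 : 0 ≤ P := by positivity
  -- With `χ ∝ (1 + t) ^ n`, this choice gives `χ ^ (2 D - α) ≤ (1 + t) ^ (-(D + 1))`; it is the
  -- place where `α > 2 D` is needed.
  obtain ⟨n, hn⟩ := exists_nat_ge (((D : ℝ) + 1) / (α - 2 * D))
  rw [div_le_iff₀ (by linarith)] at hn
  set c : ℝ := 2 * (α + D) + 1 with hc
  set χ₀ : ℝ := 2 * R₀ with hχ₀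
  set a : ℝ := 1 + 2 * ((1 + Real.exp 1) * |h₀| * C₁) + n * D with ha
  set K₁ : ℝ := 2 * Real.exp 1 * P * P * |κ| * |h₀| * C₁ * (2 * χ₀) ^ D * (2 ^ D * D.factorial)
    with hK₁
  set lam : ℝ := 2 * (c + a + K₁) + 1 with hlam
  have ha0 : 0 ≤ a := by positivity
  have hK₁0 : 0 ≤ K₁ := by positivity
  have hc0 : 0 ≤ c := by positivity
  have hlam1 : 1 ≤ lam := by rw [hlam]; linarith
  have hlam0 : 0 < lam := by linarith
  set V : ℝ := 8 * C * |h₀| * |κ| * lam ^ D * Real.exp (4 * (α + D)) with hV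
  set k : ℕ := ⌈((n + 1 : ℕ) : ℝ) * α⌉₊ with hk
  -- The power `k` comes from `ρ ^ α` with `ρ ∝ (1 + t) ^ (n + 1)`; `P + 1` instead of `P` keeps the
  -- constant positive.
  refine ⟨4 * Real.exp (2 * α) * Real.exp V * (P + 1) * (χ₀ * lam) ^ α, k, by positivity, ?_⟩
  intro L M Φ hΦ hR X Y hX hY hXY hXp A hA B hB t ht
  set τ := 1 + t with hτ
  have hτ1 : 1 ≤ τ := by rw [hτ]; linarith
  have hτ0 : 0 < τ := by linarith
  set χ := χ₀ * τ ^ n with hχ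
  have hτn : 1 ≤ τ ^ n := one_le_pow₀ hτ1
  have hχ2 : χ₀ ≤ χ := le_mul_of_one_le_right (by linarith) hτn
  have hχ1 : 1 ≤ χ := by linarith
  have hχ0 : 0 < χ := by linarith
  set ρ := χ * (lam * (1 + t)) with hρ
  have hlt : 1 ≤ lam * (1 + t) := one_le_mul_of_one_le_of_one_le hlam1 (by linarith)
  have hχρ : χ ≤ ρ := le_mul_of_one_le_right hχ0.le hlt
  have hρ1 : 1 ≤ ρ := hχ1.trans hχρ
  have hρ0 : 0 < ρ := by linarith
  have hR' := hR.mono (le_max_left R 1)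
  have hCχ : 0 ≤ χ ^ ((D : ℝ) - α) := by positivity
  have herase : ∀ i : L.site, ∑ j ∈ Finset.univ.erase i, dist i j ^ (-α) ≤ C₁ := by
    intro i
    have h3 := h₁ L i 1 le_rfl
    rw [Real.one_rpow, mul_one] at h3
    refine le_trans (Finset.sum_le_sum_of_subset_of_nonneg (fun j hj => ?_)
      fun j _ _ => Real.rpow_nonneg dist_nonneg _) h3
    simpa using L.one_le_dist i j (Finset.ne_of_mem_erase hj).symm
  have hXP : (X.card : ℝ) ≤ P := by
    have : (X.card : ℝ) ≤ p := by exact_mod_cast hXp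
    have : 0 ≤ 2 * |κ| * (1 + R₀) ^ D := by positivity
    rw [hP]; linarith
  have hfar : ∀ x : L.site, ∑ b ∈ Finset.univ.filter (fun b => χ ≤ dist x b), dist x b ^ (-α) ≤
      C * χ ^ ((D : ℝ) - α) :=
    fun x => (h₁ L x χ hχ1).trans (mul_le_mul_of_nonneg_right (le_max_left _ _) hCχ)
  have hconv : ∀ x y : L.site, ∑ b ∈ Finset.univ.filter (fun b => χ ≤ dist x b),
      dist x b ^ (-α) * (1 + dist b y / ρ) ^ (-α) ≤
      C * χ ^ ((D : ℝ) - α) * (1 + dist x y / ρ) ^ (-α) := by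
    intro x y
    refine (h₂ L x y χ ρ hχ1 hχρ).trans ?_
    have : C₂ ≤ C := le_max_right _ _
    gcongr
  have hcard : ∀ W : Φ.LongRegion χ, (W.1.card : ℝ) ≤ P := by
    intro W
    have h3 := hR'.card_le (by linarith) W.2.1
    have : (0 : ℝ) ≤ p := Nat.cast_nonneg p
    rw [hP]; linarith
  have hloc : ∀ (W : Finset L.site) (O : M.Op), O ∈ M.localAlg W → (W.card : ℝ) ≤ P →
      ∀ s ∈ Set.Icc 0 t, ∀ m : ℕ,
        ‖Φ.layer χ ρ W O s m‖ ≤ ‖O‖ * Real.exp (-(2 * (α + D) + 1) * m) :=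
    fun W O hO hW s hs m => norm_layer_le hχ1 hΦ hC₁.le herase (by linarith) hχ ht hc0 ha hK₁
      (by rw [hlam]; linarith) hlam1 hO hW hs m
  have hcent := hR'.exists_centers hχ2 hχρ
  have key := norm_commutator_heisenberg_le_profile (Y := Y) (χ := χ) (ρ := ρ) (C := C) (P := P)
    hα0 hχ1 hρ1 hC0 hΦ hfar hconv hcent ht hloc hcard hXP hX hA hB
  refine key.trans ?_
  -- The rate times `t` is a constant times `χ ^ (2 D - α) (1 + t) ^ D t`, hence bounded uniformly
  -- in `t`.
  have hrate : 8 * C * |h₀| * |κ| * χ ^ ((D : ℝ) - α) * ρ ^ D * Real.exp (4 * (α + D)) * t ≤ V := by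
    have e1 : χ ^ ((D : ℝ) - α) * ρ ^ D = χ ^ (2 * (D : ℝ) - α) * (lam ^ D * τ ^ D) := by
      rw [hρ, mul_pow χ (lam * (1 + t)) D, mul_pow lam (1 + t) D, ← hτ, ← mul_assoc,
        ← Real.rpow_natCast χ D, ← Real.rpow_add hχ0]
      ring_nf
    have e2 : χ ^ (2 * (D : ℝ) - α) ≤ (τ ^ (D + 1))⁻¹ := by
      calc χ ^ (2 * (D : ℝ) - α) ≤ (τ ^ n) ^ (2 * (D : ℝ) - α) := by
            refine Real.rpow_le_rpow_of_nonpos (by positivity) ?_ (by linarith)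
            exact le_mul_of_one_le_left (by positivity) (by linarith)
        _ = τ ^ ((n : ℝ) * (2 * D - α)) := by rw [← Real.rpow_natCast, ← Real.rpow_mul hτ0.le]
        _ ≤ τ ^ (-((D + 1 : ℕ) : ℝ)) := by
            refine Real.rpow_le_rpow_of_exponent_le hτ1 ?_
            push_cast; linarith
        _ = _ := by rw [Real.rpow_neg hτ0.le, Real.rpow_natCast]
    have e3 : (τ ^ (D + 1))⁻¹ * τ ^ D * t ≤ 1 := by
      have h5 : (τ ^ (D + 1))⁻¹ * τ ^ D = τ⁻¹ := by rw [pow_succ]; field_simp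
      rw [h5, inv_mul_le_iff₀ hτ0]
      rw [hτ]; linarith
    calc _ = 8 * C * |h₀| * |κ| * Real.exp (4 * (α + D)) * lam ^ D *
          (χ ^ (2 * (D : ℝ) - α) * τ ^ D * t) := by
          rw [mul_assoc _ (χ ^ ((D : ℝ) - α)), e1]; ring
      _ ≤ 8 * C * |h₀| * |κ| * Real.exp (4 * (α + D)) * lam ^ D * 1 := by
          gcongr
          exact le_trans (by gcongr) e3
      _ = V := by rw [hV]; ring
  set r := regionDist X Y with hr
  have hr1 : 1 ≤ r := one_le_regionDist hX hY hXY
  have hprof : ∑ i ∈ X, profile α ρ Y i ≤ P * (Y.card * (ρ ^ α / r ^ α)) := by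
    have h4 : ∑ i ∈ X, profile α ρ Y i ≤ X.card * (Y.card * (ρ ^ α / r ^ α)) := by
      rw [← nsmul_eq_mul]
      refine Finset.sum_le_card_nsmul _ _ _ fun i hi => ?_
      rw [← nsmul_eq_mul]
      refine Finset.sum_le_card_nsmul _ _ _ fun y hy => ?_
      have h5 : r / ρ ≤ 1 + dist i y / ρ := by
        have : r / ρ ≤ dist i y / ρ := by gcongr; exact regionDist_le hi hy
        linarith
      have h6 := Real.rpow_le_rpow_of_nonpos (by positivity) h5 (neg_nonpos.2 hα0)
      refine h6.trans (le_of_eq ?_)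
      rw [Real.rpow_neg (by positivity), Real.div_rpow (by linarith) hρ0.le, inv_div]
    refine h4.trans ?_
    gcongr
  have hρα : ρ ^ α ≤ (χ₀ * lam) ^ α * τ ^ k := by
    have e4 : ρ = (χ₀ * lam) * τ ^ (n + 1) := by rw [hρ, hχ, pow_succ]; ring
    have hχ₀0 : 0 < χ₀ := by linarith
    rw [e4, Real.mul_rpow (by positivity) (by positivity)]
    gcongr
    rw [← Real.rpow_natCast, ← Real.rpow_mul hτ0.le, ← Real.rpow_natCast τ k]
    exact Real.rpow_le_rpow_of_exponent_le hτ1 (Nat.le_ceil _)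
  have hF0 : 0 ≤ ∑ i ∈ X, profile α ρ Y i := Finset.sum_nonneg fun i _ => profile_nonneg hρ0 i
  have hF1 : ∑ i ∈ X, profile α ρ Y i ≤
      (P + 1) * (Y.card * ((χ₀ * lam) ^ α * τ ^ k / r ^ α)) := by
    refine hprof.trans ?_
    gcongr
    linarith
  have hexp := Real.exp_le_exp.2 hrate
  calc _ ≤ 4 * Real.exp (2 * α) * ‖A‖ * ‖B‖ * Real.exp V *
        ((P + 1) * (Y.card * ((χ₀ * lam) ^ α * τ ^ k / r ^ α))) :=
        mul_le_mul (mul_le_mul_of_nonneg_left hexp (by positivity)) hF1 hF0 (by positivity)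
    _ = _ := by ring

/-- For two-body interactions with `α > 2 D`, commutators grow polynomially in time and decay with
the exponent of the interaction. -/
theorem exists_lieb_robinson_two_body (D : ℕ) (κ h₀ : ℝ) {α : ℝ} (hα : 2 * (D : ℝ) < α)
    (R : ℝ) (p : ℕ) : ∃ (K : ℝ) (k : ℕ), 0 < K ∧
    ∀ (L : Lattice D κ) (M : Model L) (Φ : Interaction M),
      Φ.DecaysLike (fun r => h₀ / r ^ α) → Φ.IsTwoBody R →
      ∀ X Y : Finset L.site, X.Nonempty → Y.Nonempty → Disjoint X Y → X.card ≤ p →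
      ∀ A ∈ M.localAlg X, ∀ B ∈ M.localAlg Y, ∀ t : ℝ,
        ‖heisenberg Φ.hamiltonian A t * B - B * heisenberg Φ.hamiltonian A t‖ ≤
          K * Y.card * ‖A‖ * ‖B‖ * (1 + |t|) ^ k / regionDist X Y ^ α := by
  obtain ⟨K, k, hK, h⟩ := exists_lieb_robinson_two_body_of_nonneg D κ h₀ hα R p
  refine ⟨K, k, hK, fun L M Φ hΦ hR X Y hX hY hXY hp A hA B hB t => ?_⟩
  rcases le_total 0 t with ht | ht
  · rw [abs_of_nonneg ht]
    exact h L M Φ hΦ hR X Y hX hY hXY hp A hA B hB t ht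
  · rw [abs_of_nonpos ht]
    have h1 := h L M Φ.neg (fun i j hij => by simpa [Interaction.neg] using hΦ i j hij)
      (fun W hW => hR W (by simpa [Interaction.neg] using hW)) X Y hX hY hXY hp A hA B hB (-t)
      (neg_nonneg.2 ht)
    rwa [Interaction.neg_hamiltonian, ← heisenberg_neg_time, neg_neg] at h1

end

/-! ### Resolvent sums as Laplace transforms of phase sums -/

section Laplace

variable {J : Type*} [Fintype J] {c : J → ℂ} {w : J → ℝ}

/-- The rational function `∑ j, c j / (w j - z)`. -/
def resolventSum (c : J → ℂ) (w : J → ℝ) (z : ℂ) : ℂ := ∑ j, c j / (w j - z)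

/-- The almost periodic function `∑ j, c j exp(-i w j t)`. -/
def phaseSum (c : J → ℂ) (w : J → ℝ) (t : ℝ) : ℂ :=
  ∑ j, c j * Complex.exp (-(Complex.I * w j * t))

/-- Reflection of all frequencies exchanges the two half planes and reverses time; it reduces the
lower half plane to the upper one. -/
lemma resolventSum_neg (z : ℂ) :
    resolventSum c (fun j => -w j) (-z) = -resolventSum c w z := by
  unfold resolventSum
  rw [← Finset.sum_neg_distrib]
  refine Finset.sum_congr rfl fun j _ => ?_
  rw [← div_neg]
  congr 1
  push_cast
  ring

lemma phaseSum_neg (t : ℝ) : phaseSum c (fun j => -w j) t = phaseSum c w (-t) := by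
  unfold phaseSum
  refine Finset.sum_congr rfl fun j _ => ?_
  congr 2
  push_cast
  ring

/-- In the upper half plane, the resolvent sum is a Laplace transform of the phase sum. -/
lemma resolventSum_eq_integral {z : ℂ} (hz : 0 < z.im) :
    resolventSum c w z =
      Complex.I * ∫ t in Set.Ioi (0 : ℝ), phaseSum c w t * Complex.exp (Complex.I * z * t) := by
  have hre : ∀ j, (Complex.I * (z - w j)).re < 0 := fun j => by simp [hz]
  have e1 : ∀ t : ℝ, phaseSum c w t * Complex.exp (Complex.I * z * t) =
      ∑ j, c j * Complex.exp (Complex.I * (z - w j) * t) := by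
    intro t
    unfold phaseSum
    rw [Finset.sum_mul]
    refine Finset.sum_congr rfl fun j _ => ?_
    rw [mul_assoc, ← Complex.exp_add]
    congr 2
    ring
  simp_rw [e1]
  rw [MeasureTheory.integral_finsetSum]
  · rw [Finset.mul_sum]
    unfold resolventSum
    refine Finset.sum_congr rfl fun j _ => ?_
    rw [MeasureTheory.integral_const_mul, integral_exp_mul_complex_Ioi (hre j)]
    have h1 : z - w j ≠ 0 := fun h => by
      have := hre j
      rw [h] at this
      simp at this
    have h2 : (w j : ℂ) - z ≠ 0 := fun h => h1 (by rw [← neg_sub, h, neg_zero])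
    simp only [Complex.ofReal_zero, mul_zero, Complex.exp_zero]
    field_simp
    ring
  · intro j _
    exact (integrableOn_exp_mul_complex_Ioi (hre j) 0).const_mul _

lemma norm_resolventSum_le_integral {z : ℂ} (hz : 0 < z.im) {b : ℝ → ℝ}
    (hb : MeasureTheory.IntegrableOn b (Set.Ioi 0))
    (h : ∀ t : ℝ, 0 < t → ‖phaseSum c w t‖ * Real.exp (-z.im * t) ≤ b t) :
    ‖resolventSum c w z‖ ≤ ∫ t in Set.Ioi (0 : ℝ), b t := by
  rw [resolventSum_eq_integral hz, norm_mul, Complex.norm_I, one_mul]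
  refine MeasureTheory.norm_integral_le_of_norm_le hb ?_
  refine (MeasureTheory.ae_restrict_mem measurableSet_Ioi).mono fun t ht => ?_
  refine le_trans (le_of_eq ?_) (h t ht)
  rw [norm_mul, Complex.norm_exp]
  congr 2
  simp

/-- A bound in the upper half plane that depends only on a symmetric bound for the phase sum holds
in the lower half plane, too. -/
lemma norm_resolventSum_le_of_im_ne_zero {P : ℝ → Prop} {b β : ℝ → ℝ}
    (hup : ∀ w : J → ℝ, (∀ t, ‖phaseSum c w t‖ ≤ b |t|) → ∀ z : ℂ, 0 < z.im →
      P z.im → ‖resolventSum c w z‖ ≤ β z.im)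
    (h : ∀ t, ‖phaseSum c w t‖ ≤ b |t|) {z : ℂ} (hz : z.im ≠ 0) (hP : P |z.im|) :
    ‖resolventSum c w z‖ ≤ β |z.im| := by
  rcases hz.lt_or_gt with hz | hz
  · rw [abs_of_neg hz] at hP ⊢
    have h1 := hup (fun j => -w j) (fun t => by rw [phaseSum_neg, ← abs_neg]; exact h _) (-z)
      (by simpa using hz) (by simpa using hP)
    rwa [resolventSum_neg, norm_neg, Complex.neg_im] at h1
  · rw [abs_of_pos hz] at hP ⊢
    exact hup w h z hz hP

/-- Up to time `T` the front beats the damping: `exp(v (t - T) - y t) ≤ exp(-y T)` because `y ≤ v`,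
and integration gives `T`. After `T` the trivial bound is integrated against `exp(-y t)`, which
gives `1 / y`. -/
lemma norm_resolventSum_le_of_front {B v T : ℝ} (hB : 0 ≤ B) (hT : 0 ≤ T)
    (h : ∀ t, ‖phaseSum c w t‖ ≤ B * min 1 (Real.exp (v * (|t| - T)))) {z : ℂ}
    (hz : z.im ≠ 0) (hzv : |z.im| ≤ v) :
    ‖resolventSum c w z‖ ≤ B * Real.exp (-|z.im| * T) * (T + 1 / |z.im|) := by
  refine norm_resolventSum_le_of_im_ne_zero (P := fun y => y ≤ v)
    (b := fun t => B * min 1 (Real.exp (v * (t - T))))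
    (β := fun y => B * Real.exp (-y * T) * (T + 1 / y)) ?_ h hz hzv
  intro w h z hz hzv
  set y := z.im with hy
  have i1 : MeasureTheory.Integrable
      ((Set.Ioc 0 T).indicator fun _ : ℝ => B * Real.exp (-y * T)) :=
    (MeasureTheory.integrable_indicator_iff measurableSet_Ioc).2
      (MeasureTheory.integrableOn_const (by simp))
  have i2 : MeasureTheory.Integrable
      ((Set.Ioi T).indicator fun t : ℝ => B * Real.exp (-y * t)) :=
    (MeasureTheory.integrable_indicator_iff measurableSet_Ioi).2
      ((integrableOn_exp_mul_Ioi (neg_lt_zero.2 hz) T).const_mul _)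
  refine (norm_resolventSum_le_integral hz (i1.add i2).integrableOn ?_).trans ?_
  · intro t ht
    have h1 := h t
    rw [abs_of_pos ht] at h1
    by_cases htT : t ≤ T
    · have e1 : t ∈ Set.Ioc 0 T := ⟨ht, htT⟩
      have e2 : t ∉ Set.Ioi T := fun h => (not_lt.2 htT) h
      simp only [Pi.add_apply, Set.indicator_of_mem e1, Set.indicator_of_notMem e2, add_zero]
      calc _ ≤ B * Real.exp (v * (t - T)) * Real.exp (-y * t) := by
            gcongr
            refine h1.trans ?_
            gcongr
            exact min_le_right _ _
        _ ≤ _ := by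
            rw [mul_assoc, ← Real.exp_add]
            gcongr
            nlinarith
    · have e1 : t ∉ Set.Ioc 0 T := fun h => htT h.2
      have e2 : t ∈ Set.Ioi T := not_le.1 htT
      simp only [Pi.add_apply, Set.indicator_of_mem e2, Set.indicator_of_notMem e1, zero_add]
      gcongr
      refine h1.trans ?_
      nlinarith [min_le_left 1 (Real.exp (v * (t - T)))]
  · rw [MeasureTheory.integral_add' i1.integrableOn i2.integrableOn,
      MeasureTheory.setIntegral_indicator measurableSet_Ioc,
      MeasureTheory.setIntegral_indicator measurableSet_Ioi]
    have e1 : Set.Ioi 0 ∩ Set.Ioc 0 T = Set.Ioc 0 T :=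
      Set.inter_eq_right.2 fun t ht => ht.1
    have e2 : Set.Ioi 0 ∩ Set.Ioi T = Set.Ioi T :=
      Set.inter_eq_right.2 fun t ht => lt_of_le_of_lt hT ht
    rw [e1, e2, MeasureTheory.setIntegral_const, MeasureTheory.integral_const_mul,
      integral_exp_mul_Ioi (neg_lt_zero.2 hz)]
    simp only [MeasureTheory.measureReal_def, Real.volume_Ioc, sub_zero, smul_eq_mul]
    rw [ENNReal.toReal_ofReal hT]
    refine le_of_eq ?_
    field_simp

/-- Half of the damping absorbs the polynomial through `x ^ m / m! ≤ exp x` at `x = y (1 + t) / 2`;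
the other half makes the integral converge. -/
lemma norm_resolventSum_le_of_pow {B : ℝ} {m : ℕ} (hB : 0 ≤ B)
    (h : ∀ t, ‖phaseSum c w t‖ ≤ B * (1 + |t|) ^ m) {z : ℂ} (hz : z.im ≠ 0) :
    ‖resolventSum c w z‖ ≤ B * m.factorial * (2 / |z.im|) ^ (m + 1) * Real.exp (|z.im| / 2) := by
  refine norm_resolventSum_le_of_im_ne_zero (P := fun _ => True)
    (b := fun t => B * (1 + t) ^ m)
    (β := fun y => B * m.factorial * (2 / y) ^ (m + 1) * Real.exp (y / 2)) ?_ h hz trivial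
  intro w h z hz hP
  set y := z.im with hy
  have hb : MeasureTheory.IntegrableOn
      (fun t : ℝ => B * m.factorial * (2 / y) ^ m * Real.exp (y / 2) * Real.exp (-(y / 2) * t))
      (Set.Ioi 0) := (integrableOn_exp_mul_Ioi (by linarith) 0).const_mul _
  refine (norm_resolventSum_le_integral hz hb ?_).trans ?_
  · intro t ht
    have h1 := h t
    rw [abs_of_pos ht] at h1
    have h2 := Real.pow_div_factorial_le_exp (y / 2 * (1 + t)) (by positivity) m
    rw [div_le_iff₀ (by positivity), mul_pow] at h2
    have h3 : (1 + t) ^ m ≤ m.factorial * (2 / y) ^ m * Real.exp (y / 2 * (1 + t)) := by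
      have e : (2 / y) ^ m * (y / 2) ^ m = 1 := by
        rw [← mul_pow, div_mul_div_comm, mul_comm 2 y, div_self (by positivity), one_pow]
      calc (1 + t) ^ m = (2 / y) ^ m * ((y / 2) ^ m * (1 + t) ^ m) := by
            rw [← mul_assoc, e, one_mul]
        _ ≤ (2 / y) ^ m * (Real.exp (y / 2 * (1 + t)) * m.factorial) := by gcongr
        _ = _ := by ring
    calc _ ≤ B * (m.factorial * (2 / y) ^ m * Real.exp (y / 2 * (1 + t))) * Real.exp (-y * t) := by
          gcongr
          exact h1.trans (by gcongr)
      _ = B * m.factorial * (2 / y) ^ m * Real.exp (y / 2 * (1 + t) + -y * t) := by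
          rw [Real.exp_add]; ring
      _ = B * m.factorial * (2 / y) ^ m * Real.exp (y / 2 + -(y / 2) * t) := by
          congr 2; ring
      _ = _ := by rw [Real.exp_add]; ring
  · rw [MeasureTheory.integral_const_mul, integral_exp_mul_Ioi (by linarith)]
    refine le_of_eq ?_
    simp only [mul_zero, Real.exp_zero]
    rw [pow_succ]
    field_simp

lemma differentiableAt_resolventSum {z : ℂ} (hz : ∀ j, z ≠ w j) :
    DifferentiableAt ℂ (resolventSum c w) z := by
  unfold resolventSum
  refine DifferentiableAt.fun_sum fun j _ => ?_
  exact (differentiableAt_const _).div ((differentiableAt_const _).sub differentiableAt_id)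
    (sub_ne_zero.2 (hz j).symm)

/-- On the circle `ρ² = q q̄`, so the expression equals `q (q̄ - q) / ρ²`. This factor cancels an
inverse power of `|Im q|` on the circle and equals 1 at the center. -/
lemma norm_one_sub_sq_div {q : ℂ} {ρ : ℝ} (hρ : 0 < ρ) (hq : ‖q‖ = ρ) :
    ‖1 - q ^ 2 / (ρ : ℂ) ^ 2‖ = 2 * |q.im| / ρ := by
  have hρ' : (ρ : ℂ) ≠ 0 := by exact_mod_cast hρ.ne'
  have h1 : (ρ : ℂ) ^ 2 = q * (starRingEnd ℂ) q := by
    rw [Complex.mul_conj, Complex.normSq_eq_norm_sq, hq]; push_cast; ring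
  have h2 : 1 - q ^ 2 / (ρ : ℂ) ^ 2 = q * ((starRingEnd ℂ) q - q) / (ρ : ℂ) ^ 2 := by
    rw [eq_div_iff (pow_ne_zero 2 hρ'), sub_mul, div_mul_cancel₀ _ (pow_ne_zero 2 hρ'), h1]
    ring
  have h3 : (starRingEnd ℂ) q - q = (-2 * q.im : ℝ) * Complex.I := by
    apply Complex.ext <;> simp; ring
  rw [h2, h3, norm_div, norm_mul, norm_mul, hq, norm_pow, Complex.norm_real, Complex.norm_real,
    Complex.norm_I, Real.norm_eq_abs, Real.norm_eq_abs, abs_of_pos hρ, abs_mul]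
  norm_num
  field_simp

/-- A polynomially bounded phase sum with spectral gap has a bounded resolvent sum at zero. -/
theorem norm_resolventSum_zero_le_of_pow {B Δ : ℝ} {m : ℕ} (hB : 0 ≤ B) (hΔ : 0 < Δ)
    (hw : ∀ j, Δ ≤ |w j|) (h : ∀ t, ‖phaseSum c w t‖ ≤ B * (1 + |t|) ^ m) :
    ‖resolventSum c w 0‖ ≤ B * (m.factorial * (8 / Δ) ^ (m + 1) * Real.exp (Δ / 4)) := by
  set δ := Δ / 2 with hδ
  have hδ0 : 0 < δ := by positivity
  -- The circle of radius `Δ / 2` stays inside the gap, where the resolvent sum is holomorphic. The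
  -- power `m + 1` matches the singularity of `norm_resolventSum_le_of_pow` at the real axis.
  set f : ℂ → ℂ := fun z => resolventSum c w z * (1 - z ^ 2 / (δ : ℂ) ^ 2) ^ (m + 1) with hf
  have hd : DifferentiableOn ℂ f (Metric.closedBall 0 δ) := by
    intro z hz
    refine DifferentiableAt.differentiableWithinAt ?_
    refine (differentiableAt_resolventSum fun j hj => ?_).mul (by fun_prop)
    rw [mem_closedBall_zero_iff, hj, Complex.norm_real, Real.norm_eq_abs] at hz
    linarith [hw j]
  have hfr : ∀ z ∈ frontier (Metric.ball (0 : ℂ) δ),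
      ‖f z‖ ≤ B * (m.factorial * (8 / Δ) ^ (m + 1) * Real.exp (Δ / 4)) := by
    intro z hz
    rw [frontier_ball _ hδ0.ne', mem_sphere_zero_iff_norm] at hz
    simp only [hf]
    rw [norm_mul, norm_pow, norm_one_sub_sq_div hδ0 hz]
    by_cases hy : z.im = 0
    · simp only [hy, abs_zero, mul_zero, zero_div, ne_eq, Nat.add_eq_zero_iff, one_ne_zero,
        and_false, not_false_eq_true, zero_pow]
      positivity
    · have hy0 : 0 < |z.im| := abs_pos.2 hy
      have hyδ : |z.im| ≤ δ := (Complex.abs_im_le_norm z).trans hz.le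
      calc _ ≤ (B * m.factorial * (2 / |z.im|) ^ (m + 1) * Real.exp (|z.im| / 2)) *
            (2 * |z.im| / δ) ^ (m + 1) := by
            gcongr
            exact norm_resolventSum_le_of_pow hB h hy
        _ = B * (m.factorial * ((2 / |z.im|) * (2 * |z.im| / δ)) ^ (m + 1) *
            Real.exp (|z.im| / 2)) := by rw [mul_pow]; ring
        _ = B * (m.factorial * (8 / Δ) ^ (m + 1) * Real.exp (|z.im| / 2)) := by
            have e : 2 / |z.im| * (2 * |z.im| / δ) = 8 / Δ := by rw [hδ]; field_simp; norm_num
            rw [e]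
        _ ≤ _ := by
            have : |z.im| / 2 ≤ Δ / 4 := by linarith
            gcongr _ * (_ * Real.exp ?_)
  have h1 := Complex.norm_le_of_forall_mem_frontier_norm_le Metric.isBounded_ball
    ⟨hd.mono Metric.ball_subset_closedBall,
      by rw [closure_ball _ hδ0.ne']; exact hd.continuousOn⟩ hfr
    (subset_closure (Metric.mem_ball_self hδ0))
  simpa [hf] using h1

end Laplace

/-! ### Conformal map of the slit strip and its harmonic measure -/

section SlitStrip

open ComplexConjugate

variable {θ₀ : ℝ} {q : ℂ}

lemma one_add_mem_slitPlane {w : ℂ} (h : ‖w‖ ≤ 1) (h0 : 1 + w ≠ 0) : 1 + w ∈ Complex.slitPlane := by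
  have h1 : -1 ≤ w.re := (abs_le.1 ((Complex.abs_re_le_norm w).trans h)).1
  rw [Complex.mem_slitPlane_iff]
  by_contra! hc
  refine h0 (Complex.ext ?_ ?_)
  · have := hc.1
    simp only [Complex.add_re, Complex.one_re, Complex.zero_re] at this ⊢
    linarith
  · simpa using hc.2

/-- Mean value inequality along a radius: the derivative of the logarithm is at most `1 / η` there.
The radius may end on the unit circle, as the argument stays away from zero. -/
lemma norm_log_one_add_sub_le {b : ℂ} {η ρ : ℝ} (hb : ‖b‖ = 1) (hη : 0 < η) (hρ : ρ ∈ Set.Icc 0 1)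
    (h : ∀ r ∈ Set.Icc (0 : ℝ) 1, η ≤ ‖1 + r * b‖) :
    ‖Complex.log (1 + b) - Complex.log (1 + ρ * b)‖ ≤ (1 - ρ) / η := by
  have hder : ∀ r ∈ Set.Icc (0 : ℝ) 1,
      HasDerivWithinAt (fun r : ℝ => Complex.log (1 + r * b)) (b / (1 + r * b)) (Set.Icc 0 1) r := by
    intro r hr
    have h1 : (1 : ℂ) + r * b ∈ Complex.slitPlane := by
      refine one_add_mem_slitPlane ?_ (norm_pos_iff.1 (hη.trans_le (h r hr)))
      rw [norm_mul, hb, mul_one, Complex.norm_real, Real.norm_eq_abs, abs_of_nonneg hr.1]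
      exact hr.2
    have h2 : HasDerivAt (fun r : ℝ => (1 : ℂ) + r * b) b r := by
      simpa using (Complex.ofRealCLM.hasDerivAt (x := r)).mul_const b |>.const_add (1 : ℂ)
    exact (h2.clog_real h1).hasDerivWithinAt
  have h3 := Convex.norm_image_sub_le_of_norm_hasDerivWithin_le (C := 1 / η) hder
    (fun r hr => by
      rw [norm_div, hb]
      exact one_div_le_one_div_of_le hη (h r hr)) (convex_Icc 0 1) hρ
    (Set.right_mem_Icc.2 zero_le_one)
  simp only [Complex.ofReal_one, one_mul] at h3
  rw [Real.norm_eq_abs, abs_of_nonneg (by linarith [hρ.2])] at h3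
  rwa [one_div_mul_eq_div] at h3

/-- Half-angle formula: `1 + exp(i φ) = 2 cos(φ/2) exp(i φ/2)`, with positive modulus for `|φ| < π`.
-/
lemma log_one_add_exp_im {φ : ℝ} (h : φ ∈ Set.Ioo (-Real.pi) Real.pi) :
    (Complex.log (1 + Complex.exp (φ * Complex.I))).im = φ / 2 := by
  have hc : 0 < 2 * Real.cos (φ / 2) := by
    have := Real.cos_pos_of_mem_Ioo (x := φ / 2) ⟨by linarith [h.1], by linarith [h.2]⟩
    linarith
  have e : 1 + Complex.exp (φ * Complex.I) =
      (2 * Real.cos (φ / 2) : ℝ) * (Complex.cos (φ / 2 : ℝ) + Complex.sin (φ / 2 : ℝ) * Complex.I) := by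
    rw [← Complex.exp_mul_I]
    push_cast
    rw [Complex.cos, mul_div_cancel₀ _ (two_ne_zero), add_mul, ← Complex.exp_add, ← Complex.exp_add]
    rw [add_comm]
    congr 1
    · congr 1; ring
    · rw [← Complex.exp_zero]; congr 1; ring
  rw [Complex.log_im, e, Complex.arg_mul_cos_add_sin_mul_I hc]
  exact ⟨by linarith [h.1, Real.pi_pos], by linarith [h.2, Real.pi_pos]⟩

/-- Up to the factor `v / π`, a conformal map of the unit disc onto the strip `|Im z| < v` without
two half lines on the real axis. -/
def stripMap (θ₀ : ℝ) (q : ℂ) : ℂ :=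
  (Complex.log (1 + q * Complex.exp (θ₀ * Complex.I)) -
    Complex.log (1 - q * Complex.exp (θ₀ * Complex.I))) +
  (Complex.log (1 + q * Complex.exp (-θ₀ * Complex.I)) -
    Complex.log (1 - q * Complex.exp (-θ₀ * Complex.I)))

/-- A holomorphic function on the unit disc whose real part is the harmonic measure of the part of
the boundary that `stripMap` sends to the edges of the strip. -/
def edgeMeasure (θ₀ : ℝ) (q : ℂ) : ℂ :=
  Complex.I / Real.pi * ((Complex.log (1 + q * Complex.exp (-θ₀ * Complex.I)) -
    Complex.log (1 - q * Complex.exp (θ₀ * Complex.I))) -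
  (Complex.log (1 + q * Complex.exp (θ₀ * Complex.I)) -
    Complex.log (1 - q * Complex.exp (-θ₀ * Complex.I)))) + (1 - 2 * θ₀ / Real.pi : ℝ)

lemma stripMap_neg (θ₀ : ℝ) (q : ℂ) : stripMap θ₀ (-q) = -stripMap θ₀ q := by
  unfold stripMap
  simp only [neg_mul, sub_neg_eq_add, ← sub_eq_add_neg]
  ring

lemma edgeMeasure_neg (θ₀ : ℝ) (q : ℂ) : edgeMeasure θ₀ (-q) = edgeMeasure θ₀ q := by
  unfold edgeMeasure
  simp only [neg_mul, sub_neg_eq_add, ← sub_eq_add_neg]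
  ring

lemma norm_mul_exp (q : ℂ) (θ : ℝ) : ‖q * Complex.exp (θ * Complex.I)‖ = ‖q‖ := by
  rw [norm_mul, Complex.norm_exp_ofReal_mul_I, mul_one]

lemma norm_mul_exp_neg (q : ℂ) (θ : ℝ) : ‖q * Complex.exp (-θ * Complex.I)‖ = ‖q‖ := by
  rw [← Complex.ofReal_neg, norm_mul_exp]

lemma one_add_slit (hq : ‖q‖ < 1) : 1 + q ∈ Complex.slitPlane :=
  Complex.mem_slitPlane_of_norm_lt_one hq

lemma one_sub_slit (hq : ‖q‖ < 1) : 1 - q ∈ Complex.slitPlane := by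
  rw [sub_eq_add_neg]
  exact Complex.mem_slitPlane_of_norm_lt_one (by rwa [norm_neg])

lemma differentiableAt_stripMap (hq : ‖q‖ < 1) : DifferentiableAt ℂ (stripMap θ₀) q := by
  have h1 := one_add_slit ((norm_mul_exp q θ₀).trans_lt hq)
  have h2 := one_sub_slit ((norm_mul_exp q θ₀).trans_lt hq)
  have h3 := one_add_slit ((norm_mul_exp_neg q θ₀).trans_lt hq)
  have h4 := one_sub_slit ((norm_mul_exp_neg q θ₀).trans_lt hq)
  unfold stripMap
  fun_prop (disch := assumption)

lemma differentiableAt_edgeMeasure (hq : ‖q‖ < 1) : DifferentiableAt ℂ (edgeMeasure θ₀) q := by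
  have h1 := one_add_slit ((norm_mul_exp q θ₀).trans_lt hq)
  have h2 := one_sub_slit ((norm_mul_exp q θ₀).trans_lt hq)
  have h3 := one_add_slit ((norm_mul_exp_neg q θ₀).trans_lt hq)
  have h4 := one_sub_slit ((norm_mul_exp_neg q θ₀).trans_lt hq)
  unfold edgeMeasure
  fun_prop (disch := assumption)

/-- The map `(1 + w) / (1 - w)` sends the disc to the right half plane, so the cosine of the
difference of arguments is positive. Each argument is below `π/2` in modulus, so the difference is
below `π` and no other branch is possible. -/
lemma abs_log_one_add_sub_log_one_sub_im_lt {w : ℂ} (h : ‖w‖ < 1) :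
    |(Complex.log (1 + w) - Complex.log (1 - w)).im| < Real.pi / 2 := by
  have h1 := one_add_slit h
  have h2 := one_sub_slit h
  have hre := abs_lt.1 ((Complex.abs_re_le_norm w).trans_lt h)
  have a1 := Complex.abs_arg_lt_pi_div_two_iff.2 (Or.inl (a := 0 < (1 + w).re)
    (by simp only [Complex.add_re, Complex.one_re]; linarith))
  have a2 := Complex.abs_arg_lt_pi_div_two_iff.2 (Or.inl (a := 0 < (1 - w).re)
    (by simp only [Complex.sub_re, Complex.one_re]; linarith))
  rw [← Complex.log_im] at a1 a2
  set x := Complex.log (1 + w) - Complex.log (1 - w) with hx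
  have hxpi : |x.im| < Real.pi := by
    rw [hx, Complex.sub_im]
    rw [abs_lt] at *
    constructor <;> linarith
  have hcos : 0 < Real.cos x.im := by
    have e : Complex.exp x = (1 + w) / (1 - w) := by
      rw [hx, Complex.exp_sub, Complex.exp_log (Complex.slitPlane_ne_zero h1),
        Complex.exp_log (Complex.slitPlane_ne_zero h2)]
    have e2 : 0 < (Complex.exp x).re := by
      rw [e, Complex.div_re, ← add_div]
      refine div_pos ?_ (Complex.normSq_pos.2 (Complex.slitPlane_ne_zero h2))
      have : w.re ^ 2 + w.im ^ 2 < 1 := by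
        have := Complex.sq_norm w
        rw [Complex.normSq_apply] at this
        nlinarith [norm_nonneg w]
      simp
      nlinarith
    rw [Complex.exp_re] at e2
    exact pos_of_mul_pos_right e2 (Real.exp_pos _).le
  by_contra! hc
  have := Real.cos_nonpos_of_pi_div_two_le_of_le hc (by linarith [Real.pi_pos])
  rw [Real.cos_abs] at this
  linarith

lemma abs_stripMap_im_lt (hq : ‖q‖ < 1) : |(stripMap θ₀ q).im| < Real.pi := by
  have h1 := abs_log_one_add_sub_log_one_sub_im_lt ((norm_mul_exp q θ₀).trans_lt hq)
  have h2 := abs_log_one_add_sub_log_one_sub_im_lt ((norm_mul_exp_neg q θ₀).trans_lt hq)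
  unfold stripMap
  rw [Complex.add_im]
  exact (abs_add_le _ _).trans_lt (by linarith)

lemma exp_mul_exp_neg (θ₀ : ℝ) :
    Complex.exp (θ₀ * Complex.I) * Complex.exp (-θ₀ * Complex.I) = 1 := by
  rw [← Complex.exp_add]; simp

lemma exp_add_exp_neg (θ₀ : ℝ) :
    Complex.exp (θ₀ * Complex.I) + Complex.exp (-θ₀ * Complex.I) = 2 * Real.cos θ₀ := by
  rw [Complex.ofReal_cos, Complex.cos]; ring

lemma exp_stripMap (hq : ‖q‖ < 1) :
    1 - 2 * Real.cos θ₀ * q + q ^ 2 ≠ 0 ∧ Complex.exp (stripMap θ₀ q) =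
      (1 + 2 * Real.cos θ₀ * q + q ^ 2) / (1 - 2 * Real.cos θ₀ * q + q ^ 2) := by
  have h1 := Complex.slitPlane_ne_zero (one_add_slit ((norm_mul_exp q θ₀).trans_lt hq))
  have h2 := Complex.slitPlane_ne_zero (one_sub_slit ((norm_mul_exp q θ₀).trans_lt hq))
  have h3 := Complex.slitPlane_ne_zero (one_add_slit ((norm_mul_exp_neg q θ₀).trans_lt hq))
  have h4 := Complex.slitPlane_ne_zero (one_sub_slit ((norm_mul_exp_neg q θ₀).trans_lt hq))
  have e1 := exp_mul_exp_neg θ₀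
  have e2 := exp_add_exp_neg θ₀
  have eN : 1 + 2 * Real.cos θ₀ * q + q ^ 2 = (1 + q * Complex.exp (θ₀ * Complex.I)) *
      (1 + q * Complex.exp (-θ₀ * Complex.I)) := by
    rw [← e2]; linear_combination -q ^ 2 * e1
  have eD : 1 - 2 * Real.cos θ₀ * q + q ^ 2 = (1 - q * Complex.exp (θ₀ * Complex.I)) *
      (1 - q * Complex.exp (-θ₀ * Complex.I)) := by
    rw [← e2]; linear_combination -q ^ 2 * e1
  refine ⟨by rw [eD]; exact mul_ne_zero h2 h4, ?_⟩
  rw [eN, eD]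
  unfold stripMap
  rw [Complex.exp_add, Complex.exp_sub, Complex.exp_sub, Complex.exp_log h1, Complex.exp_log h2,
    Complex.exp_log h3, Complex.exp_log h4, div_mul_div_comm]

/-- With numerator `N` and denominator `E` of `exp_stripMap`, both sides are the imaginary part of
`N Ē`, and `m = ‖N‖ ‖E‖`; each norm is at most `1 + 2 + 1`. It shows how fast the image leaves the
real axis. -/
lemma sin_stripMap_im (hq : ‖q‖ < 1) :
    ∃ m : ℝ, 0 < m ∧ m ≤ 16 ∧
      m * Real.sin (stripMap θ₀ q).im = 4 * Real.cos θ₀ * q.im * (1 - ‖q‖ ^ 2) := by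
  obtain ⟨hD, hE⟩ := exp_stripMap (θ₀ := θ₀) hq
  set N := 1 + 2 * Real.cos θ₀ * q + q ^ 2 with hN
  set E := 1 - 2 * Real.cos θ₀ * q + q ^ 2 with hE'
  have hN0 : N ≠ 0 := fun h => by rw [h, zero_div] at hE; exact Complex.exp_ne_zero _ hE
  have hq2 : ‖q ^ 2‖ ≤ 1 := by rw [norm_pow]; exact pow_le_one₀ (norm_nonneg _) hq.le
  have hc2 : ‖2 * (Real.cos θ₀ : ℂ) * q‖ ≤ 2 := by
    rw [norm_mul, norm_mul, Complex.norm_real, Complex.norm_ofNat, Real.norm_eq_abs]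
    nlinarith [Real.abs_cos_le_one θ₀, abs_nonneg (Real.cos θ₀), norm_nonneg q]
  have hN4 : ‖N‖ ≤ 4 := by
    refine (norm_add_le _ _).trans ?_
    have := norm_add_le (1 : ℂ) (2 * Real.cos θ₀ * q)
    rw [norm_one] at this
    linarith
  have hE4 : ‖E‖ ≤ 4 := by
    refine (norm_add_le _ _).trans ?_
    have := norm_sub_le (1 : ℂ) (2 * Real.cos θ₀ * q)
    rw [norm_one] at this
    linarith
  have hNp := norm_pos_iff.2 hN0
  have hEp := norm_pos_iff.2 hD
  refine ⟨‖N‖ * ‖E‖, by positivity, by nlinarith, ?_⟩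
  have h1 : Real.exp (stripMap θ₀ q).re = ‖N‖ / ‖E‖ := by
    rw [← Complex.norm_exp, hE, norm_div]
  have h2 : Real.exp (stripMap θ₀ q).re * Real.sin (stripMap θ₀ q).im =
      (N.im * E.re - N.re * E.im) / ‖E‖ ^ 2 := by
    rw [← Complex.exp_im, hE, Complex.div_im, Complex.sq_norm]; ring
  rw [h1, div_mul_eq_mul_div, div_eq_div_iff hEp.ne' (by positivity)] at h2
  have h3 : ‖N‖ * ‖E‖ * Real.sin (stripMap θ₀ q).im = N.im * E.re - N.re * E.im := by
    have : (‖N‖ * ‖E‖ * Real.sin (stripMap θ₀ q).im - (N.im * E.re - N.re * E.im)) * ‖E‖ = 0 := by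
      linear_combination h2
    rcases mul_eq_zero.1 this with h | h
    · linarith
    · exact absurd h hEp.ne'
  rw [h3, Complex.sq_norm, Complex.normSq_apply, hN, hE']
  generalize Real.cos θ₀ = k
  simp [pow_two]
  ring

lemma le_stripMap_im (hθ : 0 ≤ Real.cos θ₀) (hq : ‖q‖ < 1) (h : 0 ≤ q.im) :
    Real.cos θ₀ * q.im * (1 - ‖q‖ ^ 2) / 4 ≤ (stripMap θ₀ q).im := by
  obtain ⟨m, hm0, hm, h1⟩ := sin_stripMap_im (θ₀ := θ₀) hq
  have hq2 : 0 ≤ 1 - ‖q‖ ^ 2 := by nlinarith [norm_nonneg q]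
  have h2 : 0 ≤ Real.cos θ₀ * q.im * (1 - ‖q‖ ^ 2) := by positivity
  have h3 := abs_lt.1 (abs_stripMap_im_lt (θ₀ := θ₀) hq)
  set s := (stripMap θ₀ q).im with hs
  have hsin : 0 ≤ Real.sin s := by
    by_contra! hc
    nlinarith
  have h4 : Real.cos θ₀ * q.im * (1 - ‖q‖ ^ 2) / 4 ≤ Real.sin s := by nlinarith
  rcases le_or_gt 0 s with h5 | h5
  · exact h4.trans (Real.sin_le h5)
  · have := Real.sin_neg_of_neg_of_neg_pi_lt h5 h3.1
    linarith

lemma le_abs_stripMap_im (hθ : 0 ≤ Real.cos θ₀) (hq : ‖q‖ < 1) :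
    Real.cos θ₀ * |q.im| * (1 - ‖q‖ ^ 2) / 4 ≤ |(stripMap θ₀ q).im| := by
  rcases le_total 0 q.im with h | h
  · rw [abs_of_nonneg h]
    exact (le_stripMap_im hθ hq h).trans (le_abs_self _)
  · rw [abs_of_nonpos h]
    have h1 := le_stripMap_im (θ₀ := θ₀) (q := -q) hθ (by rwa [norm_neg]) (by simpa using h)
    rw [norm_neg, stripMap_neg, Complex.neg_im, Complex.neg_im] at h1
    exact h1.trans (neg_le_abs _)

/-- The image meets the real axis only strictly between the tips of the slits. A real value forces
`q` to be real, and for real `x` the cross-multiplied difference of the two sides is `2 k (1 - x)²`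
with `k = cos θ₀`. -/
lemma abs_stripMap_re_lt (hθ : 0 < Real.cos θ₀) (hθ' : Real.cos θ₀ < 1) (hq : ‖q‖ < 1)
    (h : (stripMap θ₀ q).im = 0) :
    Real.exp |(stripMap θ₀ q).re| < (1 + Real.cos θ₀) / (1 - Real.cos θ₀) := by
  have key : ∀ q : ℂ, ‖q‖ < 1 → (stripMap θ₀ q).im = 0 →
      Real.exp (stripMap θ₀ q).re < (1 + Real.cos θ₀) / (1 - Real.cos θ₀) := by
    intro q hq h
    have hq2 : 0 < 1 - ‖q‖ ^ 2 := by nlinarith [norm_nonneg q]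
    have him : q.im = 0 := by
      have h1 := le_abs_stripMap_im hθ.le hq
      rw [h, abs_zero] at h1
      have : |q.im| ≤ 0 := by
        by_contra! hc
        have : 0 < Real.cos θ₀ * |q.im| * (1 - ‖q‖ ^ 2) / 4 := by positivity
        linarith
      simpa using this
    obtain ⟨x, rfl⟩ : ∃ x : ℝ, q = x := ⟨q.re, Complex.ext rfl (by simpa using him)⟩
    rw [Complex.norm_real, Real.norm_eq_abs] at hq
    obtain ⟨hx1, hx2⟩ := abs_lt.1 hq
    set k := Real.cos θ₀
    obtain ⟨_, hE⟩ := exp_stripMap (θ₀ := θ₀) (q := x) (by simpa using hq)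
    have e1 : stripMap θ₀ x = (stripMap θ₀ x).re := Complex.ext rfl (by simpa using h)
    rw [e1] at hE
    have hE2 : Real.exp (stripMap θ₀ x).re = (1 + 2 * k * x + x ^ 2) / (1 - 2 * k * x + x ^ 2) := by
      exact_mod_cast hE
    have hpos : 0 < 1 - 2 * k * x + x ^ 2 := by nlinarith [sq_nonneg (x - k)]
    rw [hE2, div_lt_div_iff₀ hpos (by linarith)]
    nlinarith [mul_pos hθ (pow_pos (sub_pos.2 hx2) 2)]
  rcases abs_cases (stripMap θ₀ q).re with ⟨h1, _⟩ | ⟨h1, _⟩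
  · rw [h1]; exact key q hq h
  · rw [h1]
    have := key (-q) (by rwa [norm_neg]) (by rw [stripMap_neg, Complex.neg_im, h, neg_zero])
    rwa [stripMap_neg, Complex.neg_re] at this

/-- On the boundary the harmonic measure should equal `|Im| / π`: 1 on the edges and 0 on the slits.
This form isolates the correction, which involves only the two logarithms that are regular on the
closed upper half disc. -/
lemma edgeMeasure_re (q : ℂ) : (edgeMeasure θ₀ q).re = (stripMap θ₀ q).im / Real.pi +
    2 / Real.pi * (Real.pi / 2 - θ₀ - ((Complex.log (1 + q * Complex.exp (-θ₀ * Complex.I))).im -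
      (Complex.log (1 - q * Complex.exp (θ₀ * Complex.I))).im)) := by
  have hpi := Real.pi_ne_zero
  unfold edgeMeasure stripMap
  rw [Complex.add_re, Complex.ofReal_re, div_mul_eq_mul_div, Complex.div_ofReal_re, Complex.I_mul_re]
  simp only [Complex.sub_im, Complex.add_im]
  field_simp
  ring

/-- On the upper unit half circle the two arguments in `edgeMeasure_re` are `(φ - θ₀)/2` and `(φ - π
+ θ₀)/2`, so the correction vanishes. The singularities of both logarithms lie at height `-sin θ₀`;
moving inwards by `1 - ‖q‖` thus changes each by at most `(1 - ‖q‖) / sin θ₀`. -/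
lemma edgeMeasure_re_le_of_im_nonneg (hθ : θ₀ ∈ Set.Ioo 0 (Real.pi / 2)) (hq : ‖q‖ < 1)
    (h : 0 ≤ q.im) :
    (edgeMeasure θ₀ q).re ≤ (stripMap θ₀ q).im / Real.pi +
      4 / (Real.pi * Real.sin θ₀) * (1 - ‖q‖) := by
  have hpi := Real.pi_pos
  have hs : 0 < Real.sin θ₀ := Real.sin_pos_of_pos_of_lt_pi hθ.1 (by linarith [hθ.2])
  set ρ := ‖q‖ with hρ
  set φ := Complex.arg q with hφ
  have hq' : q = ρ * Complex.exp (φ * Complex.I) := (Complex.norm_mul_exp_arg_mul_I q).symm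
  have hφ0 : 0 ≤ φ := Complex.arg_nonneg_iff.2 h
  have hφ1 : φ ≤ Real.pi := Complex.arg_le_pi q
  have hρ1 : ρ ∈ Set.Icc (0 : ℝ) 1 := ⟨norm_nonneg q, hq.le⟩
  have hsφ : 0 ≤ Real.sin φ := Real.sin_nonneg_of_nonneg_of_le_pi hφ0 hφ1
  have low : ∀ (r φ' : ℝ), r ∈ Set.Icc (0 : ℝ) 1 → ∀ e : ℝ,
      Real.sin θ₀ ≤ |(Complex.exp (e * Complex.I) + r * Complex.exp (φ' * Complex.I)).im| →
      Real.sin θ₀ ≤ ‖1 + r * Complex.exp ((φ' - e : ℝ) * Complex.I)‖ := by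
    intro r φ' _ e he
    have e1 : Complex.exp (e * Complex.I) + r * Complex.exp (φ' * Complex.I) =
        Complex.exp (e * Complex.I) * (1 + r * Complex.exp ((φ' - e : ℝ) * Complex.I)) := by
      rw [mul_add, mul_one, mul_left_comm, ← Complex.exp_add]
      congr 3; push_cast; ring
    have e2 := (Complex.abs_im_le_norm _).trans_eq (congrArg norm e1)
    rw [norm_mul, Complex.norm_exp_ofReal_mul_I, one_mul] at e2
    exact he.trans e2
  have b1 := norm_log_one_add_sub_le (b := Complex.exp ((φ - θ₀ : ℝ) * Complex.I))
    (Complex.norm_exp_ofReal_mul_I _) hs hρ1 (fun r hr => low r φ hr θ₀ (by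
      rw [Complex.add_im, Complex.exp_ofReal_mul_I_im,
        Complex.im_ofReal_mul, Complex.exp_ofReal_mul_I_im, abs_of_nonneg]
      · nlinarith [hr.1, mul_nonneg hr.1 hsφ]
      · nlinarith [hr.1, mul_nonneg hr.1 hsφ]))
  have b2 := norm_log_one_add_sub_le (b := Complex.exp ((φ - (Real.pi - θ₀) : ℝ) * Complex.I))
    (Complex.norm_exp_ofReal_mul_I _) hs hρ1 (fun r hr => low r φ hr (Real.pi - θ₀) (by
      rw [Complex.add_im, Complex.exp_ofReal_mul_I_im,
        Complex.im_ofReal_mul, Complex.exp_ofReal_mul_I_im, Real.sin_pi_sub, abs_of_nonneg]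
      · nlinarith [hr.1, mul_nonneg hr.1 hsφ]
      · nlinarith [hr.1, mul_nonneg hr.1 hsφ]))
  have c1 : q * Complex.exp (-θ₀ * Complex.I) = ρ * Complex.exp ((φ - θ₀ : ℝ) * Complex.I) := by
    conv_lhs => rw [hq']
    rw [mul_assoc, ← Complex.exp_add]; congr 2; push_cast; ring
  have c2 : 1 - q * Complex.exp (θ₀ * Complex.I) =
      1 + ρ * Complex.exp ((φ - (Real.pi - θ₀) : ℝ) * Complex.I) := by
    have : ((φ - (Real.pi - θ₀) : ℝ) : ℂ) * Complex.I =
        φ * Complex.I + θ₀ * Complex.I - Real.pi * Complex.I := by push_cast; ring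
    conv_lhs => rw [hq']
    rw [this, Complex.exp_sub, Complex.exp_pi_mul_I, Complex.exp_add]; ring
  have d1 := (abs_le.1 ((Complex.abs_im_le_norm _).trans b1)).2
  have d2 := (abs_le.1 ((Complex.abs_im_le_norm _).trans b2)).1
  rw [Complex.sub_im, log_one_add_exp_im ⟨by linarith [hθ.2], by linarith [hθ.1]⟩, ← c1] at d1
  rw [Complex.sub_im, log_one_add_exp_im ⟨by linarith [hθ.1], by linarith [hθ.2]⟩, ← c2] at d2
  rw [edgeMeasure_re]
  have e : 4 / (Real.pi * Real.sin θ₀) * (1 - ρ) = 2 / Real.pi * (2 * ((1 - ρ) / Real.sin θ₀)) := by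
    field_simp; ring
  rw [e]
  gcongr
  linarith

lemma edgeMeasure_re_le (hθ : θ₀ ∈ Set.Ioo 0 (Real.pi / 2)) (hq : ‖q‖ < 1) :
    (edgeMeasure θ₀ q).re ≤ |(stripMap θ₀ q).im| / Real.pi +
      4 / (Real.pi * Real.sin θ₀) * (1 - ‖q‖) := by
  have hpi := Real.pi_pos
  rcases le_total 0 q.im with h | h
  · refine (edgeMeasure_re_le_of_im_nonneg hθ hq h).trans ?_
    gcongr
    exact le_abs_self _
  · have h1 := edgeMeasure_re_le_of_im_nonneg (q := -q) hθ (by rwa [norm_neg]) (by simpa using h)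
    rw [edgeMeasure_neg, stripMap_neg, norm_neg, Complex.neg_im] at h1
    refine h1.trans ?_
    gcongr
    exact neg_le_abs _

end SlitStrip

/-! ### The two-constants estimate on the slit strip -/

section SlitStripBound

/-- If a phase sum with spectral gap `Δ` is small for times `|t| < T`, with a front of exponential
growth rate `v`, then its resolvent sum at zero is exponentially small in `T`. -/
theorem exists_norm_resolventSum_zero_le_of_front {v Δ : ℝ} (hv : 0 < v) (hΔ : 0 < Δ) :
    ∃ K : ℝ, 0 < K ∧ ∀ {J : Type} [Fintype J] (c : J → ℂ) (w : J → ℝ) (B T : ℝ), 0 ≤ B → 0 ≤ T →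
      (∀ j, Δ ≤ |w j|) →
      (∀ t, ‖phaseSum c w t‖ ≤ B * min 1 (Real.exp (v * (|t| - T)))) →
      ‖resolventSum c w 0‖ ≤ B * K * (1 + T) * Real.exp
        (-(2 * v / Real.pi * Real.arcsin (Real.tanh (Δ * Real.pi / (2 * v))) * T)) := by
  have hpi := Real.pi_pos
  set x := Δ * Real.pi / (2 * v) with hx
  have hx0 : 0 < x := by positivity
  set k := Real.tanh x with hk
  have hk0 : 0 < k := by
    rw [hk, Real.tanh_eq_sinh_div_cosh]
    exact div_pos (Real.sinh_pos_iff.2 hx0) (Real.cosh_pos x)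
  have hk1 : k < 1 := Real.tanh_lt_one x
  set θ₀ := Real.arccos k with hθ₀
  have hcos : Real.cos θ₀ = k := Real.cos_arccos (by linarith) hk1.le
  have hθ : θ₀ ∈ Set.Ioo 0 (Real.pi / 2) :=
    ⟨Real.arccos_pos.2 hk1, Real.arccos_lt_pi_div_two.2 hk0⟩
  have hsin : 0 < Real.sin θ₀ := Real.sin_pos_of_pos_of_lt_pi hθ.1 (by linarith [hθ.2])
  -- The choice `k = tanh(πΔ/(2v))` puts the tips of the slits, which are the images of `q = ±1`
  -- after scaling by `v / π`, exactly at `±Δ`.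
  have hgap : (1 + k) / (1 - k) = Real.exp (Real.pi / v * Δ) := by
    have h1 : Real.pi / v * Δ = x - -x := by rw [hx]; field_simp; ring
    rw [h1, Real.exp_sub, hk, Real.tanh_eq_sinh_div_cosh, ← Real.cosh_add_sinh, ← Real.cosh_sub_sinh]
    have := (Real.cosh_pos x).ne'
    rw [one_add_div this, one_sub_div this, div_div_div_cancel_right₀ this]
  set C := 4 / (Real.pi * Real.sin θ₀) with hC
  have hC0 : 0 < C := by positivity
  set K₁ := 4 + 32 * Real.pi / (v * k) with hK₁
  have hK₁0 : 0 < K₁ := by positivity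
  refine ⟨Real.exp (v * C) * K₁, by positivity, ?_⟩
  intro J _ c w B T hB hT hw hg
  -- The circle is so close to the unit circle that the error `C ε` of the harmonic measure,
  -- multiplied by `v T`, stays bounded; the price is a factor `1 / ε`, proportional to `1 + T`.
  set ε := 1 / (2 * (1 + T)) with hε
  have hε0 : 0 < ε := by positivity
  have hε2 : ε ≤ 1 / 2 := one_div_le_one_div_of_le two_pos (by linarith)
  have hTε : T * ε ≤ 1 := by
    rw [hε, mul_one_div, div_le_one (by positivity)]; linarith
  set ρ := 1 - ε with hρ
  have hρ0 : 0 < ρ := by linarith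
  have hρ1 : ρ < 1 := by linarith
  -- The exponential compensates the decay `exp(-|y| T)` on the circle and is largest where that
  -- decay is; at the center it leaves the exponent to be proved. The last factor removes the `1 /
  -- |y|` singularity near `q = ±ρ`.
  set f : ℂ → ℂ := fun q => resolventSum c w ((v / Real.pi : ℝ) * stripMap θ₀ q) *
    Complex.exp ((T * v : ℝ) * edgeMeasure θ₀ q) * (1 - q ^ 2 / (ρ : ℂ) ^ 2) with hf
  have hd : DifferentiableOn ℂ f (Metric.closedBall 0 ρ) := by
    intro q hq
    have hq1 : ‖q‖ < 1 := (mem_closedBall_zero_iff.1 hq).trans_lt hρ1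
    refine DifferentiableAt.differentiableWithinAt ?_
    -- A pole on the image would be a real number of modulus at least `Δ`, but the image meets the
    -- real axis only inside the gap.
    have hne : ∀ j, ((v / Real.pi : ℝ) : ℂ) * stripMap θ₀ q ≠ w j := by
      intro j hj
      have h1 := congrArg Complex.im hj
      have h2 := congrArg Complex.re hj
      rw [Complex.im_ofReal_mul, Complex.ofReal_im] at h1
      rw [Complex.re_ofReal_mul, Complex.ofReal_re] at h2
      have h3 : (stripMap θ₀ q).im = 0 :=
        (mul_eq_zero.1 h1).resolve_left (by positivity)
      have h4 := abs_stripMap_re_lt (by rw [hcos]; exact hk0) (by rw [hcos]; exact hk1) hq1 h3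
      rw [hcos, hgap, Real.exp_lt_exp] at h4
      have h5 := hw j
      rw [← h2, abs_mul, abs_of_pos (by positivity)] at h5
      have h6 : Real.pi / v * Δ ≤ Real.pi / v * (v / Real.pi * |(stripMap θ₀ q).re|) := by gcongr
      rw [← mul_assoc, div_mul_div_cancel₀ hv.ne', div_self hpi.ne', one_mul] at h6
      linarith
    have h1 : DifferentiableAt ℂ (fun q => ((v / Real.pi : ℝ) : ℂ) * stripMap θ₀ q) q :=
      (differentiableAt_stripMap hq1).const_mul _
    have h2 : DifferentiableAt ℂ (fun q => Complex.exp ((T * v : ℝ) * edgeMeasure θ₀ q)) q :=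
      ((differentiableAt_edgeMeasure hq1).const_mul _).cexp
    exact (((differentiableAt_resolventSum hne).comp q h1).mul h2).mul (by fun_prop)
  have hfr : ∀ q ∈ frontier (Metric.ball (0 : ℂ) ρ), ‖f q‖ ≤ B * (Real.exp (v * C) * K₁) * (1 + T) := by
    intro q hq
    rw [frontier_ball _ hρ0.ne', mem_sphere_zero_iff_norm] at hq
    have hq1 : ‖q‖ < 1 := hq.trans_lt hρ1
    simp only [hf]
    rw [norm_mul, norm_one_sub_sq_div hρ0 hq]
    by_cases hy : q.im = 0
    · simp only [hy, abs_zero, mul_zero, zero_div]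
      positivity
    have hy0 : 0 < |q.im| := abs_pos.2 hy
    have hy1 : |q.im| ≤ 1 := (Complex.abs_im_le_norm q).trans hq1.le
    have him : (((v / Real.pi : ℝ) : ℂ) * stripMap θ₀ q).im =
      v / Real.pi * (stripMap θ₀ q).im := Complex.im_ofReal_mul _ _
    set σ := |(stripMap θ₀ q).im| with hσ
    have hσ1 : k * |q.im| * ε / 4 ≤ σ := by
      have h1 := le_abs_stripMap_im (θ₀ := θ₀) (by rw [hcos]; exact hk0.le) hq1
      rw [hcos, hq] at h1
      refine le_trans ?_ h1
      have : ε ≤ 1 - ρ ^ 2 := by rw [hρ]; nlinarith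
      gcongr
    have hσ0 : 0 < σ := lt_of_lt_of_le (by positivity) hσ1
    have hσπ : σ < Real.pi := abs_stripMap_im_lt hq1
    have himabs : |(((v / Real.pi : ℝ) : ℂ) * stripMap θ₀ q).im| = v / Real.pi * σ := by
      rw [him, abs_mul, abs_of_pos (by positivity)]
    have hR := norm_resolventSum_le_of_front (c := c) (w := w) hB hT hg
      (z := ((v / Real.pi : ℝ) : ℂ) * stripMap θ₀ q)
      (abs_pos.1 (by rw [himabs]; positivity))
      (by rw [himabs, div_mul_eq_mul_div, div_le_iff₀ hpi]; gcongr)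
    rw [himabs] at hR
    have hW : ‖Complex.exp ((T * v : ℝ) * edgeMeasure θ₀ q)‖ ≤
        Real.exp (v / Real.pi * σ * T) * Real.exp (v * C) := by
      rw [Complex.norm_exp, Complex.re_ofReal_mul, ← Real.exp_add, Real.exp_le_exp]
      have h1 := edgeMeasure_re_le hθ hq1
      rw [hq] at h1
      have h2 : 1 - ρ = ε := by rw [hρ]; ring
      rw [h2] at h1
      calc T * v * (edgeMeasure θ₀ q).re ≤ T * v * (σ / Real.pi + C * ε) := by gcongr
        _ = v / Real.pi * σ * T + v * C * (T * ε) := by ring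
        _ ≤ v / Real.pi * σ * T + v * C * 1 := by gcongr
        _ = _ := by ring
    -- By `le_abs_stripMap_im`, `σ` is at least of order `|Im q| ε`; the factor `|Im q|` cancels,
    -- and `1 / ε = 2 (1 + T)` remains.
    have hfac : (T + 1 / (v / Real.pi * σ)) * (2 * |q.im| / ρ) ≤ K₁ * (1 + T) := by
      have h1 : 1 / (v / Real.pi * σ) ≤ Real.pi / v * (4 / (k * |q.im| * ε)) := by
        calc 1 / (v / Real.pi * σ) ≤ 1 / (v / Real.pi * (k * |q.im| * ε / 4)) := by gcongr
          _ = _ := by field_simp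
      have h2 : 2 * |q.im| / ρ ≤ 4 * |q.im| := by
        rw [div_le_iff₀ hρ0]; nlinarith
      calc _ ≤ (T + Real.pi / v * (4 / (k * |q.im| * ε))) * (4 * |q.im|) := by gcongr
        _ = 4 * |q.im| * T + 32 * Real.pi / (v * k) * (1 + T) := by
            rw [hε]; field_simp; ring
        _ ≤ 4 * 1 * (1 + T) + 32 * Real.pi / (v * k) * (1 + T) := by
            gcongr
            linarith
        _ = _ := by rw [hK₁]; ring
    rw [norm_mul]
    calc _ ≤ (B * Real.exp (-(v / Real.pi * σ) * T) * (T + 1 / (v / Real.pi * σ))) *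
          (Real.exp (v / Real.pi * σ * T) * Real.exp (v * C)) * (2 * |q.im| / ρ) := by
          gcongr
      _ = B * Real.exp (v * C) * (Real.exp (-(v / Real.pi * σ) * T) * Real.exp (v / Real.pi * σ * T)) *
          ((T + 1 / (v / Real.pi * σ)) * (2 * |q.im| / ρ)) := by ring
      _ = B * Real.exp (v * C) * ((T + 1 / (v / Real.pi * σ)) * (2 * |q.im| / ρ)) := by
          rw [← Real.exp_add, neg_mul, neg_add_cancel, Real.exp_zero, mul_one]
      _ ≤ B * Real.exp (v * C) * (K₁ * (1 + T)) := by gcongr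
      _ = _ := by ring
  have h1 := Complex.norm_le_of_forall_mem_frontier_norm_le Metric.isBounded_ball
    ⟨hd.mono Metric.ball_subset_closedBall,
      by rw [closure_ball _ hρ0.ne']; exact hd.continuousOn⟩ hfr
    (subset_closure (Metric.mem_ball_self hρ0))
  have e1 : f 0 = resolventSum c w 0 * Complex.exp ((T * v * (1 - 2 * θ₀ / Real.pi) : ℝ)) := by
    simp [hf, stripMap, edgeMeasure]
  rw [e1, norm_mul, ← Complex.ofReal_exp, Complex.norm_real, Real.norm_eq_abs, Real.abs_exp] at h1
  have e2 : T * v * (1 - 2 * θ₀ / Real.pi) = 2 * v / Real.pi * Real.arcsin k * T := by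
    rw [hθ₀, Real.arccos]; field_simp; ring
  rw [e2] at h1
  rw [Real.exp_neg, ← div_eq_mul_inv, le_div_iff₀ (Real.exp_pos _)]
  exact h1

end SlitStripBound

/-! ### Operator norm, expectation values and traces -/

section OperatorNorm

variable {ι : Type} [Fintype ι] [DecidableEq ι]

lemma norm_dotProduct_mulVec_le (A : Matrix ι ι ℂ) {u : ι → ℂ} (hu : star u ⬝ᵥ u = 1) :
    ‖star u ⬝ᵥ (A *ᵥ u)‖ ≤ ‖A‖ := by
  have h1 : ∀ x y : ι → ℂ, star x ⬝ᵥ y = inner ℂ (WithLp.toLp 2 x) (WithLp.toLp 2 y) := by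
    intro x y
    rw [EuclideanSpace.inner_toLp_toLp, dotProduct_comm]
  have h2 : ‖(WithLp.toLp 2 u : EuclideanSpace ℂ ι)‖ = 1 := by
    have h3 := inner_self_eq_norm_sq_to_K (𝕜 := ℂ) (WithLp.toLp 2 u : EuclideanSpace ℂ ι)
    rw [← h1, hu] at h3
    have h4 : ‖(WithLp.toLp 2 u : EuclideanSpace ℂ ι)‖ ^ 2 = 1 := by
      have := congrArg Complex.re h3
      simpa [← Complex.ofReal_pow] using this.symm
    exact (pow_eq_one_iff_of_nonneg (norm_nonneg _) two_ne_zero).1 h4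
  rw [h1]
  refine (norm_inner_le_norm _ _).trans ?_
  rw [h2, one_mul]
  have h5 := Matrix.l2_opNorm_mulVec A (WithLp.toLp 2 u)
  rwa [h2, mul_one] at h5

lemma norm_trace_le (A : Matrix ι ι ℂ) : ‖A.trace‖ ≤ Fintype.card ι * ‖A‖ := by
  unfold Matrix.trace
  refine (norm_sum_le _ _).trans ?_
  rw [← nsmul_eq_mul, ← Finset.card_univ]
  refine Finset.sum_le_card_nsmul _ _ _ fun i _ => ?_
  have h := norm_dotProduct_mulVec_le A (u := Pi.single i 1) (by simp)
  simpa [← Pi.single_star] using h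

/-- The trace is the square of the Frobenius norm, which dominates the operator norm by
Cauchy-Schwarz. -/
lemma norm_sq_le_trace (A : Matrix ι ι ℂ) : ‖A‖ ^ 2 ≤ (Aᴴ * A).trace.re := by
  have e : (Aᴴ * A).trace.re = ∑ i, ∑ j, ‖A i j‖ ^ 2 := by
    rw [Matrix.trace, Complex.re_sum, Finset.sum_comm]
    refine Finset.sum_congr rfl fun j _ => ?_
    rw [Matrix.diag_apply, Matrix.mul_apply, Complex.re_sum]
    refine Finset.sum_congr rfl fun i _ => ?_
    rw [Matrix.conjTranspose_apply, Complex.star_def, ← Complex.normSq_eq_conj_mul_self,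
      Complex.ofReal_re, Complex.normSq_eq_norm_sq]
  rw [e]
  have hF : 0 ≤ ∑ i, ∑ j, ‖A i j‖ ^ 2 := by positivity
  refine (Real.le_sqrt (norm_nonneg _) hF).1 ?_
  rw [Matrix.l2_opNorm_def]
  refine ContinuousLinearMap.opNorm_le_bound _ (Real.sqrt_nonneg _) fun x => ?_
  rw [EuclideanSpace.norm_eq, EuclideanSpace.norm_eq, ← Real.sqrt_mul hF]
  refine Real.sqrt_le_sqrt ?_
  rw [Finset.sum_mul]
  refine Finset.sum_le_sum fun i _ => ?_
  have h1 : ‖∑ j, A i j * x j‖ ≤ ∑ j, ‖A i j‖ * ‖x j‖ :=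
    (norm_sum_le _ _).trans_eq (by simp)
  calc _ = ‖∑ j, A i j * x j‖ ^ 2 := rfl
    _ ≤ (∑ j, ‖A i j‖ * ‖x j‖) ^ 2 := by gcongr
    _ ≤ _ := Finset.sum_mul_sq_le_sq_mul_sq _ _ _

end OperatorNorm

/-! ### Ground-state projection and reduced resolvent -/

section GroundManifold

variable {ι : Type} [Fintype ι] [DecidableEq ι] {d : ℕ} {H V S : Matrix ι ι ℂ} {Δ : ℝ}
  {G : Fin d → ι → ℂ} {E : Fin d → ℝ}

lemma groundProj_mulVec {ι : Type} [Fintype ι] {d : ℕ} (G : Fin d → ι → ℂ) (ψ : ι → ℂ) :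
    groundProj G *ᵥ ψ = ∑ a, (star (G a) ⬝ᵥ ψ) • G a := by
  unfold groundProj
  rw [Matrix.sum_mulVec]
  refine Finset.sum_congr rfl fun a _ => ?_
  rw [Matrix.vecMulVec_mulVec]
  ext i
  simp [mul_comm]

lemma trace_groundProj_mul {ι : Type} [Fintype ι] {d : ℕ} (G : Fin d → ι → ℂ)
    (A : Matrix ι ι ℂ) :
    (groundProj G * A).trace = ∑ a, star (G a) ⬝ᵥ (A *ᵥ G a) := by
  unfold groundProj
  rw [Finset.sum_mul, Matrix.trace_sum]
  refine Finset.sum_congr rfl fun a _ => ?_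
  rw [Matrix.vecMulVec_mul, Matrix.trace_vecMulVec, dotProduct_comm, Matrix.dotProduct_mulVec]

lemma groundProj_isHermitian {ι : Type} {d : ℕ} (G : Fin d → ι → ℂ) : (groundProj G).IsHermitian := by
  unfold Matrix.IsHermitian groundProj
  rw [Matrix.conjTranspose_sum]
  refine Finset.sum_congr rfl fun a _ => ?_
  rw [Matrix.conjTranspose_vecMulVec, star_star]

namespace IsGroundManifold

lemma proj_mulVec {ι : Type} [Fintype ι] {d : ℕ} {H : Matrix ι ι ℂ} {Δ : ℝ}
    {G : Fin d → ι → ℂ} {E : Fin d → ℝ} (hG : IsGroundManifold H Δ G E) (a : Fin d) : groundProj G *ᵥ G a = G a := by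
  rw [groundProj_mulVec, Finset.sum_eq_single a]
  · rw [hG.orthonormal, if_pos rfl, one_smul]
  · intro b _ hb
    rw [hG.orthonormal, if_neg hb, zero_smul]
  · simp

lemma proj_mul_proj {ι : Type} [Fintype ι] {d : ℕ} {H : Matrix ι ι ℂ} {Δ : ℝ}
    {G : Fin d → ι → ℂ} {E : Fin d → ℝ} (hG : IsGroundManifold H Δ G E) :
    groundProj G * groundProj G = groundProj G := by
  conv_lhs => rhs; unfold groundProj
  rw [Finset.mul_sum]
  conv_rhs => unfold groundProj
  refine Finset.sum_congr rfl fun a _ => ?_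
  rw [Matrix.mul_vecMulVec, hG.proj_mulVec]

lemma trace_proj (hG : IsGroundManifold H Δ G E) : (groundProj G).trace = d := by
  have h := trace_groundProj_mul G 1
  rw [mul_one] at h
  rw [h]
  simp [hG.orthonormal]

lemma mul_proj {ι : Type} [Fintype ι] {d : ℕ} {H : Matrix ι ι ℂ} {Δ : ℝ}
    {G : Fin d → ι → ℂ} {E : Fin d → ℝ} (hG : IsGroundManifold H Δ G E) (hH : H.IsHermitian) :
    H * groundProj G = groundProj G * H := by
  have h1 : H * groundProj G = ∑ a, (E a : ℂ) • Matrix.vecMulVec (G a) (star (G a)) := by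
    unfold groundProj
    rw [Finset.mul_sum]
    refine Finset.sum_congr rfl fun a _ => ?_
    rw [Matrix.mul_vecMulVec, hG.eigen, Matrix.smul_vecMulVec]
  have h2 : (H * groundProj G)ᴴ = H * groundProj G := by
    rw [h1, Matrix.conjTranspose_sum]
    refine Finset.sum_congr rfl fun a _ => ?_
    rw [Matrix.conjTranspose_smul, Matrix.conjTranspose_vecMulVec, star_star]
    simp
  rw [← h2, Matrix.conjTranspose_mul, hH.eq, (groundProj_isHermitian G).eq]

lemma proj_mul_one_sub (hG : IsGroundManifold H Δ G E) :
    groundProj G * (1 - groundProj G) = 0 := by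
  rw [mul_sub, mul_one, hG.proj_mul_proj, sub_self]

lemma one_sub_mul_proj (hG : IsGroundManifold H Δ G E) :
    (1 - groundProj G) * groundProj G = 0 := by
  rw [sub_mul, one_mul, hG.proj_mul_proj, sub_self]

lemma one_sub_mul_one_sub (hG : IsGroundManifold H Δ G E) :
    (1 - groundProj G) * (1 - groundProj G) = 1 - groundProj G := by
  rw [mul_sub, mul_one, hG.one_sub_mul_proj, sub_zero]

lemma dotProduct_eq_zero {ι : Type} [Fintype ι] {d : ℕ} {H : Matrix ι ι ℂ} {Δ : ℝ}
    {G : Fin d → ι → ℂ} {E : Fin d → ℝ} (hG : IsGroundManifold H Δ G E) {ψ : ι → ℂ} (h : groundProj G *ᵥ ψ = 0)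
    (a : Fin d) : star (G a) ⬝ᵥ ψ = 0 := by
  have h1 : star (G a) ⬝ᵥ (groundProj G *ᵥ ψ) = star (G a) ⬝ᵥ ψ := by
    rw [groundProj_mulVec, dotProduct_sum, Finset.sum_eq_single a]
    · rw [dotProduct_smul, hG.orthonormal, if_pos rfl, smul_eq_mul, mul_one]
    · intro b _ hb
      rw [dotProduct_smul, hG.orthonormal, if_neg hb.symm, smul_zero]
    · simp
  rw [← h1, h, dotProduct_zero]

/-- The operator that `reducedResolvent` inverts. -/
lemma isUnit_shifted (hG : IsGroundManifold H Δ G E) (hH : H.IsHermitian) (hΔ : 0 < Δ) (a : Fin d) :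
    IsUnit ((1 - groundProj G) * (H - (E a : ℂ) • (1 : Matrix ι ι ℂ)) + groundProj G) := by
  set P := groundProj G with hP
  rw [← Matrix.mulVec_injective_iff_isUnit]
  refine (injective_iff_map_eq_zero (Matrix.mulVecLin
    ((1 - P) * (H - (E a : ℂ) • (1 : Matrix ι ι ℂ)) + P))).2 fun ψ hψ => ?_
  rw [Matrix.mulVecLin_apply] at hψ
  have h1 : P *ᵥ ψ = 0 := by
    have := congrArg (fun x => P *ᵥ x) hψ
    simp only [Matrix.mulVec_mulVec, Matrix.mulVec_zero] at this
    rwa [mul_add, ← mul_assoc, hG.proj_mul_one_sub, zero_mul, zero_add, hG.proj_mul_proj] at this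
  have h2 : H *ᵥ ψ = (E a : ℂ) • ψ := by
    rw [sub_mul, one_mul, mul_sub, ← hG.mul_proj hH, Matrix.mul_smul, mul_one] at hψ
    simp only [Matrix.add_mulVec, Matrix.sub_mulVec, Matrix.smul_mulVec, ← Matrix.mulVec_mulVec, h1,
      ← hP, Matrix.mulVec_zero, smul_zero, sub_zero, add_zero, Matrix.one_mulVec] at hψ
    exact sub_eq_zero.1 hψ
  by_contra hne
  have := hG.gap ψ (E a) hne (hG.dotProduct_eq_zero h1) h2 a
  linarith

/-- The reduced resolvent inverts `H - E a` on the complement of the ground states. -/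
lemma eq_reducedResolvent_mulVec (hG : IsGroundManifold H Δ G E) (hH : H.IsHermitian) (hΔ : 0 < Δ)
    {a : Fin d} {x y : ι → ℂ} (hx : groundProj G *ᵥ x = 0)
    (h : H *ᵥ x - (E a : ℂ) • x = (1 - groundProj G) *ᵥ y) :
    reducedResolvent H G (E a) *ᵥ y = x := by
  have hu := hG.isUnit_shifted hH hΔ a
  set P := groundProj G with hP
  set M := (1 - P) * (H - (E a : ℂ) • (1 : Matrix ι ι ℂ)) + P with hM
  have hcP : H * P = P * H := hG.mul_proj hH
  have hc : P * M = M * P := by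
    have h1 : (H - (E a : ℂ) • (1 : Matrix ι ι ℂ)) * P = P * (H - (E a : ℂ) • 1) := by
      rw [sub_mul, mul_sub, hcP, Matrix.smul_mul, Matrix.mul_smul, one_mul, mul_one]
    rw [hM, mul_add, add_mul, ← mul_assoc, hG.proj_mul_one_sub, mul_assoc (1 - P), h1, ← mul_assoc,
      hG.one_sub_mul_proj, zero_mul]
  have hdet : IsUnit M.det := (Matrix.isUnit_iff_isUnit_det M).1 hu
  -- The projection commutes with `M`, hence with its inverse, so it can be moved onto `y`, where
  -- the equation for `x` applies.
  have hcinv : (1 - P) * M⁻¹ = M⁻¹ * (1 - P) := by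
    have h1 : M⁻¹ * (M * ((1 - P) * M⁻¹)) = M⁻¹ * ((1 - P) * M * M⁻¹) := by
      congr 1
      rw [← mul_assoc, mul_sub, sub_mul 1 P M, hc, mul_one, one_mul]
    rwa [Matrix.nonsing_inv_mul_cancel_left _ _ hdet, mul_assoc, Matrix.mul_nonsing_inv _ hdet,
      mul_one] at h1
  have h2 : M *ᵥ x = (1 - P) *ᵥ y := by
    rw [hM, Matrix.add_mulVec, hx, add_zero, ← Matrix.mulVec_mulVec, Matrix.sub_mulVec H,
      Matrix.smul_mulVec, Matrix.one_mulVec, h, Matrix.mulVec_mulVec, hG.one_sub_mul_one_sub]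
  have h3 : reducedResolvent H G (E a) = (1 - P) * M⁻¹ := rfl
  rw [h3, hcinv, ← Matrix.mulVec_mulVec, ← h2, Matrix.mulVec_mulVec,
    Matrix.nonsing_inv_mul _ hdet, Matrix.one_mulVec]

lemma reducedResolvent_mul_proj (hG : IsGroundManifold H Δ G E) (hH : H.IsHermitian) (hΔ : 0 < Δ)
    (a : Fin d) : reducedResolvent H G (E a) * groundProj G = 0 := by
  refine Matrix.ext_of_mulVec_single fun i => ?_
  have h := hG.eq_reducedResolvent_mulVec hH hΔ (a := a) (x := 0)
    (y := groundProj G *ᵥ Pi.single i 1) (Matrix.mulVec_zero _) (by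
      rw [Matrix.mulVec_mulVec, hG.one_sub_mul_proj, Matrix.zero_mulVec, Matrix.mulVec_zero,
        smul_zero, sub_zero])
  rw [← Matrix.mulVec_mulVec, h, Matrix.zero_mulVec]

end IsGroundManifold

end GroundManifold

/-! ### First-order perturbation theory of ground-state averages -/

section GroundManifold

open scoped ComplexOrder

variable {ι : Type} [Fintype ι] [DecidableEq ι] {d : ℕ} {H H' V S : Matrix ι ι ℂ} {Δ : ℝ}
  {G G' : Fin d → ι → ℂ} {E E' : Fin d → ℝ}

lemma isHermitian_add_smul {ι : Type} {H V : Matrix ι ι ℂ} (hH : H.IsHermitian)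
    (hV : V.IsHermitian) (u : ℝ) : (H + (u : ℂ) • V).IsHermitian := by
  refine hH.add ?_
  unfold Matrix.IsHermitian
  rw [Matrix.conjTranspose_smul, hV.eq, Complex.star_def, Complex.conj_ofReal]

lemma groundAverage_eq_trace {ι : Type} [Fintype ι] {d : ℕ} (G : Fin d → ι → ℂ)
    (S : Matrix ι ι ℂ) :
    groundAverage G S = 1 / (d : ℂ) * (groundProj G * S).trace := by
  rw [groundAverage, trace_groundProj_mul]

namespace IsGroundManifold

lemma one_sub_proj_posSemidef (hG : IsGroundManifold H Δ G E) : (1 - groundProj G).PosSemidef := by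
  have h := Matrix.posSemidef_conjTranspose_mul_self (1 - groundProj G)
  rwa [Matrix.conjTranspose_sub, Matrix.conjTranspose_one, (groundProj_isHermitian G).eq,
    hG.one_sub_mul_one_sub] at h

/-- An eigenvector with nonzero eigenvalue lies in the range of `1 - P`. If the eigenvalue is
negative, the vector is an eigenvector of `H` below `E a + Δ` and orthogonal to the ground states,
against the gap. -/
lemma shifted_posSemidef (hG : IsGroundManifold H Δ G E) (hH : H.IsHermitian) (a : Fin d) :
    ((1 - groundProj G) * (H - ((E a + Δ : ℝ) : ℂ) • (1 : Matrix ι ι ℂ))).PosSemidef := by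
  set P := groundProj G with hP
  set μ := E a + Δ with hμ
  have hHP : H * P = P * H := hG.mul_proj hH
  have hPh : Pᴴ = P := (groundProj_isHermitian G).eq
  have hK : ((1 - P) * (H - (μ : ℂ) • (1 : Matrix ι ι ℂ))).IsHermitian := by
    unfold Matrix.IsHermitian
    rw [Matrix.conjTranspose_mul, Matrix.conjTranspose_sub, Matrix.conjTranspose_sub,
      Matrix.conjTranspose_smul, Matrix.conjTranspose_one, hPh, hH.eq, Complex.star_def,
      Complex.conj_ofReal]
    simp only [mul_sub, sub_mul, mul_one, one_mul, hHP, Matrix.smul_mul, Matrix.mul_smul]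
    abel
  rw [hK.posSemidef_iff_eigenvalues_nonneg]
  intro i
  set ε := hK.eigenvalues i with hε
  by_contra! hneg
  have hneg : ε < 0 := hneg
  set ψ : ι → ℂ := ⇑(hK.eigenvectorBasis i) with hψ
  have h1 : ((1 - P) * (H - (μ : ℂ) • (1 : Matrix ι ι ℂ))) *ᵥ ψ = (ε : ℂ) • ψ := by
    have := hK.mulVec_eigenvectorBasis i
    rw [← hψ, ← hε] at this
    rw [this]; ext j; simp
  have hψ0 : ψ ≠ 0 := fun h => by
    have h2 := hK.eigenvectorBasis.toBasis.ne_zero i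
    rw [OrthonormalBasis.coe_toBasis] at h2
    exact h2 (by ext j; exact congrFun h j)
  have hPψ : P *ᵥ ψ = 0 := by
    have h2 := congrArg (fun x => P *ᵥ x) h1
    simp only [Matrix.mulVec_mulVec, Matrix.mulVec_smul] at h2
    rw [← mul_assoc, hG.proj_mul_one_sub, zero_mul, Matrix.zero_mulVec] at h2
    exact (smul_eq_zero.1 h2.symm).resolve_left (by exact_mod_cast hneg.ne)
  have hHψ : H *ᵥ ψ = ((μ + ε : ℝ) : ℂ) • ψ := by
    rw [sub_mul, one_mul, mul_sub, ← hHP, Matrix.mul_smul, mul_one] at h1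
    simp only [Matrix.sub_mulVec, Matrix.smul_mulVec, ← Matrix.mulVec_mulVec, hPψ,
      Matrix.mulVec_zero, smul_zero, sub_zero, Matrix.one_mulVec] at h1
    rw [sub_eq_iff_eq_add] at h1
    rw [h1, Complex.ofReal_add μ ε, add_smul, add_comm]
  have := hG.gap ψ _ hψ0 (hG.dotProduct_eq_zero hPψ) hHψ a
  linarith

/-- Variational principle: both projections have rank `d`, so the weight that `P'` puts above the
gap equals the weight it removes from the ground states. The former costs at least `E m + Δ` per
unit and the latter saves at most `E m`, where `E m` is the largest ground-state energy. -/
lemma le_trace_proj_sub (hG : IsGroundManifold H Δ G E) (hH : H.IsHermitian)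
    (hG' : IsGroundManifold H' Δ G' E') (hd : 0 < d) :
    Δ * (groundProj G' * (1 - groundProj G)).trace.re ≤
      ((groundProj G' - groundProj G) * H).trace.re := by
  have : Nonempty (Fin d) := ⟨⟨0, hd⟩⟩
  obtain ⟨m, hm⟩ := Finite.exists_max E
  have hK := hG.shifted_posSemidef hH m
  have hHP := hG.mul_proj hH
  set P := groundProj G with hP
  set P' := groundProj G' with hP'
  have h1 : 0 ≤ (P' * ((1 - P) * (H - ((E m + Δ : ℝ) : ℂ) • (1 : Matrix ι ι ℂ)))).trace.re := by
    rw [trace_groundProj_mul, Complex.re_sum]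
    exact Finset.sum_nonneg fun a _ => (Complex.le_def.1 (hK.dotProduct_mulVec_nonneg (G' a))).1
  have e1 : P' * ((1 - P) * (H - ((E m + Δ : ℝ) : ℂ) • (1 : Matrix ι ι ℂ))) =
      P' * H - P' * (H * P) - ((E m + Δ : ℝ) : ℂ) • (P' * (1 - P)) := by
    rw [sub_mul 1 P (H - _), one_mul, mul_sub P, ← hHP, Matrix.mul_smul, mul_one, mul_sub,
      mul_sub, mul_sub, mul_sub P' 1 P, Matrix.mul_smul, Matrix.mul_smul, smul_sub, mul_one]
    abel
  have e2 : (P' * (H * P)).trace = ∑ a, (E a : ℂ) * (star (G a) ⬝ᵥ (P' *ᵥ G a)) := by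
    rw [← mul_assoc, Matrix.trace_mul_comm, trace_groundProj_mul]
    refine Finset.sum_congr rfl fun a _ => ?_
    rw [← Matrix.mulVec_mulVec, hG.eigen, Matrix.mulVec_smul, dotProduct_smul, smul_eq_mul]
  have e3 : (P * H).trace = ∑ a, (E a : ℂ) := by
    rw [trace_groundProj_mul]
    refine Finset.sum_congr rfl fun a _ => ?_
    rw [hG.eigen, dotProduct_smul, hG.orthonormal, if_pos rfl, smul_eq_mul, mul_one]
  have e4 : (P' * (1 - P)).trace = ∑ a, star (G a) ⬝ᵥ ((1 - P') *ᵥ G a) := by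
    rw [← trace_groundProj_mul, mul_sub, mul_sub, Matrix.trace_sub, Matrix.trace_sub,
      Matrix.trace_mul_comm P' P, mul_one, mul_one, hG.trace_proj, hG'.trace_proj]
  have e5 : (P' * (H * P)).trace - (P * H).trace =
      -∑ a, (E a : ℂ) * (star (G a) ⬝ᵥ ((1 - P') *ᵥ G a)) := by
    rw [e2, e3, ← Finset.sum_sub_distrib, ← Finset.sum_neg_distrib]
    refine Finset.sum_congr rfl fun a _ => ?_
    rw [Matrix.sub_mulVec, Matrix.one_mulVec, dotProduct_sub, hG.orthonormal, if_pos rfl]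
    ring
  have h2 : (∑ a, (E a : ℂ) * (star (G a) ⬝ᵥ ((1 - P') *ᵥ G a))).re ≤
      E m * (P' * (1 - P)).trace.re := by
    rw [e4, Complex.re_sum, Complex.re_sum, Finset.mul_sum]
    refine Finset.sum_le_sum fun a _ => ?_
    rw [Complex.re_ofReal_mul]
    exact mul_le_mul_of_nonneg_right (hm a)
      (Complex.le_def.1 (hG'.one_sub_proj_posSemidef.dotProduct_mulVec_nonneg (G a))).1
  rw [e1, Matrix.trace_sub, Matrix.trace_sub, Matrix.trace_smul, smul_eq_mul, Complex.sub_re,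
    Complex.sub_re, Complex.re_ofReal_mul] at h1
  have h3 := congrArg Complex.re e5
  rw [Complex.sub_re, Complex.neg_re] at h3
  rw [sub_mul, Matrix.trace_sub, Complex.sub_re]
  linarith

/-- The projection to the ground states is a Lipschitz function of the Hamiltonian. -/
lemma norm_proj_sub_le (hG : IsGroundManifold H Δ G E) (hH : H.IsHermitian)
    (hG' : IsGroundManifold H' Δ G' E') (hH' : H'.IsHermitian) (hd : 0 < d) (hΔ : 0 < Δ) :
    ‖groundProj G' - groundProj G‖ ≤ Fintype.card ι * ‖H' - H‖ / Δ := by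
  have h1 := hG.le_trace_proj_sub hH hG' hd
  have h2 := hG'.le_trace_proj_sub hH' hG hd
  set P := groundProj G with hP
  set P' := groundProj G' with hP'
  set X := P' - P with hX
  have hXh : Xᴴ = X := by
    rw [hX, Matrix.conjTranspose_sub, (groundProj_isHermitian G).eq, (groundProj_isHermitian G').eq]
  have e1 : (Xᴴ * X).trace = (P' * (1 - P)).trace + (P * (1 - P')).trace := by
    rw [hXh, ← Matrix.trace_add, hX]
    congr 1
    rw [mul_sub, sub_mul, sub_mul, hG.proj_mul_proj, hG'.proj_mul_proj, mul_sub, mul_sub]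
    simp only [mul_one]
    abel
  have h3 := norm_sq_le_trace X
  rw [e1, Complex.add_re] at h3
  -- Adding the two variational inequalities leaves only `H' - H`, to first order in `X`, while the
  -- left-hand sides add up to `Δ` times the trace of `X²`.
  have e2 : ((P' - P) * H).trace.re + ((P - P') * H').trace.re = -(X * (H' - H)).trace.re := by
    rw [← Complex.add_re, ← Matrix.trace_add, ← Complex.neg_re, ← Matrix.trace_neg]
    congr 2
    rw [hX]; noncomm_ring
  have h4 : -(X * (H' - H)).trace.re ≤ Fintype.card ι * (‖X‖ * ‖H' - H‖) := by
    refine (neg_le_abs _).trans ((Complex.abs_re_le_norm _).trans ((norm_trace_le _).trans ?_))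
    gcongr
    exact norm_mul_le _ _
  have h5 : Δ * ‖X‖ ^ 2 ≤ Fintype.card ι * (‖X‖ * ‖H' - H‖) := by nlinarith
  rcases (norm_nonneg X).eq_or_lt with h0 | h0
  · rw [← h0]; positivity
  · rw [le_div_iff₀ hΔ]
    refine le_of_mul_le_mul_right ?_ h0
    linarith

/-- First-order perturbation theory, with an exact remainder. -/
lemma one_sub_mul_proj'_mulVec (hG : IsGroundManifold H Δ G E) (hH : H.IsHermitian) (hΔ : 0 < Δ)
    {t : ℂ} (hG' : IsGroundManifold (H + t • V) Δ G' E') (hH' : (H + t • V).IsHermitian)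
    (a : Fin d) :
    (1 - groundProj G) *ᵥ (groundProj G' *ᵥ G a) =
      -(t • reducedResolvent H G (E a) *ᵥ ((V * groundProj G' - groundProj G' * V) *ᵥ G a)) := by
  have hHP := hG.mul_proj hH
  have hHP' := hG'.mul_proj hH'
  set P := groundProj G with hP
  set P' := groundProj G' with hP'
  rw [← Matrix.mulVec_smul, ← Matrix.mulVec_neg]
  symm
  refine hG.eq_reducedResolvent_mulVec hH hΔ ?_ ?_
  · rw [Matrix.mulVec_mulVec, hG.proj_mul_one_sub, Matrix.zero_mulVec]
  · have h1 : H * P' - P' * H = -(t • (V * P' - P' * V)) := by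
      rw [add_mul, mul_add, Matrix.smul_mul, Matrix.mul_smul] at hHP'
      rw [smul_sub, neg_sub, sub_eq_sub_iff_add_eq_add]
      rw [hHP', add_comm]
    have h2 : H *ᵥ (P' *ᵥ G a) - (E a : ℂ) • (P' *ᵥ G a) =
        -(t • ((V * P' - P' * V) *ᵥ G a)) := by
      have h := congrArg (fun A : Matrix ι ι ℂ => A *ᵥ G a) h1
      simp only [Matrix.neg_mulVec, Matrix.smul_mulVec] at h
      rw [← h, Matrix.sub_mulVec, ← Matrix.mulVec_mulVec, ← Matrix.mulVec_mulVec, hG.eigen,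
        Matrix.mulVec_smul]
    have h3 : H * (1 - P) = (1 - P) * H := by rw [mul_sub, sub_mul, hHP, mul_one, one_mul]
    rw [Matrix.mulVec_mulVec, h3, ← Matrix.mulVec_mulVec, ← Matrix.mulVec_smul, ← Matrix.mulVec_sub,
      h2]

/-- The second-order Taylor estimate for ground-state averages. -/
lemma exists_norm_groundAverage_sub_le (hG : IsGroundManifold H Δ G E) (hH : H.IsHermitian)
    (hV : V.IsHermitian) (hS : S.IsHermitian) (hΔ : 0 < Δ) (hd : 0 < d) : ∃ K : ℝ, 0 ≤ K ∧
    ∀ (t : ℝ) (G' : Fin d → ι → ℂ) (E' : Fin d → ℝ), IsGroundManifold (H + (t : ℂ) • V) Δ G' E' →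
      ‖groundAverage G' S - groundAverage G S - t * -(linearResponse H V S G E +
        starRingEnd ℂ (linearResponse H V S G E))‖ ≤ K * t ^ 2 := by
  set P := groundProj G with hP
  have hPP : P * P = P := hG.proj_mul_proj
  -- `Z X` is the error made when `P'` is replaced by `P` in the exact first-order formula; it is
  -- linear in `X = P' - P`, hence of order `t`.
  set Z : Matrix ι ι ℂ → ℂ := fun X =>
    ∑ a, star (G a) ⬝ᵥ ((S * reducedResolvent H G (E a) * (V * X - X * V)) *ᵥ G a) with hZ
  set C₁ := ∑ a, ‖S * reducedResolvent H G (E a)‖ * (2 * ‖V‖) with hC₁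
  set c := Fintype.card ι * ‖V‖ / Δ with hc
  set K₂ := Fintype.card ι * ((‖1 - P‖ * ‖1 - P‖ + ‖P‖ * ‖P‖) * ‖S‖) with hK₂
  have hc0 : 0 ≤ c := by positivity
  refine ⟨1 / d * (2 * (C₁ * c) + K₂ * c ^ 2), by positivity, fun t G' E' hG' => ?_⟩
  have hH' : (H + (t : ℂ) • V).IsHermitian := isHermitian_add_smul hH hV t
  set P' := groundProj G' with hP'
  have hPP' : P' * P' = P' := hG'.proj_mul_proj
  set X := P' - P with hX
  have hXn : ‖X‖ ≤ c * |t| := by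
    refine (hG.norm_proj_sub_le hH hG' hH' hd hΔ).trans (le_of_eq ?_)
    rw [add_sub_cancel_left, norm_smul, Complex.norm_real, Real.norm_eq_abs, hc]
    ring
  have hZX : ‖Z X‖ ≤ C₁ * (c * |t|) := by
    rw [hC₁, Finset.sum_mul]
    refine (norm_sum_le _ _).trans (Finset.sum_le_sum fun a _ => ?_)
    refine (norm_dotProduct_mulVec_le _ (by rw [hG.orthonormal, if_pos rfl])).trans ?_
    refine (norm_mul_le _ _).trans ?_
    rw [mul_assoc]
    gcongr
    calc ‖V * X - X * V‖ ≤ ‖V‖ * ‖X‖ + ‖X‖ * ‖V‖ :=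
          (norm_sub_le _ _).trans (add_le_add (norm_mul_le _ _) (norm_mul_le _ _))
      _ = 2 * ‖V‖ * ‖X‖ := by ring
      _ ≤ _ := by gcongr
  -- `Y` is the block-diagonal part of `X`. As `P` and `P'` are both projections, it is quadratic in
  -- `X`, so only the off-diagonal blocks count at first order.
  set Y := (1 - P) * (X * X) * (1 - P) - P * (X * X) * P with hY
  have hYn : ‖(Y * S).trace‖ ≤ K₂ * c ^ 2 * t ^ 2 := by
    have h1 : ‖X‖ * ‖X‖ ≤ c ^ 2 * t ^ 2 := by
      calc _ ≤ (c * |t|) * (c * |t|) := by gcongr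
        _ = c ^ 2 * |t| ^ 2 := by ring
        _ = _ := by rw [sq_abs]
    have h2 : ‖Y‖ ≤ (‖1 - P‖ * ‖1 - P‖ + ‖P‖ * ‖P‖) * (‖X‖ * ‖X‖) := by
      have h3 : ∀ A : Matrix ι ι ℂ, ‖A * (X * X) * A‖ ≤ ‖A‖ * ‖A‖ * (‖X‖ * ‖X‖) := fun A => by
        calc _ ≤ ‖A‖ * (‖X‖ * ‖X‖) * ‖A‖ := (norm_mul_le _ _).trans (by
              gcongr
              exact (norm_mul_le _ _).trans (by gcongr; exact norm_mul_le _ _))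
          _ = _ := by ring
      rw [add_mul]
      exact (norm_sub_le _ _).trans (add_le_add (h3 _) (h3 _))
    calc _ ≤ Fintype.card ι * (‖Y‖ * ‖S‖) := (norm_trace_le _).trans (by
          gcongr; exact norm_mul_le _ _)
      _ ≤ Fintype.card ι * (((‖1 - P‖ * ‖1 - P‖ + ‖P‖ * ‖P‖) * (c ^ 2 * t ^ 2)) * ‖S‖) := by
          gcongr
          exact h2.trans (by gcongr)
      _ = _ := by rw [hK₂]; ring
  have hdec : X = (1 - P) * P' * P + P * P' * (1 - P) + Y := by
    have h1 : (1 - P) * X = (1 - P) * P' := by rw [hX, mul_sub, hG.one_sub_mul_proj, sub_zero]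
    have h2 : X * (1 - P) = P' * (1 - P) := by rw [hX, sub_mul, hG.proj_mul_one_sub, sub_zero]
    have h3 : P * X = P * P' - P := by rw [hX, mul_sub, hPP]
    have h4 : X * P = P' * P - P := by rw [hX, sub_mul, hPP]
    have h5 : Y = (1 - P) * X * (X * (1 - P)) - P * X * (X * P) := by
      rw [hY]; simp only [mul_assoc]
    have h6 : (1 - P) * P' * (P' * (1 - P)) = (1 - P) * P' * (1 - P) := by
      rw [← mul_assoc, mul_assoc (1 - P) P' P', hPP']
    have h7 : (P * P' - P) * (P' * P - P) = P - P * P' * P := by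
      rw [sub_mul, mul_sub, mul_sub, ← mul_assoc (P * P'), mul_assoc P P' P', hPP', ← mul_assoc P P',
        hPP]
      abel
    rw [h5, h1, h2, h3, h4, h6, h7, hX]
    noncomm_ring
  have hR : ∀ a, star (G a) ⬝ᵥ ((S * reducedResolvent H G (E a) * (V * P - P * V)) *ᵥ G a) =
      star (G a) ⬝ᵥ ((S * reducedResolvent H G (E a) * V) *ᵥ G a) := fun a => by
    rw [mul_sub, mul_assoc S _ (P * V), ← mul_assoc _ P V, hG.reducedResolvent_mul_proj hH hΔ,
      zero_mul, mul_zero, sub_zero, ← mul_assoc, ← Matrix.mulVec_mulVec, hG.proj_mulVec]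
  have htr : ((1 - P) * P' * P * S).trace = -(t * (d * linearResponse H V S G E + Z X)) := by
    have h1 : ((1 - P) * P' * P * S).trace = (P * (S * ((1 - P) * P'))).trace := by
      rw [mul_assoc, Matrix.trace_mul_comm, mul_assoc]
    have hd0 : (d : ℂ) ≠ 0 := by exact_mod_cast hd.ne'
    rw [h1, trace_groundProj_mul, linearResponse, ← mul_assoc (d : ℂ), mul_one_div_cancel hd0, one_mul, hZ]
    simp only
    rw [← Finset.sum_add_distrib, Finset.mul_sum, ← Finset.sum_neg_distrib]
    refine Finset.sum_congr rfl fun a _ => ?_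
    rw [← hR, ← dotProduct_add, ← Matrix.add_mulVec, ← mul_add, ← Matrix.mulVec_mulVec,
      ← Matrix.mulVec_mulVec, hG.one_sub_mul_proj'_mulVec hH hΔ hG' hH', Matrix.mulVec_neg,
      dotProduct_neg, Matrix.mulVec_smul, dotProduct_smul, smul_eq_mul,
      Matrix.mulVec_mulVec, Matrix.mulVec_mulVec]
    have h2 : V * groundProj G' - groundProj G' * V = V * P - P * V + (V * X - X * V) := by
      rw [hX]; noncomm_ring
    rw [h2]
  have htr' : (P * P' * (1 - P) * S).trace = starRingEnd ℂ ((1 - P) * P' * P * S).trace := by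
    rw [← Complex.star_def, ← Matrix.trace_conjTranspose, Matrix.conjTranspose_mul,
      Matrix.conjTranspose_mul, Matrix.conjTranspose_mul, hS.eq, (groundProj_isHermitian G).eq,
      (groundProj_isHermitian G').eq, Matrix.conjTranspose_sub, Matrix.conjTranspose_one,
      (groundProj_isHermitian G).eq, Matrix.trace_mul_comm S, mul_assoc P]
  have hmain : groundAverage G' S - groundAverage G S - t * -(linearResponse H V S G E +
        starRingEnd ℂ (linearResponse H V S G E)) =
      1 / (d : ℂ) * (-(t * Z X) - t * starRingEnd ℂ (Z X) + (Y * S).trace) := by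
    have hd0 : (d : ℂ) ≠ 0 := by exact_mod_cast hd.ne'
    rw [groundAverage_eq_trace, groundAverage_eq_trace, ← mul_sub, ← Matrix.trace_sub, ← sub_mul,
      ← hP, ← hP', ← hX, congrArg (fun A => (A * S).trace) hdec]
    rw [add_mul, add_mul, Matrix.trace_add, Matrix.trace_add, htr', htr]
    simp only [map_neg, map_mul, map_add, Complex.conj_ofReal, map_natCast]
    field_simp
    ring
  rw [hmain, norm_mul, norm_div, norm_one, Complex.norm_natCast, mul_assoc]
  gcongr
  calc _ ≤ |t| * ‖Z X‖ + |t| * ‖Z X‖ + ‖(Y * S).trace‖ := by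
        refine (norm_add_le _ _).trans (add_le_add ((norm_sub_le _ _).trans (le_of_eq ?_)) le_rfl)
        rw [norm_neg, norm_mul, norm_mul, Complex.norm_real, Real.norm_eq_abs, Complex.norm_conj]
    _ ≤ |t| * (C₁ * (c * |t|)) + |t| * (C₁ * (c * |t|)) + K₂ * c ^ 2 * t ^ 2 := by gcongr
    _ = (2 * (C₁ * c)) * |t| ^ 2 + K₂ * c ^ 2 * t ^ 2 := by ring
    _ = _ := by rw [sq_abs]; ring

end IsGroundManifold

/-- The derivative of a ground-state average along a gapped path. -/
theorem hasDerivWithinAt_groundAverage {G : ℝ → Fin d → ι → ℂ} {E : ℝ → Fin d → ℝ}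
    (hH : H.IsHermitian) (hV : V.IsHermitian) (hS : S.IsHermitian) (hΔ : 0 < Δ) (hd : 0 < d)
    (hG : IsGappedPath H V Δ G E) {u : ℝ} (hu : u ∈ Set.Icc (0 : ℝ) 1) :
    HasDerivWithinAt (fun x => groundAverage (G x) S)
      (-(linearResponse (H + (u : ℂ) • V) V S (G u) (E u) +
        starRingEnd ℂ (linearResponse (H + (u : ℂ) • V) V S (G u) (E u)))) (Set.Icc 0 1) u := by
  have hHu : (H + (u : ℂ) • V).IsHermitian := isHermitian_add_smul hH hV u
  obtain ⟨K, hK, h⟩ := (hG u hu).exists_norm_groundAverage_sub_le hHu hV hS hΔ hd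
  rw [hasDerivWithinAt_iff_isLittleO]
  have h1 : (fun x : ℝ => groundAverage (G x) S - groundAverage (G u) S - (x - u) •
      (-(linearResponse (H + (u : ℂ) • V) V S (G u) (E u) +
        starRingEnd ℂ (linearResponse (H + (u : ℂ) • V) V S (G u) (E u)))))
      =O[nhdsWithin u (Set.Icc 0 1)] fun x => (x - u) ^ 2 := by
    refine Asymptotics.IsBigO.of_bound K ?_
    filter_upwards [self_mem_nhdsWithin] with x hx
    have e : H + (u : ℂ) • V + ((x - u : ℝ) : ℂ) • V = H + (x : ℂ) • V := by
      rw [add_assoc, ← add_smul]; congr 2; push_cast; ring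
    have h2 := h (x - u) (G x) (E x) (by rw [e]; exact hG x hx)
    rwa [Real.norm_eq_abs, abs_of_nonneg (sq_nonneg _), Complex.real_smul]
  refine h1.trans_isLittleO ?_
  have h3 : (fun x : ℝ => x - u) =o[nhdsWithin u (Set.Icc 0 1)] fun _ => (1 : ℝ) := by
    rw [Asymptotics.isLittleO_one_iff]
    have : Filter.Tendsto (fun x : ℝ => x - u) (nhds u) (nhds (u - u)) :=
      (continuous_id.sub continuous_const).tendsto u
    rw [sub_self] at this
    exact this.mono_left nhdsWithin_le_nhds
  have h4 := (Asymptotics.isBigO_refl (fun x : ℝ => x - u) (nhdsWithin u (Set.Icc 0 1))).mul_isLittleO h3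
  simpa [pow_two] using h4

end GroundManifold

/-! ### Linear response as a resolvent sum -/

section SpectralRepresentation

variable {ι : Type} [Fintype ι] [DecidableEq ι] {d : ℕ} {H V S : Matrix ι ι ℂ} {Δ : ℝ}
  {G : Fin d → ι → ℂ} {E : Fin d → ℝ}

lemma pow_mulVec_of_eigen {A : Matrix ι ι ℂ} {v : ι → ℂ} {e : ℂ} (h : A *ᵥ v = e • v) (n : ℕ) :
    A ^ n *ᵥ v = e ^ n • v := by
  induction n with
  | zero => simp
  | succ n ih => rw [pow_succ', ← Matrix.mulVec_mulVec, ih, Matrix.mulVec_smul, h, smul_smul, pow_succ]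

lemma evo_mulVec {v : ι → ℂ} {e : ℝ} (h : H *ᵥ v = (e : ℂ) • v) (t : ℝ) :
    evo H t *ᵥ v = Complex.exp (Complex.I * e * t) • v := by
  have h1 : ((Complex.I * (t : ℂ)) • H) *ᵥ v = (Complex.I * e * t) • v := by
    rw [Matrix.smul_mulVec, h, smul_smul]; congr 1; ring
  have h2 := NormedSpace.exp_series_hasSum_exp' (𝕂 := ℂ) ((Complex.I * (t : ℂ)) • H)
  have h3 := NormedSpace.exp_series_hasSum_exp' (𝕂 := ℂ) (Complex.I * e * t)
  rw [← Complex.exp_eq_exp_ℂ] at h3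
  have hc : Continuous fun A : Matrix ι ι ℂ => A *ᵥ v := by fun_prop
  have h4 := h2.map (⟨⟨fun A => A *ᵥ v, Matrix.zero_mulVec v⟩, fun A B => Matrix.add_mulVec A B v⟩ :
    Matrix ι ι ℂ →+ (ι → ℂ)) hc
  have h5 := h3.smul_const v
  refine h4.unique (h5.congr_fun fun n => ?_) 
  simp only [Function.comp_apply, AddMonoidHom.coe_mk, ZeroHom.coe_mk]
  rw [Matrix.smul_mulVec, pow_mulVec_of_eigen h1, smul_smul, smul_eq_mul]

lemma dotProduct_evo_mulVec (hH : H.IsHermitian) {u : ι → ℂ} {e : ℝ} (h : H *ᵥ u = (e : ℂ) • u)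
    (t : ℝ) (x : ι → ℂ) :
    star u ⬝ᵥ (evo H t *ᵥ x) = Complex.exp (Complex.I * e * t) * (star u ⬝ᵥ x) := by
  have h1 : (evo H (-t))ᴴ = evo H t := by
    rw [← Matrix.star_eq_conjTranspose, star_evo hH, neg_neg]
  rw [← h1, Matrix.dotProduct_mulVec, ← Matrix.star_mulVec, evo_mulVec h, star_smul,
    smul_dotProduct, smul_eq_mul]
  congr 1
  rw [Complex.star_def, ← Complex.exp_conj]
  congr 1
  simp

lemma dotProduct_heisenberg_mulVec (hH : H.IsHermitian) {u v : ι → ℂ} {e f : ℝ}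
    (hu : H *ᵥ u = (e : ℂ) • u) (hv : H *ᵥ v = (f : ℂ) • v) (A : Matrix ι ι ℂ) (t : ℝ) :
    star u ⬝ᵥ (heisenberg H A t *ᵥ v) =
      Complex.exp (-(Complex.I * (f - e : ℝ) * t)) * (star u ⬝ᵥ (A *ᵥ v)) := by
  rw [heisenberg_eq, ← Matrix.mulVec_mulVec, ← Matrix.mulVec_mulVec, evo_mulVec hv,
    Matrix.mulVec_smul, Matrix.mulVec_smul, dotProduct_smul, smul_eq_mul,
    dotProduct_evo_mulVec hH hu, ← mul_assoc, ← Complex.exp_add]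
  congr 2
  push_cast
  ring

namespace IsGroundManifold

/-- Every eigenvector of `H` lies either in the ground-state manifold or in its orthogonal
complement. -/
lemma proj_mulVec_eq_zero_or (hG : IsGroundManifold H Δ G E) (hH : H.IsHermitian) (hΔ : 0 < Δ)
    {v : ι → ℂ} {e : ℝ} (hv : H *ᵥ v = (e : ℂ) • v) :
    groundProj G *ᵥ v = 0 ∨ (1 - groundProj G) *ᵥ v = 0 := by
  by_contra! hc
  have hHP : H * (1 - groundProj G) = (1 - groundProj G) * H := by
    rw [mul_sub, sub_mul, hG.mul_proj hH, mul_one, one_mul]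
  have h1 : ∃ b, star (G b) ⬝ᵥ v ≠ 0 := by
    by_contra! h
    refine hc.1 ?_
    rw [groundProj_mulVec]
    simp [h]
  obtain ⟨b, hb⟩ := h1
  have h2 : (e : ℂ) * (star (G b) ⬝ᵥ v) = E b * (star (G b) ⬝ᵥ v) := by
    have h3 : star (G b) ⬝ᵥ (H *ᵥ v) = E b * (star (G b) ⬝ᵥ v) := by
      conv_lhs => rw [← hH.eq]
      rw [Matrix.dotProduct_mulVec, ← Matrix.star_mulVec, hG.eigen, star_smul, smul_dotProduct]
      simp
    rw [← h3, hv, dotProduct_smul, smul_eq_mul]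
  -- Nonzero overlap with `G b` forces the energy `E b`, while a nonzero component outside the
  -- manifold would have to lie at least `Δ` above it.
  have h3 : e = E b := by exact_mod_cast mul_right_cancel₀ hb h2
  have h4 := hG.gap _ e hc.2 (hG.dotProduct_eq_zero (by
    rw [Matrix.mulVec_mulVec, hG.proj_mul_one_sub, Matrix.zero_mulVec])) (by
    rw [Matrix.mulVec_mulVec, hHP, ← Matrix.mulVec_mulVec, hv, Matrix.mulVec_smul]) b
  linarith

end IsGroundManifold

lemma exists_eigenbasis (hH : H.IsHermitian) : ∃ (v : ι → ι → ℂ) (e : ι → ℝ),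
    (∀ n, H *ᵥ v n = (e n : ℂ) • v n) ∧ (∀ n, v n ≠ 0) ∧
      ∑ n, Matrix.vecMulVec (v n) (star (v n)) = 1 := by
  refine ⟨fun n => ⇑(hH.eigenvectorBasis n), hH.eigenvalues, fun n => ?_, fun n h => ?_, ?_⟩
  · simp only
    rw [hH.mulVec_eigenvectorBasis n]
    ext j
    simp
  · have h2 := hH.eigenvectorBasis.toBasis.ne_zero n
    rw [OrthonormalBasis.coe_toBasis] at h2
    exact h2 (by ext j; exact congrFun h j)
  · have h := Unitary.mul_star_self_of_mem hH.eigenvectorUnitary.2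
    ext i j
    have h1 := congrFun (congrFun h i) j
    rw [Matrix.mul_apply] at h1
    rw [← h1, Matrix.sum_apply]
    refine Finset.sum_congr rfl fun n _ => ?_
    rw [Matrix.vecMulVec_apply, Matrix.star_apply, hH.eigenvectorUnitary_apply,
      hH.eigenvectorUnitary_apply]
    rfl

/-- The linear response is the value at zero of a resolvent sum whose phase sum is bounded by the
commutator of the observable, at time `t`, and the perturbation. -/
theorem IsGroundManifold.exists_resolventSum_eq (hG : IsGroundManifold H Δ G E)
    (hH : H.IsHermitian) (hV : V.IsHermitian) (hS : S.IsHermitian) (hΔ : 0 < Δ) (hd : 0 < d) :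
    ∃ (J : Type) (_ : Fintype J) (c : J → ℂ) (w : J → ℝ), (∀ j, Δ ≤ |w j|) ∧
      (∀ t, ‖phaseSum c w t‖ ≤ ‖heisenberg H S t * V - V * heisenberg H S t‖) ∧
      resolventSum c w 0 = linearResponse H V S G E + starRingEnd ℂ (linearResponse H V S G E) := by
  set P := groundProj G with hP
  obtain ⟨v, e, hHv, hv0, hsum⟩ := exists_eigenbasis hH
  have hχ : ∀ n, ∃ χ : ℂ, (χ = 1 ∧ P *ᵥ v n = 0) ∨ (χ = 0 ∧ (1 - P) *ᵥ v n = 0) := fun n => by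
    rcases hG.proj_mulVec_eq_zero_or hH hΔ (hHv n) with h | h
    · exact ⟨1, Or.inl ⟨rfl, h⟩⟩
    · exact ⟨0, Or.inr ⟨rfl, h⟩⟩
  choose χ hχ using hχ
  have hQ : 1 - P = ∑ n, χ n • Matrix.vecMulVec (v n) (star (v n)) := by
    rw [← mul_one (1 - P), ← hsum, Finset.mul_sum]
    refine Finset.sum_congr rfl fun n _ => ?_
    rw [hsum, Matrix.mul_vecMulVec]
    rcases hχ n with ⟨h1, h2⟩ | ⟨h1, h2⟩
    · rw [h1, one_smul, Matrix.sub_mulVec, Matrix.one_mulVec, h2, sub_zero]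
    · rw [h1, zero_smul, h2, Matrix.zero_vecMulVec]
  -- For states inside the manifold the frequency is a dummy value `Δ`: their coefficient `χ n` is
  -- zero.
  have hω : ∀ (a : Fin d) n, ∃ ω : ℝ, Δ ≤ |ω| ∧ (χ n = 0 ∨ (χ n = 1 ∧ ω = e n - E a)) := by
    intro a n
    rcases hχ n with ⟨h1, h2⟩ | ⟨h1, h2⟩
    · refine ⟨e n - E a, ?_, Or.inr ⟨h1, rfl⟩⟩
      have := hG.gap (v n) (e n) (hv0 n) (hG.dotProduct_eq_zero h2) (hHv n) a
      exact le_trans (by linarith) (le_abs_self _)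
    · exact ⟨Δ, le_abs_self _, Or.inl h1⟩
  choose ω hωΔ hω using hω
  set c : Fin d × ι → ℂ := fun p => 1 / (d : ℂ) * (χ p.2 * (star (G p.1) ⬝ᵥ (S *ᵥ v p.2)) *
    (star (v p.2) ⬝ᵥ (V *ᵥ G p.1))) with hc
  set w : Fin d × ι → ℝ := fun p => ω p.1 p.2 with hw
  have hQV : ∀ a, (1 - P) *ᵥ (V *ᵥ G a) = ∑ n, (χ n * (star (v n) ⬝ᵥ (V *ᵥ G a))) • v n := by
    intro a
    rw [hQ, Matrix.sum_mulVec]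
    refine Finset.sum_congr rfl fun n _ => ?_
    rw [Matrix.smul_mulVec, Matrix.vecMulVec_mulVec, ← smul_smul]
    congr 1
    ext i
    simp [mul_comm]
  have hPv : ∀ n, χ n • (P *ᵥ v n) = 0 := fun n => by
    rcases hχ n with ⟨_, h2⟩ | ⟨h1, _⟩
    · rw [h2, smul_zero]
    · rw [h1, zero_smul]
  have hresp : ∀ a, reducedResolvent H G (E a) *ᵥ (V *ᵥ G a) =
      ∑ n, (χ n * (star (v n) ⬝ᵥ (V *ᵥ G a)) / (ω a n : ℂ)) • v n := by
    intro a
    refine hG.eq_reducedResolvent_mulVec hH hΔ ?_ ?_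
    · rw [Matrix.mulVec_sum]
      refine Finset.sum_eq_zero fun n _ => ?_
      rw [Matrix.mulVec_smul, mul_div_assoc, mul_comm, ← smul_smul, hPv, smul_zero]
    · rw [← hP, hQV, Matrix.mulVec_sum, Finset.smul_sum, ← Finset.sum_sub_distrib]
      refine Finset.sum_congr rfl fun n _ => ?_
      rw [Matrix.mulVec_smul, hHv, smul_smul, smul_smul, ← sub_smul]
      congr 1
      rcases hω a n with h | ⟨_, h⟩
      · rw [h]; simp
      · have h0 : (ω a n : ℂ) ≠ 0 := by
          have := hωΔ a n
          intro h0
          rw [Complex.ofReal_eq_zero.1 h0, abs_zero] at this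
          linarith
        have h1 : (ω a n : ℂ) = e n - E a := by rw [h]; push_cast; rfl
        field_simp
        rw [h1]
  have hLR : linearResponse H V S G E = ∑ p, c p / (w p : ℂ) := by
    rw [Fintype.sum_prod_type, linearResponse, Finset.mul_sum]
    refine Finset.sum_congr rfl fun a _ => ?_
    rw [← Matrix.mulVec_mulVec, ← Matrix.mulVec_mulVec, hresp, Matrix.mulVec_sum, dotProduct_sum,
      Finset.mul_sum]
    refine Finset.sum_congr rfl fun n _ => ?_
    rw [Matrix.mulVec_smul, dotProduct_smul, smul_eq_mul, hc, hw]
    ring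
  have htr : ∀ t, 1 / (d : ℂ) * (P * (heisenberg H S t * (1 - P) * V)).trace =
      ∑ p, c p * Complex.exp (-(Complex.I * w p * t)) := by
    intro t
    rw [Fintype.sum_prod_type, trace_groundProj_mul, Finset.mul_sum]
    refine Finset.sum_congr rfl fun a _ => ?_
    rw [← Matrix.mulVec_mulVec, ← Matrix.mulVec_mulVec, hQV, Matrix.mulVec_sum, dotProduct_sum,
      Finset.mul_sum]
    refine Finset.sum_congr rfl fun n _ => ?_
    rw [Matrix.mulVec_smul, dotProduct_smul, smul_eq_mul,
      dotProduct_heisenberg_mulVec hH (hG.eigen a) (hHv n), hc, hw]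
    rcases hω a n with h | ⟨_, h⟩
    · simp only [h]; ring
    · simp only [h]; ring
  -- The second family `-c̄`, `-w` adds the complex conjugate at `z = 0` and subtracts it in the
  -- phase sum, which thereby becomes the average of a commutator.
  refine ⟨(Fin d × ι) ⊕ (Fin d × ι), inferInstance, Sum.elim c fun p => -starRingEnd ℂ (c p),
    Sum.elim w fun p => -w p, ?_, ?_, ?_⟩
  · rintro (p | p)
    · exact hωΔ p.1 p.2
    · simp only [Sum.elim_inr, abs_neg]
      exact hωΔ p.1 p.2
  · intro t
    set St := heisenberg H S t with hSt
    have hSth : Stᴴ = St := (heisenberg_isHermitian hH hS t).eq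
    have hPh : Pᴴ = P := (groundProj_isHermitian G).eq
    have e1 : phaseSum (Sum.elim c fun p => -starRingEnd ℂ (c p)) (Sum.elim w fun p => -w p) t =
        1 / (d : ℂ) * (P * (St * V - V * St)).trace := by
      have h1 : phaseSum (Sum.elim c fun p => -starRingEnd ℂ (c p)) (Sum.elim w fun p => -w p) t =
          (∑ p, c p * Complex.exp (-(Complex.I * w p * t))) -
            starRingEnd ℂ (∑ p, c p * Complex.exp (-(Complex.I * w p * t))) := by
        unfold phaseSum
        rw [Fintype.sum_sum_type, map_sum, sub_eq_add_neg, ← Finset.sum_neg_distrib]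
        simp only [Sum.elim_inl, Sum.elim_inr]
        congr 1
        refine Finset.sum_congr rfl fun p _ => ?_
        rw [map_mul _ (c p), ← Complex.exp_conj, neg_mul]
        congr 3
        simp
      have hconj : ∀ X : Matrix ι ι ℂ, starRingEnd ℂ (1 / (d : ℂ) * X.trace) =
          1 / (d : ℂ) * Xᴴ.trace := fun X => by
        rw [Matrix.trace_conjTranspose, map_mul, map_div₀, map_one, map_natCast, Complex.star_def]
      rw [h1, ← htr, hconj]
      have h2 : (P * (St * (1 - P) * V))ᴴ = V * (1 - P) * St * P := by
        rw [Matrix.conjTranspose_mul, Matrix.conjTranspose_mul, Matrix.conjTranspose_mul, hSth, hV.eq,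
          Matrix.conjTranspose_sub, Matrix.conjTranspose_one, hPh, ← mul_assoc]
      rw [h2, ← mul_sub]
      congr 1
      -- Intermediate states inside the manifold contribute the trace of `P St P V` minus that of `P
      -- V P St`, which is zero by cyclicity. For this the weights of the ground states must be
      -- equal.
      have h4 : (P * (St * V - V * St)).trace = (P * (St * (1 - P) * V)).trace -
          (P * (V * (1 - P) * St)).trace + ((P * St * (P * V)).trace - (P * V * (P * St)).trace) := by
        rw [← Matrix.trace_sub, ← Matrix.trace_sub, ← Matrix.trace_add]
        congr 1
        noncomm_ring
      rw [h4, Matrix.trace_mul_comm (P * St), sub_self, add_zero,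
        Matrix.trace_mul_comm (V * (1 - P) * St)]
    rw [e1, norm_mul, norm_div, norm_one, Complex.norm_natCast, trace_groundProj_mul,
      one_div_mul_eq_div, div_le_iff₀ (by exact_mod_cast hd), mul_comm, ← nsmul_eq_mul]
    refine (norm_sum_le _ _).trans ((Finset.sum_le_card_nsmul _ _ _ fun a _ =>
      norm_dotProduct_mulVec_le _ (by rw [hG.orthonormal, if_pos rfl])).trans (le_of_eq ?_))
    rw [Finset.card_univ, Fintype.card_fin]
  · unfold resolventSum
    rw [Fintype.sum_sum_type, hLR, map_sum]
    simp only [Sum.elim_inl, Sum.elim_inr, sub_zero]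
    congr 1
    refine Finset.sum_congr rfl fun p _ => ?_
    rw [map_div₀, Complex.conj_ofReal, Complex.ofReal_neg, neg_div_neg_eq]

end SpectralRepresentation

/-! ### From commutator bounds to bounds on the response -/

section PerturbedEvolution

variable {ι : Type} [Fintype ι] [DecidableEq ι] {d : ℕ} {H V S : Matrix ι ι ℂ} {Δ : ℝ}

/-- The Hamiltonian is perturbed by a multiple of `V`, so the Duhamel integrand is the very
commutator of the evolved `S` with `V` that is already bounded by `b'`. -/
lemma norm_commutator_heisenberg_add_smul_le_of_nonneg (hH : H.IsHermitian) (hV : V.IsHermitian)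
    {c : ℝ} (hc : |c| ≤ 1) {b b' : ℝ → ℝ} (hb : ∀ s, HasDerivAt b (b' s) s) {t : ℝ} (ht : 0 ≤ t)
    (h : ∀ s ∈ Set.Icc 0 t, ‖heisenberg H S s * V - V * heisenberg H S s‖ ≤ b' s) :
    ‖heisenberg (H + (c : ℂ) • V) S t * V - V * heisenberg (H + (c : ℂ) • V) S t‖ ≤
      b' t + 2 * ‖V‖ * (b t - b 0) := by
  set H' := H + (c : ℂ) • V with hH'
  have h1 : ‖heisenberg H' S t - heisenberg H S t‖ ≤ b t - b 0 := by
    refine norm_heisenberg_sub_le (isHermitian_add_smul hH hV c) S ht hb fun s hs => ?_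
    rw [add_sub_cancel_left, Matrix.smul_mul, Matrix.mul_smul, ← smul_sub, norm_smul,
      Complex.norm_real, Real.norm_eq_abs, norm_sub_rev]
    exact (mul_le_of_le_one_left (norm_nonneg _) hc).trans (h s hs)
  have h2 : heisenberg H' S t * V - V * heisenberg H' S t =
      (heisenberg H S t * V - V * heisenberg H S t) +
      ((heisenberg H' S t - heisenberg H S t) * V - V * (heisenberg H' S t - heisenberg H S t)) := by
    noncomm_ring
  rw [h2]
  refine (norm_add_le _ _).trans (add_le_add (h t ⟨ht, le_rfl⟩) ?_)
  refine (norm_commutator_le _ _).trans ?_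
  calc _ = 2 * ‖V‖ * ‖heisenberg H' S t - heisenberg H S t‖ := by ring
    _ ≤ _ := by gcongr

/-- A bound for the growth of commutators under `H` gives one under `H + c V`. -/
lemma norm_commutator_heisenberg_add_smul_le (hH : H.IsHermitian) (hV : V.IsHermitian)
    {c : ℝ} (hc : |c| ≤ 1) {b b' : ℝ → ℝ} (hb : ∀ s, HasDerivAt b (b' s) s)
    (h : ∀ s, ‖heisenberg H S s * V - V * heisenberg H S s‖ ≤ b' |s|) (t : ℝ) :
    ‖heisenberg (H + (c : ℂ) • V) S t * V - V * heisenberg (H + (c : ℂ) • V) S t‖ ≤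
      b' |t| + 2 * ‖V‖ * (b |t| - b 0) := by
  rcases le_total 0 t with ht | ht
  · rw [abs_of_nonneg ht]
    refine norm_commutator_heisenberg_add_smul_le_of_nonneg hH hV hc hb ht fun s hs => ?_
    have := h s
    rwa [abs_of_nonneg hs.1] at this
  · rw [abs_of_nonpos ht]
    have h1 := norm_commutator_heisenberg_add_smul_le_of_nonneg (S := S) (c := -c) hH.neg hV
      (by rwa [abs_neg]) hb (neg_nonneg.2 ht) (fun s hs => by
        have := h (-s)
        rwa [abs_neg, abs_of_nonneg hs.1, heisenberg_neg_time] at this)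
    have e : -H + ((-c : ℝ) : ℂ) • V = -(H + (c : ℂ) • V) := by
      rw [Complex.ofReal_neg, neg_smul, neg_add]
    rwa [e, ← heisenberg_neg_time, neg_neg] at h1

lemma norm_groundAverage_sub_le {G : ℝ → Fin d → ι → ℂ} {E : ℝ → Fin d → ℝ}
    (hH : H.IsHermitian) (hV : V.IsHermitian) (hS : S.IsHermitian) (hΔ : 0 < Δ) (hd : 0 < d)
    (hG : IsGappedPath H V Δ G E) {g : ℝ → ℝ} {M : ℝ}
    (hg : ∀ u ∈ Set.Icc (0 : ℝ) 1, ∀ t, ‖heisenberg (H + (u : ℂ) • V) S t * V -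
      V * heisenberg (H + (u : ℂ) • V) S t‖ ≤ g t)
    (hM : ∀ (J : Type) [Fintype J] (c : J → ℂ) (w : J → ℝ), (∀ j, Δ ≤ |w j|) →
      (∀ t, ‖phaseSum c w t‖ ≤ g t) → ‖resolventSum c w 0‖ ≤ M) :
    ‖groundAverage (G 1) S - groundAverage (G 0) S‖ ≤ M := by
  have h := Convex.norm_image_sub_le_of_norm_hasDerivWithin_le (C := M)
    (fun u hu => hasDerivWithinAt_groundAverage hH hV hS hΔ hd hG hu) (fun u hu => ?_)
    (convex_Icc 0 1) (Set.left_mem_Icc.2 zero_le_one) (Set.right_mem_Icc.2 zero_le_one)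
  · simpa using h
  · obtain ⟨J, hJ, c, w, h1, h2, h3⟩ :=
      (hG u hu).exists_resolventSum_eq (isHermitian_add_smul hH hV u) hV hS hΔ hd
    rw [norm_neg, ← h3]
    exact hM J c w h1 fun t => (h2 t).trans (hg u hu t)

/-- The front bound survives the passage to `H + u V`, since its time integral has the same form
with an additional `1 / v`; for late times the trivial bound `2 ‖S‖ ‖V‖` replaces it. -/
lemma exists_norm_groundAverage_sub_le_of_front {v Δ : ℝ} (hv : 0 < v) (hΔ : 0 < Δ) :
    ∃ K : ℝ, 0 < K ∧ ∀ {ι : Type} [Fintype ι] [DecidableEq ι] {d : ℕ} {H V S : Matrix ι ι ℂ}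
      {G : ℝ → Fin d → ι → ℂ} {E : ℝ → Fin d → ℝ} {s w K₀ T : ℝ},
      H.IsHermitian → V.IsHermitian → S.IsHermitian → 0 < d → IsGappedPath H V Δ G E →
      ‖S‖ ≤ s → ‖V‖ ≤ w → 0 ≤ K₀ → 0 ≤ T →
      (∀ t, ‖heisenberg H S t * V - V * heisenberg H S t‖ ≤ K₀ * Real.exp (v * (|t| - T))) →
      ‖groundAverage (G 1) S - groundAverage (G 0) S‖ ≤
        (2 * s * w + K₀ * (1 + 2 * w / v)) * K * (1 + T) * Real.exp
          (-(2 * v / Real.pi * Real.arcsin (Real.tanh (Δ * Real.pi / (2 * v))) * T)) := by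
  obtain ⟨K, hK, h⟩ := exists_norm_resolventSum_zero_le_of_front hv hΔ
  refine ⟨K, hK, ?_⟩
  intro ι _ _ d H V S G E s w K₀ T hH hV hS hd hG hs hw hK₀ hT hlr
  have hs0 : 0 ≤ s := (norm_nonneg S).trans hs
  have hw0 : 0 ≤ w := (norm_nonneg V).trans hw
  set B := 2 * s * w + K₀ * (1 + 2 * w / v) with hB
  have hB1 : K₀ * (1 + 2 * w / v) ≤ B := le_add_of_nonneg_left (by positivity)
  have hB2 : 2 * s * w ≤ B := le_add_of_nonneg_right (by positivity)
  refine norm_groundAverage_sub_le (g := fun t => B * min 1 (Real.exp (v * (|t| - T))))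
    hH hV hS hΔ hd hG (fun u hu t => ?_)
    (fun J _ c w' h1 h2 => h c w' B T (by positivity) hT h1 h2)
  have hHu := isHermitian_add_smul hH hV u
  have h1 := norm_commutator_heisenberg_add_smul_le (S := S) hH hV (c := u)
    (by rw [abs_of_nonneg hu.1]; exact hu.2)
    (b := fun t => K₀ / v * Real.exp (v * (t - T))) (b' := fun t => K₀ * Real.exp (v * (t - T)))
    (fun t => by
      have h2 : HasDerivAt (fun t => v * (t - T)) v t := by
        simpa using ((hasDerivAt_id t).sub_const T).const_mul v
      refine (h2.exp.const_mul (K₀ / v)).congr_deriv ?_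
      field_simp) hlr t
  rcases min_cases 1 (Real.exp (v * (|t| - T))) with ⟨h2, _⟩ | ⟨h2, _⟩
  · rw [h2, mul_one]
    refine (norm_commutator_le _ _).trans (le_trans ?_ hB2)
    rw [norm_heisenberg hHu]
    gcongr
  · rw [h2]
    refine h1.trans ?_
    calc _ ≤ K₀ * Real.exp (v * (|t| - T)) + 2 * w * (K₀ / v * Real.exp (v * (|t| - T))) := by
          gcongr
          · exact sub_nonneg.2 (by gcongr; exact abs_nonneg t)
          · rw [sub_le_self_iff]
            positivity
      _ = K₀ * (1 + 2 * w / v) * Real.exp (v * (|t| - T)) := by field_simp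
      _ ≤ _ := by gcongr

/-- Duhamel's formula integrates the polynomial once, which raises the degree from `k` to `k + 1`.
-/
lemma norm_groundAverage_sub_le_of_pow {G : ℝ → Fin d → ι → ℂ} {E : ℝ → Fin d → ℝ}
    (hH : H.IsHermitian) (hV : V.IsHermitian) (hS : S.IsHermitian) (hΔ : 0 < Δ) (hd : 0 < d)
    (hG : IsGappedPath H V Δ G E) {w K₀ : ℝ} {k : ℕ} (hw : ‖V‖ ≤ w) (hK₀ : 0 ≤ K₀)
    (hlr : ∀ t, ‖heisenberg H S t * V - V * heisenberg H S t‖ ≤ K₀ * (1 + |t|) ^ k) :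
    ‖groundAverage (G 1) S - groundAverage (G 0) S‖ ≤ K₀ * (1 + 2 * w) *
      ((k + 1).factorial * (8 / Δ) ^ (k + 2) * Real.exp (Δ / 4)) := by
  have hw0 : 0 ≤ w := (norm_nonneg V).trans hw
  refine norm_groundAverage_sub_le (g := fun t => K₀ * (1 + 2 * w) * (1 + |t|) ^ (k + 1))
    hH hV hS hΔ hd hG (fun u hu t => ?_)
    (fun J _ c w' h1 h2 => norm_resolventSum_zero_le_of_pow (by positivity) hΔ h1 h2)
  have h1 := norm_commutator_heisenberg_add_smul_le (S := S) hH hV (c := u)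
    (by rw [abs_of_nonneg hu.1]; exact hu.2)
    (b := fun t => K₀ / (k + 1) * (1 + t) ^ (k + 1)) (b' := fun t => K₀ * (1 + t) ^ k)
    (fun t => by
      have h2 : HasDerivAt (fun t : ℝ => 1 + t) 1 t := (hasDerivAt_id t).const_add 1
      refine ((h2.pow (k + 1)).const_mul (K₀ / (k + 1))).congr_deriv ?_
      push_cast
      field_simp) hlr t
  refine h1.trans ?_
  have ht : (1 : ℝ) ≤ 1 + |t| := by linarith [abs_nonneg t]
  have h3 : K₀ / (k + 1) * (1 + |t|) ^ (k + 1) - K₀ / (k + 1) * (1 + 0) ^ (k + 1) ≤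
      K₀ * (1 + |t|) ^ (k + 1) := by
    have : K₀ / (k + 1) ≤ K₀ := div_le_self hK₀ (by linarith [k.cast_nonneg (α := ℝ)])
    calc _ ≤ K₀ / (k + 1) * (1 + |t|) ^ (k + 1) := by
          rw [sub_le_self_iff]; positivity
      _ ≤ _ := by gcongr
  calc _ ≤ K₀ * (1 + |t|) ^ (k + 1) + 2 * w * (K₀ * (1 + |t|) ^ (k + 1)) := by
        refine add_le_add (mul_le_mul_of_nonneg_left (pow_le_pow_right₀ ht k.le_succ) hK₀)
          (mul_le_mul (by gcongr) h3 ?_ (by positivity))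
        rw [← mul_sub]
        exact mul_nonneg (by positivity) (sub_nonneg.2 (by gcongr; exact abs_nonneg t))
    _ = _ := by ring

end PerturbedEvolution

/-! ### Response bounds for the three classes of interactions -/

section Response

variable {M : Model L} {Φ : Interaction M}

lemma isNonnegQuadratic_linear {a b : ℝ} (ha : 0 ≤ a) (hb : 0 ≤ b) :
    IsNonnegQuadratic (Polynomial.C a * Polynomial.X + Polynomial.C b) := by
  refine ⟨Polynomial.natDegree_linear_le.trans one_le_two, fun n => ?_⟩
  rcases n with _ | _ | n
  · simpa using hb
  · simpa using ha
  · simp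

/-- The front arrives at `T = (α / v) log r`, since `exp(v t) / r ^ α = exp(v (t - T))`. The factor
`1 + T` becomes a polynomial of degree one in `log r`. -/
theorem exists_lpplBound_of_powerLR (D : ℕ) (κ : ℝ) {α v C Δ : ℝ} (hα : 0 < α) (hv : 0 < v)
    (hC : 0 < C) (hΔ : 0 < Δ) (p q : ℕ) (s w : ℝ) :
    ∃ P : Polynomial ℝ, IsNonnegQuadratic P ∧
      ∀ (L : Lattice D κ) (M : Model L) (Φ : Interaction M), HasLiebRobinson Φ (powerLR α C v) →
        LPPLBound Φ Δ p q s w (fun r => P.eval (Real.log r) / r ^ powerExponent α v Δ) := by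
  obtain ⟨K, hK, h⟩ := exists_norm_groundAverage_sub_le_of_front hv hΔ
  set K₀ := (p : ℝ) * q * |s| * |w| * C with hK₀
  set A := (2 * |s| * |w| + K₀ * (1 + 2 * |w| / v)) * K with hA
  have hA0 : 0 ≤ A := by positivity
  refine ⟨Polynomial.C (A * (α / v)) * Polynomial.X + Polynomial.C A,
    isNonnegQuadratic_linear (by positivity) hA0, ?_⟩
  intro L M Φ hLR X Y hX hY hXY hXp hYq S hS hSh hSs V hV hVh hVw d G E hd hG
  have hr1 := one_le_regionDist hX hY hXY
  set r := regionDist X Y with hr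
  have hr0 : 0 < r := by linarith
  have hlog : 0 ≤ Real.log r := Real.log_nonneg hr1
  have hXp' : (X.card : ℝ) ≤ p := by exact_mod_cast hXp
  have hYq' : (Y.card : ℝ) ≤ q := by exact_mod_cast hYq
  have hSs' : ‖S‖ ≤ |s| := hSs.trans (le_abs_self s)
  have hVw' : ‖V‖ ≤ |w| := hVw.trans (le_abs_self w)
  have h1 := h (T := α / v * Real.log r) Φ.hamiltonian_isHermitian hVh hSh hd hG hSs' hVw'
    (K₀ := K₀) (by positivity) (by positivity) (fun t => by
      refine (hLR X Y hX hY hXY S hS V hV t).trans ?_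
      have e : powerLR α C v r |t| = C * Real.exp (v * (|t| - α / v * Real.log r)) := by
        rw [powerLR, Real.rpow_def_of_pos hr0, mul_div_assoc, ← Real.exp_sub]
        congr 2
        field_simp
      rw [e, hK₀, ← mul_assoc]
      gcongr)
  refine h1.trans (le_of_eq ?_)
  have e : 2 * v / Real.pi * Real.arcsin (Real.tanh (Δ * Real.pi / (2 * v))) *
      (α / v * Real.log r) = Real.log r * powerExponent α v Δ := by
    rw [powerExponent]; field_simp
  rw [e, Real.exp_neg, ← Real.rpow_def_of_pos hr0, ← div_eq_mul_inv]
  simp only [Polynomial.eval_add, Polynomial.eval_mul, Polynomial.eval_C, Polynomial.eval_X]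
  congr 1
  rw [hA]
  ring

/-- The front has growth rate `ν v` and arrives at `T = r / v`. -/
theorem exists_lpplBound_of_expLR (D : ℕ) (κ : ℝ) {ν v C Δ : ℝ} (hν : 0 < ν) (hv : 0 < v)
    (hC : 0 < C) (hΔ : 0 < Δ) (p q : ℕ) (s w : ℝ) :
    ∃ P : Polynomial ℝ, IsNonnegQuadratic P ∧
      ∀ (L : Lattice D κ) (M : Model L) (Φ : Interaction M), HasLiebRobinson Φ (expLR ν C v) →
        LPPLBound Φ Δ p q s w (fun r => P.eval r * Real.exp (-expRate ν v Δ * r)) := by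
  obtain ⟨K, hK, h⟩ := exists_norm_groundAverage_sub_le_of_front (mul_pos hν hv) hΔ
  set K₀ := (p : ℝ) * q * |s| * |w| * C with hK₀
  set A := (2 * |s| * |w| + K₀ * (1 + 2 * |w| / (ν * v))) * K with hA
  have hA0 : 0 ≤ A := by positivity
  refine ⟨Polynomial.C (A * (1 / v)) * Polynomial.X + Polynomial.C A,
    isNonnegQuadratic_linear (by positivity) hA0, ?_⟩
  intro L M Φ hLR X Y hX hY hXY hXp hYq S hS hSh hSs V hV hVh hVw d G E hd hG
  have hr1 := one_le_regionDist hX hY hXY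
  set r := regionDist X Y with hr
  have hr0 : 0 < r := by linarith
  have hXp' : (X.card : ℝ) ≤ p := by exact_mod_cast hXp
  have hYq' : (Y.card : ℝ) ≤ q := by exact_mod_cast hYq
  have hSs' : ‖S‖ ≤ |s| := hSs.trans (le_abs_self s)
  have hVw' : ‖V‖ ≤ |w| := hVw.trans (le_abs_self w)
  have h1 := h (T := r / v) Φ.hamiltonian_isHermitian hVh hSh hd hG hSs' hVw'
    (K₀ := K₀) (by positivity) (by positivity) (fun t => by
      refine (hLR X Y hX hY hXY S hS V hV t).trans ?_
      have e : expLR ν C v r |t| = C * Real.exp (ν * v * (|t| - r / v)) := by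
        rw [expLR]
        congr 2
        field_simp
        ring
      rw [e, hK₀, ← mul_assoc]
      gcongr)
  refine h1.trans (le_of_eq ?_)
  have e : -(2 * (ν * v) / Real.pi * Real.arcsin (Real.tanh (Δ * Real.pi / (2 * (ν * v)))) *
      (r / v)) = -expRate ν v Δ * r := by
    rw [expRate, ← mul_assoc 2 ν v]; field_simp
  rw [e]
  simp only [Polynomial.eval_add, Polynomial.eval_mul, Polynomial.eval_C, Polynomial.eval_X]
  congr 1
  rw [hA]
  ring

theorem exists_lpplBound_of_twoBody (D : ℕ) (κ h₀ : ℝ) {α : ℝ} (hα : 2 * (D : ℝ) < α) (R : ℝ)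
    {Δ : ℝ} (hΔ : 0 < Δ) (p q : ℕ) (s w : ℝ) :
    ∃ C : ℝ, 0 < C ∧ ∀ (L : Lattice D κ) (M : Model L) (Φ : Interaction M),
      Φ.DecaysLike (fun r => h₀ / r ^ α) → Φ.IsTwoBody R →
        LPPLBound Φ Δ p q s w (fun r => C / r ^ α) := by
  obtain ⟨K, k, hK, h⟩ := exists_lieb_robinson_two_body D κ h₀ hα R p
  set F := (1 + 2 * |w|) * ((k + 1).factorial * (8 / Δ) ^ (k + 2) * Real.exp (Δ / 4)) with hF
  have hF0 : 0 < F := by positivity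
  -- The summand 1 keeps the constant positive when `q`, `s` or `w` vanishes.
  refine ⟨K * q * |s| * |w| * F + 1, by positivity, ?_⟩
  intro L M Φ hΦ hR X Y hX hY hXY hXp hYq S hS hSh hSs V hV hVh hVw d G E hd hG
  have hr1 := one_le_regionDist hX hY hXY
  have h2 := h L M Φ hΦ hR X Y hX hY hXY hXp S hS V hV
  simp only
  set r := regionDist X Y with hr
  have hr0 : 0 < r := by linarith
  have hYq' : (Y.card : ℝ) ≤ q := by exact_mod_cast hYq
  have hSs' : ‖S‖ ≤ |s| := hSs.trans (le_abs_self s)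
  have hVw' : ‖V‖ ≤ |w| := hVw.trans (le_abs_self w)
  have h3 := norm_groundAverage_sub_le_of_pow Φ.hamiltonian_isHermitian hVh hSh hΔ hd hG hVw'
    (K₀ := K * q * |s| * |w| / r ^ α) (k := k) (by positivity) (fun t => by
      refine (h2 t).trans ?_
      rw [div_mul_eq_mul_div]
      gcongr)
  refine h3.trans ?_
  rw [mul_assoc _ (1 + 2 * |w|), ← hF, div_mul_eq_mul_div]
  gcongr
  linarith

end Response

end LPPL

end

theorem mainTheorem5 (D : ℕ) (hD : 0 < D) (κ h₀ : ℝ) :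
    -- the derivative of the averaged expectation value along a gapped path
    (∀ (L : LPPL.Lattice D κ) (M : LPPL.Model L) (H V S : M.Op),
      H.IsHermitian → V.IsHermitian → S.IsHermitian →
      ∀ (Δ : ℝ) (d : ℕ) (G : ℝ → Fin d → M.Config → ℂ) (E : ℝ → Fin d → ℝ), 0 < Δ → 0 < d →
        LPPL.IsGappedPath H V Δ G E →
        ∀ u ∈ Set.Icc (0 : ℝ) 1,
          HasDerivWithinAt (fun x => LPPL.groundAverage (G x) S)
            (-(LPPL.linearResponse (H + (u : ℂ) • V) V S (G u) (E u) +
              starRingEnd ℂ (LPPL.linearResponse (H + (u : ℂ) • V) V S (G u) (E u))))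
            (Set.Icc 0 1) u) ∧
    -- power-law interactions, `α > D`: Lieb-Robinson constants exist, and any such `v` can be used
    (∀ α : ℝ, (D : ℝ) < α →
      (∃ v C : ℝ, 0 < v ∧ 0 < C ∧
        ∀ (L : LPPL.Lattice D κ) (M : LPPL.Model L) (Φ : LPPL.Interaction M),
          Φ.DecaysLike (fun r => h₀ / r ^ α) →
            LPPL.HasLiebRobinson Φ (LPPL.powerLR α C v)) ∧
      (∀ (v C Δ : ℝ), 0 < v → 0 < C → 0 < Δ → ∀ (p q : ℕ) (s w : ℝ),
        ∃ P : Polynomial ℝ, LPPL.IsNonnegQuadratic P ∧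
          ∀ (L : LPPL.Lattice D κ) (M : LPPL.Model L) (Φ : LPPL.Interaction M),
            Φ.DecaysLike (fun r => h₀ / r ^ α) →
            LPPL.HasLiebRobinson Φ (LPPL.powerLR α C v) →
              LPPL.LPPLBound Φ Δ p q s w
                (fun r => P.eval (Real.log r) / r ^ LPPL.powerExponent α v Δ))) ∧
    -- two-body power-law interactions, `α > 2 D`
    (∀ α : ℝ, 2 * (D : ℝ) < α →
      ∀ (R Δ : ℝ), 0 < Δ → ∀ (p q : ℕ) (s w : ℝ),
        ∃ C : ℝ, 0 < C ∧
          ∀ (L : LPPL.Lattice D κ) (M : LPPL.Model L) (Φ : LPPL.Interaction M),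
            Φ.DecaysLike (fun r => h₀ / r ^ α) → Φ.IsTwoBody R →
              LPPL.LPPLBound Φ Δ p q s w (fun r => C / r ^ α)) ∧
    -- exponentially decaying interactions: as for power laws, with `ν` the rate in the
    -- Lieb-Robinson bound
    (∀ μ : ℝ, 0 < μ →
      (∀ ν : ℝ, 0 < ν → ν < μ →
        ∃ v C : ℝ, 0 < v ∧ 0 < C ∧
          ∀ (L : LPPL.Lattice D κ) (M : LPPL.Model L) (Φ : LPPL.Interaction M),
            Φ.DecaysLike (fun r => h₀ * Real.exp (-μ * r)) →
              LPPL.HasLiebRobinson Φ (LPPL.expLR ν C v)) ∧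
      (∀ (ν v C Δ : ℝ), 0 < ν → 0 < v → 0 < C → 0 < Δ → ∀ (p q : ℕ) (s w : ℝ),
        ∃ P : Polynomial ℝ, LPPL.IsNonnegQuadratic P ∧
          ∀ (L : LPPL.Lattice D κ) (M : LPPL.Model L) (Φ : LPPL.Interaction M),
            Φ.DecaysLike (fun r => h₀ * Real.exp (-μ * r)) →
            LPPL.HasLiebRobinson Φ (LPPL.expLR ν C v) →
              LPPL.LPPLBound Φ Δ p q s w
                (fun r => P.eval r * Real.exp (-LPPL.expRate ν v Δ * r)))) := by
  refine ⟨?_, fun α hα => ⟨?_, ?_⟩, ?_, fun μ hμ => ⟨?_, ?_⟩⟩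
  · intro L M H V S hH hV hS Δ d G E hΔ hd hG u hu
    exact LPPL.hasDerivWithinAt_groundAverage hH hV hS hΔ hd hG hu
  · exact LPPL.exists_hasLiebRobinson_powerLR D κ h₀ hα
  · intro v C Δ hv hC hΔ p q s w
    have hα0 : 0 < α := (Nat.cast_nonneg D).trans_lt hα
    obtain ⟨P, hP, h⟩ := LPPL.exists_lpplBound_of_powerLR D κ hα0 hv hC hΔ p q s w
    exact ⟨P, hP, fun L M Φ _ hLR => h L M Φ hLR⟩
  · intro α hα R Δ hΔ p q s w
    exact LPPL.exists_lpplBound_of_twoBody D κ h₀ hα R hΔ p q s w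
  · intro ν hν hνμ
    exact LPPL.exists_hasLiebRobinson_expLR D κ h₀ hν hνμ
  · intro ν v C Δ hν hv hC hΔ p q s w
    obtain ⟨P, hP, h⟩ := LPPL.exists_lpplBound_of_expLR D κ hν hv hC hΔ p q s w
    exact ⟨P, hP, fun L M Φ _ hLR => h L M Φ hLR⟩
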